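/- Let $M$ be a smooth $7$-manifold with a contact Calabi–Yau structure $(g_0,\eta_0,\Upsilon_0)$. Here $(M,g_0,\eta_0)$ is Sasakian, i.e. there are a vector field $\xi_0$ and a field of endomorphisms $\Phi_0$ of $TM$ with $\eta_0(\xi_0)=1$, $\Phi_0^2=-\mathrm{id}+\eta_0\otimes\xi_0$, $g_0(\Phi_0X,\Phi_0Y)=g_0(X,Y)-\eta_0(X)\eta_0(Y)$ and $[\Phi_0X,\Phi_0Y]+\Phi_0^2[X,Y]-\Phi_0[\Phi_0X,Y]-\Phi_0[X,\Phi_0Y]+d\eta_0(X,Y)\,\xi_0=0$, normalised so that $\omega_0:=d\eta_0$ is the transverse Kähler form, $\omega_0(X,Y)=g_0(\Phi_0X,Y)$; and $\Upsilon_0$ is a nowhere vanishing complex $3$-form with $\xi_0\lrcorner\Upsilon_0=0$, of type $(3,0)$ with respect to $\Phi_0$ on $\mathcal D_0=\ker\eta_0$, such that $d\Upsilon_0=0$ and $\Upsilon_0\wedge\overline{\Upsilon_0}=-\tfrac{4i}{3}\,\omega_0^3$. All these objects are smooth. Let $g_{\mathcal D_0}=g_0-\eta_0^2$ be the transverse metric.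 Let $f_t,h_t$ be real functions of the parameter $t\in\mathbb R$ alone (constant on $M$ for each $t$), and consider any $t$ with $f_t\neq0$ and $h_t\neq0$. Then the $3$-form $$\varphi_t=f_th_t^2\,\eta_0\wedge\omega_0+h_t^3\,\mathrm{Re}\,\Upsilon_0$$ is a $\mathrm G_2$-structure, i.e. there is exactly one smooth Riemannian metric $g_t$ on $M$ such that $(X\lrcorner\varphi_t)\wedge(Y\lrcorner\varphi_t)\wedge\varphi_t=6\,g_t(X,Y)\,\mathrm{vol}_t$ for all $X,Y$, where $\mathrm{vol}_t$ is the volume form of $g_t$ for the orientation determined by $\varphi_t$; and the Ricci tensor of $g_t$ is $$\mathrm{Ric}_t=\frac{3f_t^4}{2h_t^4}\,\eta_0^2-\frac{f_t^2}{2h_t^2}\,g_{\mathcal D_0}.$$ -/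

import Mathlib

open scoped Manifold ContDiff Topology
open Bundle

noncomputable section

namespace ContactCY

/-- The model space of `7`-dimensional manifolds. -/
abbrev E7 : Type := EuclideanSpace ℝ (Fin 7)

/-! ### Exterior algebra of a vector space -/

section Algebra

variable {V A : Type*} [AddCommGroup V] [Module ℝ V] [CommRing A] [Algebra ℝ A]

/-- The wedge product of alternating forms with values in a commutative algebra, normalised as the
sum over shuffles, so `(α ∧ β) (u, v) = α u * β v - α v * β u` for `1`-forms. -/
def wedge {p q : ℕ} (α : V [⋀^Fin p]→ₗ[ℝ] A) (β : V [⋀^Fin q]→ₗ[ℝ] A) :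
    V [⋀^Fin (p + q)]→ₗ[ℝ] A :=
  ((LinearMap.mul' ℝ A).compAlternatingMap (α.domCoprod β)).domDomCongr finSumFinEquiv

/-- The real part of a complex valued form. -/
def rePart {p : ℕ} (α : V [⋀^Fin p]→ₗ[ℝ] ℂ) : V [⋀^Fin p]→ₗ[ℝ] ℝ :=
  Complex.reLm.compAlternatingMap α

/-- The complex conjugate of a complex valued form. -/
def conjForm {p : ℕ} (α : V [⋀^Fin p]→ₗ[ℝ] ℂ) : V [⋀^Fin p]→ₗ[ℝ] ℂ :=
  Complex.conjAe.toLinearMap.compAlternatingMap α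

/-- `vol` is one of the two volume forms of the inner product `b` on a `7`-dimensional space: it is
`1` or `-1` on every orthonormal frame. -/
def IsUnitVolume (b : V → V → ℝ) (vol : V [⋀^Fin 7]→ₗ[ℝ] ℝ) : Prop :=
  ∀ e : Fin 7 → V, (∀ i j, b (e i) (e j) = if i = j then 1 else 0) → |vol e| = 1

end Algebra

section Manifold

variable {M : Type*} [TopologicalSpace M] [ChartedSpace E7 M]

variable (M) in
/-- Differential `p`-forms on `M` with values in `F` (no regularity imposed). -/
abbrev DForm (p : ℕ) (F : Type*) [NormedAddCommGroup F] [NormedSpace ℝ F] : Type _ :=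
  ∀ x : M, TangentSpace (𝓡 7) x [⋀^Fin p]→L[ℝ] F

/-! ### Expressions in charts -/

/-- The point with coordinates `y` in the chart at `x₀`. -/
def chartPoint (x₀ : M) (y : E7) : M := (extChartAt (𝓡 7) x₀).symm y

/-- The coordinate frame at the point with coordinates `y`: the differential of the inverse of the
chart at `x₀`. -/
def chartFrame (x₀ : M) (y : E7) : E7 →L[ℝ] TangentSpace (𝓡 7) (chartPoint x₀ y) :=
  mfderiv 𝓘(ℝ, E7) (𝓡 7) (extChartAt (𝓡 7) x₀).symm y

/-- The components of tangent vectors at `x` in the chart at `x₀`: the differential of the chart. -/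
def chartCoframe (x₀ x : M) : TangentSpace (𝓡 7) x →L[ℝ] E7 :=
  mfderiv (𝓡 7) 𝓘(ℝ, E7) (extChartAt (𝓡 7) x₀) x

/-- The coordinate expression of a form in the chart at `x₀`. -/
def chartForm {p : ℕ} {F : Type*} [NormedAddCommGroup F] [NormedSpace ℝ F]
    (α : DForm M p F) (x₀ : M) (y : E7) : E7 [⋀^Fin p]→L[ℝ] F :=
  (α (chartPoint x₀ y)).compContinuousLinearMap (chartFrame x₀ y)

/-- The coordinate expression of a vector field in the chart at `x₀`. -/
def chartVec (ξ : ∀ x : M, TangentSpace (𝓡 7) x) (x₀ : M) (y : E7) : E7 :=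
  chartCoframe x₀ (chartPoint x₀ y) (ξ (chartPoint x₀ y))

/-- The coordinate expression of a field of endomorphisms in the chart at `x₀`. -/
def chartEndo (Φ : ∀ x : M, TangentSpace (𝓡 7) x →L[ℝ] TangentSpace (𝓡 7) x) (x₀ : M) (y : E7) :
    E7 →L[ℝ] E7 :=
  (chartCoframe x₀ (chartPoint x₀ y)).comp ((Φ (chartPoint x₀ y)).comp (chartFrame x₀ y))

/-- A form is smooth if its expressions in the charts are. -/
def SmoothForm {p : ℕ} {F : Type*} [NormedAddCommGroup F] [NormedSpace ℝ F]
    (α : DForm M p F) : Prop :=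
  ∀ x₀ : M, ContDiffOn ℝ ∞ (chartForm α x₀) (extChartAt (𝓡 7) x₀).target

/-- `β = dα`, in every chart. -/
def HasExtDeriv {p : ℕ} {F : Type*} [NormedAddCommGroup F] [NormedSpace ℝ F]
    (α : DForm M p F) (β : DForm M (p + 1) F) : Prop :=
  ∀ x₀ : M, ∀ y ∈ (extChartAt (𝓡 7) x₀).target, extDeriv (chartForm α x₀) y = chartForm β x₀ y

/-! ### Riemannian metrics and their Ricci tensor -/

variable (M) in
/-- Smooth Riemannian metrics on `M`. -/
abbrev RiemMetric [IsManifold (𝓡 7) ∞ M] : Type _ :=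
  ContMDiffRiemannianMetric (𝓡 7) ∞ E7 (fun x : M => TangentSpace (𝓡 7) x)

/-- The partial derivative `∂ᵢ u`. -/
def partialDeriv (i : Fin 7) (u : E7 → ℝ) (y : E7) : ℝ :=
  fderiv ℝ u y (EuclideanSpace.single i 1)

variable [IsManifold (𝓡 7) ∞ M]

/-- The components `gᵢⱼ` of a metric in the chart at `x₀`. -/
def metricCoeff (g : RiemMetric M) (x₀ : M) (y : E7) : Matrix (Fin 7) (Fin 7) ℝ :=
  Matrix.of fun i j => g.inner (chartPoint x₀ y)
    (chartFrame x₀ y (EuclideanSpace.single i 1)) (chartFrame x₀ y (EuclideanSpace.single j 1))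

/-- The Christoffel symbols `Γᵏᵢⱼ = ½ gᵏˡ (∂ᵢ gⱼₗ + ∂ⱼ gᵢₗ - ∂ₗ gᵢⱼ)` of the Levi-Civita
connection in the chart at `x₀`. -/
def christoffel (g : RiemMetric M) (x₀ : M) (k i j : Fin 7) (y : E7) : ℝ :=
  (1 / 2) * ∑ l, (metricCoeff g x₀ y)⁻¹ k l *
    (partialDeriv i (fun z => metricCoeff g x₀ z j l) y
      + partialDeriv j (fun z => metricCoeff g x₀ z i l) y
      - partialDeriv l (fun z => metricCoeff g x₀ z i j) y)

/-- The components `Rᵢⱼ = ∂ₖ Γᵏᵢⱼ - ∂ⱼ Γᵏᵢₖ + Γᵏₖₗ Γˡᵢⱼ - Γᵏⱼₗ Γˡᵢₖ` of the Ricci tensor in the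
chart at `x₀` (positive on round spheres). -/
def ricciCoeff (g : RiemMetric M) (x₀ : M) (i j : Fin 7) (y : E7) : ℝ :=
  ∑ k, (partialDeriv k (christoffel g x₀ k i j) y - partialDeriv j (christoffel g x₀ k i k) y
    + ∑ l, (christoffel g x₀ k k l y * christoffel g x₀ l i j y
      - christoffel g x₀ k j l y * christoffel g x₀ l i k y))

/-- The Ricci tensor of `g` at `x`, computed in the chart at `x`. -/
def ricci (g : RiemMetric M) (x : M) (v w : TangentSpace (𝓡 7) x) : ℝ :=
  ∑ i, ∑ j, ricciCoeff g x i j (extChartAt (𝓡 7) x x) * chartCoframe x x v i * chartCoframe x x w j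

/-! ### `G₂`-structures -/

/-- The `3`-form `φ` is a `G₂`-structure with metric `g`: at every point
`(X ⌟ φ) ∧ (Y ⌟ φ) ∧ φ = 6 g(X, Y) vol` for all `X`, `Y`, where `vol` is the volume form of `g` for
one of the two orientations. (`φ` also determines the orientation, hence `vol`.) -/
def InducesMetric (φ : ∀ x : M, TangentSpace (𝓡 7) x [⋀^Fin 3]→ₗ[ℝ] ℝ) (g : RiemMetric M) : Prop :=
  ∀ x : M, ∃ vol : TangentSpace (𝓡 7) x [⋀^Fin 7]→ₗ[ℝ] ℝ,
    IsUnitVolume (fun v w => g.inner x v w) vol ∧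
    ∀ X Y : TangentSpace (𝓡 7) x,
      wedge (wedge ((φ x).curryLeft X) ((φ x).curryLeft Y)) (φ x) = (6 * g.inner x X Y) • vol

/-! ### Contact Calabi-Yau manifolds -/

variable (M) in
/-- A Sasakian structure, i.e. a normal contact metric structure `(g, η, ξ, Φ)`, with the
normalisation in which `dη` itself is the transverse Kähler form: `dη(X, Y) = g(Φ X, Y)`. -/
structure SasakianStructure where
  /-- the Riemannian metric -/
  g : RiemMetric M
  /-- the contact form -/
  η : DForm M 1 ℝ
  /-- the transverse Kähler form `ω = dη` -/
  dη : DForm M 2 ℝ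
  /-- the Reeb field -/
  ξ : ∀ x : M, TangentSpace (𝓡 7) x
  /-- the transverse complex structure, extended by `Φ ξ = 0` -/
  Φ : ∀ x : M, TangentSpace (𝓡 7) x →L[ℝ] TangentSpace (𝓡 7) x
  smooth_η : SmoothForm η
  smooth_ξ : ContMDiff (𝓡 7) (𝓡 7).tangent ∞ (fun x => (⟨x, ξ x⟩ : TangentBundle (𝓡 7) M))
  smooth_Φ : ContMDiff (𝓡 7) ((𝓡 7).prod 𝓘(ℝ, E7 →L[ℝ] E7)) ∞
    (fun x => TotalSpace.mk' (E7 →L[ℝ] E7)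
      (E := fun x : M => TangentSpace (𝓡 7) x →L[ℝ] TangentSpace (𝓡 7) x) x (Φ x))
  hasExtDeriv_η : HasExtDeriv η dη
  η_ξ : ∀ x, η x ![ξ x] = 1
  Φ_sq : ∀ x (v : TangentSpace (𝓡 7) x), Φ x (Φ x v) = -v + η x ![v] • ξ x
  compatible : ∀ x (v w : TangentSpace (𝓡 7) x),
    g.inner x (Φ x v) (Φ x w) = g.inner x v w - η x ![v] * η x ![w]
  dη_eq : ∀ x (v w : TangentSpace (𝓡 7) x), dη x ![v, w] = g.inner x (Φ x v) w
  /-- `[Φ U, Φ V] + Φ² [U, V] - Φ [Φ U, V] - Φ [U, Φ V] + dη(U, V) ξ = 0`. The left side is a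
  tensor, so it is enough to let `U`, `V` be constant in a chart. -/
  normal : ∀ x₀ : M, ∀ y ∈ (extChartAt (𝓡 7) x₀).target, ∀ u v : E7,
    VectorField.lieBracket ℝ (fun z => chartEndo Φ x₀ z u) (fun z => chartEndo Φ x₀ z v) y
      + chartEndo Φ x₀ y (chartEndo Φ x₀ y
          (VectorField.lieBracket ℝ (fun _ => u) (fun _ => v) y))
      - chartEndo Φ x₀ y (VectorField.lieBracket ℝ (fun z => chartEndo Φ x₀ z u) (fun _ => v) y)
      - chartEndo Φ x₀ y (VectorField.lieBracket ℝ (fun _ => u) (fun z => chartEndo Φ x₀ z v) y)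
      + chartForm dη x₀ y ![u, v] • chartVec ξ x₀ y = 0

variable (M) in
/-- A contact Calabi-Yau structure on a `7`-manifold: a Sasakian structure with a nowhere vanishing
closed transversal `(3,0)`-form `Υ` such that `Υ ∧ Ῡ = -(4 i / 3) ω³`, where `ω = dη`. -/
structure ContactCalabiYau extends SasakianStructure M where
  /-- the transverse holomorphic volume form -/
  Υ : DForm M 3 ℂ
  smooth_Υ : SmoothForm Υ
  Υ_ne_zero : ∀ x, Υ x ≠ 0
  /-- `ξ ⌟ Υ = 0` -/
  transversal : ∀ x (v w : TangentSpace (𝓡 7) x), Υ x ![ξ x, v, w] = 0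
  /-- `Υ` is of type `(3,0)` for the complex structure `Φ` of `ker η` -/
  type_three_zero : ∀ x (u v w : TangentSpace (𝓡 7) x),
    Υ x ![Φ x u, v, w] = Complex.I * Υ x ![u, v, w]
  closed_Υ : HasExtDeriv Υ 0
  normalised : ∀ x (v : Fin 6 → TangentSpace (𝓡 7) x),
    wedge (Υ x).toAlternatingMap (conjForm (Υ x).toAlternatingMap) v
      = (-4 * Complex.I / 3) * (wedge (wedge (dη x).toAlternatingMap (dη x).toAlternatingMap)
          (dη x).toAlternatingMap v : ℝ)

/-- The `3`-form `f h² η ∧ dη + h³ Re Υ`. -/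
def ContactCalabiYau.phi (S : ContactCalabiYau M) (f h : ℝ) (x : M) :
    TangentSpace (𝓡 7) x [⋀^Fin 3]→ₗ[ℝ] ℝ :=
  (f * h ^ 2) • wedge (S.η x).toAlternatingMap (S.dη x).toAlternatingMap
    + h ^ 3 • rePart (S.Υ x).toAlternatingMap

/-- The transverse metric `g_D = g - η²`: the metric on `D = ker η`, extended by `0` along `ξ`. -/
def ContactCalabiYau.gD (S : ContactCalabiYau M) (x : M) (v w : TangentSpace (𝓡 7) x) : ℝ :=
  S.g.inner x v w - S.η x ![v] * S.η x ![w]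

end Manifold

end ContactCY

end

/-! The parameter `t` only supplies two nonzero constants `a = f t` and `b = h t`. Put `η' = a η`,
`ξ' = a⁻¹ ξ`, `Υ' = b³ Υ`, `g' = a² η² + b² (g - η²)` and keep `Φ`. This is again a normal contact
metric structure, now with `dη' = c g'(Φ ·, ·)` for `c = a / b²`, and `Υ'` is a closed transversal
(3,0)-form of constant norm for `g'`.

G₂ part. The form is `η' ∧ g'(Φ ·, ·) + Re Υ'`. The normalisation of `Υ` makes `|Υ'(e)| = 1` on
unitary frames of `g'`, and turning one vector by a phase gives `Υ'(e) = 1`. In the orthonormal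
frame `ξ', e₀, Φ e₀, e₁, Φ e₁, e₂, Φ e₂` the form is then the model G₂-form, for which the wedge
identity is a computation (`wedge_modelG2`). Any other solution is a multiple of `g'`, and comparing
volumes forces the factor to be 1 (`metric_unique`).

Ricci part, in a chart. Normality and the formula for `dη'` determine `∇ξ'` and `∇Φ` (`nabla_reeb`,
`nabla_endo`). Subtracting `K = contactTensor` from the Levi-Civita connection therefore leaves a
metric connection `D` for which `ξ'` and `Φ` are parallel, with torsion `c g'(Φ ·, ·) ξ'`. The form
`Υ'` is `D`-parallel too (`covDeriv_eq_zero`): its derivative is `θ ⊗ Υ'`, constant norm makes `θ`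
imaginary, closedness makes it of type (1,0), so `θ = 0`. The curvature of `D` is thus of `su(3)`
type and satisfies the torsion-free Bianchi identity, hence it is Ricci flat
(`trace_curvature_eq_zero`).

Since `K` is `D`-parallel, the Levi-Civita curvature differs from that of `D` only by a torsion term
and terms quadratic in `K`. Their trace is `(3c²/2) η'² - (c²/2) (g' - η'²)` (`trace_ricci`), and `c
= a / b²` turns this into the asserted formula. -/

noncomputable section

namespace ContactCY

/-! ### Explicit expansions of wedge products -/

section WedgeExpansion

open Equiv Finset

/-- Laplace expansion of a signed sum over the permutations of `Fin (n + 1)`. -/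
theorem sum_perm_fin_succ {X N : Type*} [AddCommGroup N] {n : ℕ} (F : (Fin (n + 1) → X) → N)
    (v : Fin (n + 1) → X) :
    ∑ σ : Perm (Fin (n + 1)), Perm.sign σ • F (v ∘ σ) =
      ∑ k : Fin (n + 1), (-1 : ℤˣ) ^ (k : ℕ) •
        ∑ τ : Perm (Fin n), Perm.sign τ • F (Fin.cons (v k) (k.removeNth v ∘ τ)) := by
  rw [Finset.univ_perm_fin_succ, ← Finset.univ_product_univ]
  simp only [Finset.sum_map, Equiv.toEmbedding_apply, Finset.sum_product]
  refine Finset.sum_congr rfl fun k _ => ?_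
  refine Fin.cases ?_ (fun i => ?_) k
  · simp only [Fin.val_zero, pow_zero, one_smul]
    refine Finset.sum_congr rfl fun σ _ => ?_
    rw [Equiv.Perm.decomposeFin.symm_sign, if_pos rfl, one_mul]
    congr 2
    funext j
    refine Fin.cases ?_ (fun j => ?_) j
    · simp
    · simp [Fin.tail]
  -- `decomposeFin` brings the chosen index to the front by a transposition, which disturbs the
  -- order of the others. The cycle restores the order of `removeNth`, and its sign supplies the
  -- missing power of `-1`.
  · rw [Finset.smul_sum, ← Equiv.sum_comp (Equiv.mulLeft i.cycleRange⁻¹)]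
    refine Finset.sum_congr rfl fun σ _ => ?_
    rw [Equiv.Perm.decomposeFin.symm_sign, if_neg (Fin.succ_ne_zero i), Equiv.coe_mulLeft,
      Perm.sign_mul, Perm.sign_inv, Fin.sign_cycleRange, smul_smul, ← mul_assoc, Fin.val_succ, pow_succ']
    congr 2
    funext j
    refine Fin.cases ?_ (fun j => ?_) j
    · simp
    · simp [Fin.removeNth, ← Fin.succAbove_cycleRange]

variable {V A : Type*} [AddCommGroup V] [Module ℝ V] [CommRing A] [Algebra ℝ A]

/-- The wedge product, as a form whose degree is only propositionally the sum of the degrees. -/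
def wedgeCast {p q n : ℕ} (h : p + q = n) (α : V [⋀^Fin p]→ₗ[ℝ] A) (β : V [⋀^Fin q]→ₗ[ℝ] A) :
    V [⋀^Fin n]→ₗ[ℝ] A :=
  (wedge α β).domDomCongr (finCongr h)

theorem wedge_eq_wedgeCast {p q : ℕ} (α : V [⋀^Fin p]→ₗ[ℝ] A) (β : V [⋀^Fin q]→ₗ[ℝ] A) :
    wedge α β = wedgeCast rfl α β := by
  ext v; simp [wedgeCast]

/-- Each shuffle is a coset of `p! q!` permutations with equal contributions. Passing to all
permutations removes the quotient from the definition of the wedge product. -/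
theorem factorial_smul_wedgeCast {p q n : ℕ} (h : p + q = n) (α : V [⋀^Fin p]→ₗ[ℝ] A)
    (β : V [⋀^Fin q]→ₗ[ℝ] A) (v : Fin n → V) :
    (p.factorial * q.factorial) • wedgeCast h α β v =
      ∑ σ : Perm (Fin n), Perm.sign σ • (α (fun i => v (σ (Fin.cast h (Fin.castAdd q i))))
        * β (fun j => v (σ (Fin.cast h (Fin.natAdd p j))))) := by
  subst h
  have key := congrArg (fun T => (LinearMap.mul' ℝ A).compAlternatingMap T
    (fun s => v (finSumFinEquiv s))) (MultilinearMap.domCoprod_alternization_eq α β)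
  simp only [Fintype.card_fin, MultilinearMap.alternatization_apply,
    LinearMap.compAlternatingMap_apply, map_sum, AlternatingMap.smul_apply, map_nsmul] at key
  have h1 : wedgeCast rfl α β v = (LinearMap.mul' ℝ A) ((α.domCoprod β)
      (fun s => v (finSumFinEquiv s))) := by
    simp only [wedgeCast, wedge, AlternatingMap.domDomCongr_apply,
      LinearMap.compAlternatingMap_apply]
    rfl
  rw [h1, ← key, ← Equiv.sum_comp (finSumFinEquiv.permCongr)]
  refine Finset.sum_congr rfl fun σ _ => ?_
  rw [Perm.sign_permCongr]
  have : ∀ (e : ℤˣ) (x : TensorProduct ℝ A A), (LinearMap.mul' ℝ A) (e • x) =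
      e • (LinearMap.mul' ℝ A) x := by
    intro e x
    rcases Int.units_eq_one_or e with rfl | rfl <;> simp
  rw [this]
  congr 1
  simp [Equiv.permCongr_apply]

theorem nsmul_cancel {n : ℕ} (hn : n ≠ 0) {a b : A} (h : n • a = n • b) : a = b := by
  have h' : (n : ℝ) • a = (n : ℝ) • b := by simpa [Nat.cast_smul_eq_nsmul] using h
  have hn' : (n : ℝ) ≠ 0 := by exact_mod_cast hn
  simpa [smul_smul, hn'] using congrArg (fun x => (n : ℝ)⁻¹ • x) h'

/-- The permutation sum is split by the vector that lands in the first slot of `α`. The factor `p +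
1` is the ratio of the factorials on the two sides. -/
theorem succ_smul_wedgeCast {p q n : ℕ} (h : p + 1 + q = n + 1) (h' : p + q = n)
    (α : V [⋀^Fin (p + 1)]→ₗ[ℝ] A) (β : V [⋀^Fin q]→ₗ[ℝ] A) (v : Fin (n + 1) → V) :
    (p + 1) • wedgeCast h α β v =
      ∑ k : Fin (n + 1), (-1 : ℤˣ) ^ (k : ℕ) •
        wedgeCast h' (α.curryLeft (v k)) β (k.removeNth v) := by
  apply nsmul_cancel (n := p.factorial * q.factorial) (by positivity)
  have e1 : (p.factorial * q.factorial) • ((p + 1) • wedgeCast h α β v) =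
      ((p + 1).factorial * q.factorial) • wedgeCast h α β v := by
    rw [smul_smul, Nat.factorial_succ]; congr 1; ring
  rw [e1, factorial_smul_wedgeCast]
  have e2 := sum_perm_fin_succ (fun w : Fin (n + 1) → V =>
    α (fun i => w (Fin.cast h (Fin.castAdd q i))) * β (fun j => w (Fin.cast h (Fin.natAdd _ j)))) v
  refine e2.trans ?_
  rw [Finset.smul_sum]
  refine Finset.sum_congr rfl fun k _ => ?_
  rw [smul_comm, factorial_smul_wedgeCast]
  congr 1
  refine Finset.sum_congr rfl fun τ _ => ?_
  congr 2
  · rw [AlternatingMap.curryLeft_apply_apply]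
    congr 1
    funext i
    refine Fin.cases ?_ (fun i => ?_) i
    · rfl
    · rfl
  · congr 1
    funext j
    have : Fin.cast h (Fin.natAdd (p + 1) j) = Fin.succ (Fin.cast h' (Fin.natAdd p j)) := by
      ext; simp; omega
    rw [this, Fin.cons_succ]
    rfl

theorem wedgeCast_zero_left {q n : ℕ} (h : 0 + q = n) (α : V [⋀^Fin 0]→ₗ[ℝ] A)
    (β : V [⋀^Fin q]→ₗ[ℝ] A) (v : Fin n → V) :
    wedgeCast h α β v = α ![] * β (fun j => v (Fin.cast (by omega) j)) := by
  subst h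
  apply nsmul_cancel (n := (0).factorial * q.factorial) (by positivity)
  rw [factorial_smul_wedgeCast]
  have : ∀ σ : Perm (Fin (0 + q)), Perm.sign σ • (α (fun i => v (σ (Fin.cast rfl (Fin.castAdd q i))))
        * β (fun j => v (σ (Fin.cast rfl (Fin.natAdd 0 j))))) =
        α ![] * β (fun j => v (Fin.cast (by omega) j)) := by
    intro σ
    have h1 : (fun i => v (σ (Fin.cast rfl (Fin.castAdd q i)))) = ![] := Subsingleton.elim _ _
    have h2 := AlternatingMap.map_perm β (fun j => v (Fin.cast (Nat.zero_add q).symm j))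
      ((finCongr (Nat.zero_add q)).permCongr σ)
    rw [Perm.sign_permCongr] at h2
    rw [h1, mul_comm, ← smul_mul_assoc, mul_comm]
    congr 1
    have h3 : (fun j => v (σ (Fin.cast rfl (Fin.natAdd 0 j)))) = (fun j => v (Fin.cast (Nat.zero_add q).symm j)) ∘ ((finCongr (Nat.zero_add q)).permCongr σ) := by
      funext j
      simp [Equiv.permCongr_apply]
    rw [h3, h2, smul_smul]
    rcases Int.units_eq_one_or (Perm.sign σ) with h | h <;> simp [h]
  rw [Finset.sum_congr rfl fun σ _ => this σ]
  simp [Fintype.card_perm]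

theorem wedgeCast_zero_right {p n : ℕ} (h : p + 0 = n) (α : V [⋀^Fin p]→ₗ[ℝ] A)
    (β : V [⋀^Fin 0]→ₗ[ℝ] A) (v : Fin n → V) :
    wedgeCast h α β v = α (fun j => v (Fin.cast h j)) * β ![] := by
  subst h
  apply nsmul_cancel (n := p.factorial * (0).factorial) (by positivity)
  rw [factorial_smul_wedgeCast]
  have : ∀ σ : Perm (Fin (p + 0)), Perm.sign σ • (α (fun i => v (σ (Fin.cast rfl (Fin.castAdd 0 i))))
        * β (fun j => v (σ (Fin.cast rfl (Fin.natAdd p j))))) =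
        α v * β ![] := by
    intro σ
    have h1 : (fun i => v (σ (Fin.cast rfl (Fin.natAdd p i)))) = ![] := Subsingleton.elim _ _
    rw [h1, ← smul_mul_assoc]
    congr 1
    have h2 := AlternatingMap.map_perm α v σ
    have h3 : (fun j => v (σ (Fin.cast rfl (Fin.castAdd 0 j)))) = v ∘ σ := rfl
    rw [h3, h2, smul_smul]
    rcases Int.units_eq_one_or (Perm.sign σ) with h | h <;> simp [h]
  rw [Finset.sum_congr rfl fun σ _ => this σ]
  simp [Fintype.card_perm]

theorem wedgeCast_neg_left {p q n : ℕ} (h : p + q = n) (α : V [⋀^Fin p]→ₗ[ℝ] A)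
    (β : V [⋀^Fin q]→ₗ[ℝ] A) : wedgeCast h (-α) β = -wedgeCast h α β := by
  ext v
  apply nsmul_cancel (n := p.factorial * q.factorial) (by positivity)
  rw [AlternatingMap.neg_apply, smul_neg, factorial_smul_wedgeCast, factorial_smul_wedgeCast]
  simp

theorem curryLeft_curryLeft_comm {n : ℕ} (α : V [⋀^Fin (n + 2)]→ₗ[ℝ] A) (u v : V) :
    (α.curryLeft u).curryLeft v = -(α.curryLeft v).curryLeft u := by
  have h := AlternatingMap.curryLeft_same α (u + v)
  have hu := AlternatingMap.curryLeft_same α u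
  have hv := AlternatingMap.curryLeft_same α v
  simp only [map_add, AlternatingMap.curryLeft_add, LinearMap.add_apply] at h
  rw [hu, hv] at h
  rw [eq_neg_iff_add_eq_zero]
  simpa [add_comm] using h

theorem removeNth_succ_cons {X : Type*} {m : ℕ} (x : X) (w : Fin (m + 1) → X) (k : Fin (m + 1)) :
    (Fin.removeNth (α := fun _ => X) k.succ (Fin.cons x w)) =
      (Fin.cons x (Fin.removeNth (α := fun _ => X) k w) : Fin (m + 1) → X) := by
  funext j
  refine Fin.cases ?_ (fun j => ?_) j
  · simp [Fin.removeNth]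
  · simp [Fin.removeNth]

/-- The contraction with a vector is an antiderivation of the wedge product. -/
theorem wedgeCast_cons (p : ℕ) : ∀ {q n : ℕ} (h : p + 1 + (q + 1) = n + 1) (h₁ : p + (q + 1) = n)
    (h₂ : p + 1 + q = n) (α : V [⋀^Fin (p + 1)]→ₗ[ℝ] A) (β : V [⋀^Fin (q + 1)]→ₗ[ℝ] A)
    (x : V) (w : Fin n → V),
    wedgeCast h α β (Fin.cons x w) = wedgeCast h₁ (α.curryLeft x) β w
      + (-1 : ℤˣ) ^ (p + 1) • wedgeCast h₂ α (β.curryLeft x) w := by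
  induction p with
  | zero =>
    intro q n h h₁ h₂ α β x w
    obtain ⟨m, rfl⟩ : ∃ m, n = m + 1 := ⟨n - 1, by omega⟩
    have e := succ_smul_wedgeCast h h₁ α β (Fin.cons x w)
    rw [Fin.sum_univ_succ] at e
    have e' := succ_smul_wedgeCast h₂ (by omega) α (β.curryLeft x) w
    simp only [zero_add, one_smul] at e e'
    rw [e, e', Finset.smul_sum]
    congr 1
    · simp
    · refine Finset.sum_congr rfl fun k _ => ?_
      rw [wedgeCast_zero_left, wedgeCast_zero_left, Fin.cons_succ, smul_smul, Fin.val_succ,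
        pow_succ', pow_one, removeNth_succ_cons]
      congr 2
      rw [AlternatingMap.curryLeft_apply_apply]
      congr 1
      funext j
      refine Fin.cases ?_ (fun j => ?_) j
      · rfl
      · rfl
  | succ p ih =>
    intro q n h h₁ h₂ α β x w
    obtain ⟨m, rfl⟩ : ∃ m, n = m + 1 := ⟨n - 1, by omega⟩
    apply nsmul_cancel (n := p + 1 + 1) (by positivity)
    have e := succ_smul_wedgeCast h h₁ α β (Fin.cons x w)
    rw [Fin.sum_univ_succ] at e
    have e' := succ_smul_wedgeCast h₂ (by omega) α (β.curryLeft x) w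
    have e'' := succ_smul_wedgeCast h₁ (by omega) (α.curryLeft x) β w
    -- Once `w k` has been inserted in `α`, the vector `x` still heads the remaining list, so the
    -- induction hypothesis contracts it out of a form of lower degree. The exchange of the two
    -- contractions of `α` costs a sign.
    have hk : ∀ k : Fin (m + 1), wedgeCast h₁ (α.curryLeft (w k)) β
        (Fin.removeNth (α := fun _ => V) k.succ (Fin.cons x w)) =
        - wedgeCast (by omega) ((α.curryLeft x).curryLeft (w k)) β (k.removeNth w)
        + (-1 : ℤˣ) ^ (p + 1) • wedgeCast (by omega) (α.curryLeft (w k)) (β.curryLeft x)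
          (k.removeNth w) := by
      intro k
      rw [removeNth_succ_cons, ih h₁ (by omega) (by omega), curryLeft_curryLeft_comm,
        wedgeCast_neg_left, AlternatingMap.neg_apply]
    rw [e, smul_add, smul_comm (p + 1 + 1), e']
    simp only [Fin.cons_succ, hk, smul_add, Finset.sum_add_distrib]
    rw [add_smul _ 1, e'', Finset.smul_sum]
    simp only [Fin.val_zero, pow_zero, one_smul, Fin.cons_zero, Fin.val_succ, smul_smul, smul_neg]
    have h0 : (Fin.removeNth (α := fun _ => V) 0 (Fin.cons x w)) = w := by
      funext j; simp [Fin.removeNth]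
    rw [h0]
    have s1 : ∀ k : ℕ, (-1 : ℤˣ) ^ (k + 1) * (-1) ^ (p + 1) = (-1) ^ (p + 1 + 1) * (-1) ^ k := by
      intro k; rw [← pow_add, ← pow_add]; congr 1; omega
    have s2 : ∀ (k : ℕ) (a : A), -((-1 : ℤˣ) ^ (k + 1) • a) = (-1 : ℤˣ) ^ k • a := by
      intro k a; rw [pow_succ, mul_neg, mul_one, Units.neg_smul, neg_neg]
    simp only [s1, s2]
    abel

/-- With the degree equations derived from `h`, the contraction rule has no side conditions, so
`simp` can iterate it down to degree zero. -/
theorem degree_left {p q n : ℕ} (h : p + 1 + (q + 1) = n + 1) : p + (q + 1) = n := by omega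

theorem degree_right {p q n : ℕ} (h : p + 1 + (q + 1) = n + 1) : p + 1 + q = n := by omega

theorem wedgeCast_vecCons {p q n : ℕ} (h : p + 1 + (q + 1) = n + 1)
    (α : V [⋀^Fin (p + 1)]→ₗ[ℝ] A) (β : V [⋀^Fin (q + 1)]→ₗ[ℝ] A) (x : V) (w : Fin n → V) :
    wedgeCast h α β (Matrix.vecCons x w) =
      wedgeCast (degree_left h) (α.curryLeft x) β w
      + (-1 : ℤˣ) ^ (p + 1) • wedgeCast (degree_right h) α (β.curryLeft x) w :=
  wedgeCast_cons p h _ _ α β x w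

theorem neg_one_units_smul (a : A) : (-1 : ℤˣ) • a = -a := by
  rw [Units.neg_smul, one_smul]

theorem neg_one_units_pow_two_smul (a : A) : (-1 : ℤˣ) ^ 2 • a = a := by
  rw [neg_one_sq, one_smul]

theorem neg_one_units_pow_three_smul (a : A) : (-1 : ℤˣ) ^ 3 • a = -a := by
  rw [pow_succ, neg_one_sq, one_mul, neg_one_units_smul]

theorem neg_one_units_pow_four_smul (a : A) : (-1 : ℤˣ) ^ 4 • a = a := by
  rw [show (-1 : ℤˣ) ^ 4 = 1 from rfl, one_smul]

theorem wedge_one_two (α : V [⋀^Fin 1]→ₗ[ℝ] A) (β : V [⋀^Fin 2]→ₗ[ℝ] A) (u v w : V) :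
    wedge α β ![u, v, w] = α ![u] * β ![v, w] - α ![v] * β ![u, w] + α ![w] * β ![u, v] := by
  rw [wedge_eq_wedgeCast]
  simp only [wedgeCast_vecCons, wedgeCast_zero_left, wedgeCast_zero_right,
    AlternatingMap.curryLeft_apply_apply, Fin.cast_eq_self, zero_add, pow_one, neg_one_units_smul,
    Nat.reduceAdd, smul_add]
  ring

theorem wedge_two_two (α β : V [⋀^Fin 2]→ₗ[ℝ] A) (a b c d : V) :
    wedge α β ![a, b, c, d] =
      α ![a, b] * β ![c, d] - α ![a, c] * β ![b, d] + α ![a, d] * β ![b, c]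
      + α ![b, c] * β ![a, d] - α ![b, d] * β ![a, c] + α ![c, d] * β ![a, b] := by
  rw [wedge_eq_wedgeCast]
  simp only [wedgeCast_vecCons, wedgeCast_zero_left, wedgeCast_zero_right,
    AlternatingMap.curryLeft_apply_apply, Fin.cast_eq_self, zero_add, pow_one, neg_one_units_smul,
    neg_one_units_pow_two_smul, Nat.reduceAdd, smul_add]
  ring

theorem wedge_three_three (α : V [⋀^Fin 3]→ₗ[ℝ] A) (β : V [⋀^Fin 3]→ₗ[ℝ] A)
    (a b c d e f : V) :
    wedge α β ![a, b, c, d, e, f] =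
      α ![a, b, c] * β ![d, e, f] - α ![a, b, d] * β ![c, e, f]
      + α ![a, b, e] * β ![c, d, f] - α ![a, b, f] * β ![c, d, e]
      + α ![a, c, d] * β ![b, e, f] - α ![a, c, e] * β ![b, d, f]
      + α ![a, c, f] * β ![b, d, e] + α ![a, d, e] * β ![b, c, f]
      - α ![a, d, f] * β ![b, c, e] + α ![a, e, f] * β ![b, c, d]
      - α ![b, c, d] * β ![a, e, f] + α ![b, c, e] * β ![a, d, f]
      - α ![b, c, f] * β ![a, d, e] - α ![b, d, e] * β ![a, c, f]
      + α ![b, d, f] * β ![a, c, e] - α ![b, e, f] * β ![a, c, d]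
      + α ![c, d, e] * β ![a, b, f] - α ![c, d, f] * β ![a, b, e]
      + α ![c, e, f] * β ![a, b, d] - α ![d, e, f] * β ![a, b, c] := by
  rw [wedge_eq_wedgeCast]
  simp only [wedgeCast_vecCons, wedgeCast_zero_left, wedgeCast_zero_right,
    AlternatingMap.curryLeft_apply_apply, Fin.cast_eq_self, zero_add, pow_one, neg_one_units_smul,
    neg_one_units_pow_two_smul, neg_one_units_pow_three_smul,
    Nat.reduceAdd, smul_add]
  ring

theorem wedge_four_two (α : V [⋀^Fin 4]→ₗ[ℝ] A) (β : V [⋀^Fin 2]→ₗ[ℝ] A)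
    (a b c d e f : V) :
    wedge α β ![a, b, c, d, e, f] =
      α ![a, b, c, d] * β ![e, f] - α ![a, b, c, e] * β ![d, f]
      + α ![a, b, c, f] * β ![d, e] + α ![a, b, d, e] * β ![c, f]
      - α ![a, b, d, f] * β ![c, e] + α ![a, b, e, f] * β ![c, d]
      - α ![a, c, d, e] * β ![b, f] + α ![a, c, d, f] * β ![b, e]
      - α ![a, c, e, f] * β ![b, d] + α ![a, d, e, f] * β ![b, c]
      + α ![b, c, d, e] * β ![a, f] - α ![b, c, d, f] * β ![a, e]
      + α ![b, c, e, f] * β ![a, d] - α ![b, d, e, f] * β ![a, c]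
      + α ![c, d, e, f] * β ![a, b] := by
  rw [wedge_eq_wedgeCast]
  simp only [wedgeCast_vecCons, wedgeCast_zero_left, wedgeCast_zero_right,
    AlternatingMap.curryLeft_apply_apply, Fin.cast_eq_self, zero_add, pow_one, neg_one_units_smul,
    neg_one_units_pow_two_smul, neg_one_units_pow_three_smul, neg_one_units_pow_four_smul,
    Nat.reduceAdd, smul_add]
  ring

theorem wedge_four_three (α : V [⋀^Fin 4]→ₗ[ℝ] A) (β : V [⋀^Fin 3]→ₗ[ℝ] A)
    (a b c d e f g : V) :
    wedge α β ![a, b, c, d, e, f, g] =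
      α ![a, b, c, d] * β ![e, f, g] - α ![a, b, c, e] * β ![d, f, g]
      + α ![a, b, c, f] * β ![d, e, g] - α ![a, b, c, g] * β ![d, e, f]
      + α ![a, b, d, e] * β ![c, f, g] - α ![a, b, d, f] * β ![c, e, g]
      + α ![a, b, d, g] * β ![c, e, f] + α ![a, b, e, f] * β ![c, d, g]
      - α ![a, b, e, g] * β ![c, d, f] + α ![a, b, f, g] * β ![c, d, e]
      - α ![a, c, d, e] * β ![b, f, g] + α ![a, c, d, f] * β ![b, e, g]
      - α ![a, c, d, g] * β ![b, e, f] - α ![a, c, e, f] * β ![b, d, g]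
      + α ![a, c, e, g] * β ![b, d, f] - α ![a, c, f, g] * β ![b, d, e]
      + α ![a, d, e, f] * β ![b, c, g] - α ![a, d, e, g] * β ![b, c, f]
      + α ![a, d, f, g] * β ![b, c, e] - α ![a, e, f, g] * β ![b, c, d]
      + α ![b, c, d, e] * β ![a, f, g] - α ![b, c, d, f] * β ![a, e, g]
      + α ![b, c, d, g] * β ![a, e, f] + α ![b, c, e, f] * β ![a, d, g]
      - α ![b, c, e, g] * β ![a, d, f] + α ![b, c, f, g] * β ![a, d, e]
      - α ![b, d, e, f] * β ![a, c, g] + α ![b, d, e, g] * β ![a, c, f]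
      - α ![b, d, f, g] * β ![a, c, e] + α ![b, e, f, g] * β ![a, c, d]
      + α ![c, d, e, f] * β ![a, b, g] - α ![c, d, e, g] * β ![a, b, f]
      + α ![c, d, f, g] * β ![a, b, e] - α ![c, e, f, g] * β ![a, b, d]
      + α ![d, e, f, g] * β ![a, b, c] := by
  rw [wedge_eq_wedgeCast]
  simp only [wedgeCast_vecCons, wedgeCast_zero_left, wedgeCast_zero_right,
    AlternatingMap.curryLeft_apply_apply, Fin.cast_eq_self, zero_add, pow_one, neg_one_units_smul,
    neg_one_units_pow_two_smul, neg_one_units_pow_three_smul, neg_one_units_pow_four_smul,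
    Nat.reduceAdd, smul_add]
  ring

end WedgeExpansion

/-! ### Linear algebra of a contact metric structure: adapted frames and (3,0)-forms -/

section ContactLinearAlgebra

variable {V : Type*} [AddCommGroup V] [Module ℝ V]

/-- A symmetric positive definite bilinear form. -/
structure IsMetric (g : V →ₗ[ℝ] V →ₗ[ℝ] ℝ) : Prop where
  symm : ∀ u v, g u v = g v u
  pos : ∀ v, v ≠ 0 → 0 < g v v

theorem IsMetric.eq_zero {g : V →ₗ[ℝ] V →ₗ[ℝ] ℝ} (hg : IsMetric g) {v : V} (h : g v v = 0) :
    v = 0 := by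
  by_contra hv
  exact (hg.pos v hv).ne' h

theorem IsMetric.ext {g : V →ₗ[ℝ] V →ₗ[ℝ] ℝ} (hg : IsMetric g) {u v : V}
    (h : ∀ w, g u w = g v w) : u = v := by
  rw [← sub_eq_zero]
  apply hg.eq_zero
  simp only [map_sub, LinearMap.sub_apply]
  linarith [h u, h v]

theorem exists_basis_of_orthonormal {g : V →ₗ[ℝ] V →ₗ[ℝ] ℝ}
    (hV : Module.finrank ℝ V = 7) (b : Fin 7 → V)
    (hb : ∀ i j, g (b i) (b j) = if i = j then 1 else 0) :
    ∃ B : Module.Basis (Fin 7) ℝ V, (∀ i, B i = b i) ∧ ∀ u i, B.repr u i = g (b i) u := by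
  have hli : LinearIndependent ℝ b := by
    rw [Fintype.linearIndependent_iff]
    intro c hc i
    have := congrArg (g (b i)) hc
    simpa [map_sum, hb] using this
  let B := basisOfLinearIndependentOfCardEqFinrank hli (by simp [hV])
  have hB : ∀ i, B i = b i := fun i => by simp [B]
  refine ⟨B, hB, fun u i => ?_⟩
  conv_rhs => rw [← B.sum_repr u]
  simp [map_sum, hB, hb]

/-- Fewer than seven linear forms have a common nonzero kernel vector, which is then normalised.
This is the Gram-Schmidt step for adapted frames. -/
theorem IsMetric.exists_unit {g : V →ₗ[ℝ] V →ₗ[ℝ] ℝ} (hg : IsMetric g)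
    (hV : Module.finrank ℝ V = 7) {k : ℕ} (hk : k < 7) (L : Fin k → V →ₗ[ℝ] ℝ) :
    ∃ v, g v v = 1 ∧ ∀ i, L i v = 0 := by
  have : FiniteDimensional ℝ V := Module.finite_of_finrank_pos (by omega)
  have h := LinearMap.ker_ne_bot_of_finrank_lt (f := LinearMap.pi L) (by simpa [hV] using hk)
  obtain ⟨v, hv, hv0⟩ := Submodule.exists_mem_ne_zero_of_ne_bot h
  have hp := hg.pos v hv0
  refine ⟨(Real.sqrt (g v v))⁻¹ • v, ?_, fun i => ?_⟩
  · have : Real.sqrt (g v v) ≠ 0 := (Real.sqrt_pos.2 hp).ne'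
    simp only [map_smul, LinearMap.smul_apply, smul_eq_mul]
    field_simp
    rw [Real.sq_sqrt hp.le]
  · have := congrFun (LinearMap.mem_ker.1 hv) i
    simp only [LinearMap.pi_apply, Pi.zero_apply] at this
    simp [this]

/-- The pointwise identities of an almost contact metric structure. -/
structure IsContactMetric (g : V →ₗ[ℝ] V →ₗ[ℝ] ℝ) (η : V →ₗ[ℝ] ℝ) (ξ : V) (Φ : V →ₗ[ℝ] V) : Prop
    extends IsMetric g where
  η_ξ : η ξ = 1
  Φ_sq : ∀ v, Φ (Φ v) = -v + η v • ξ
  compat : ∀ u v, g (Φ u) (Φ v) = g u v - η u * η v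
  skew : ∀ u v, g (Φ u) v = -g u (Φ v)

namespace IsContactMetric

variable {g : V →ₗ[ℝ] V →ₗ[ℝ] ℝ} {η : V →ₗ[ℝ] ℝ} {ξ : V} {Φ : V →ₗ[ℝ] V}
  (S : IsContactMetric g η ξ Φ)

include S

theorem Φ_ξ : Φ ξ = 0 := by
  apply S.eq_zero
  rw [S.skew, S.Φ_sq, S.η_ξ]
  simp

theorem g_ξ (v : V) : g ξ v = η v := by
  have := S.compat ξ v
  rw [S.Φ_ξ, S.η_ξ] at this
  simp at this
  linarith

theorem g_ξ' (v : V) : g v ξ = η v := by rw [S.symm, S.g_ξ]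

theorem η_Φ (v : V) : η (Φ v) = 0 := by
  rw [← S.g_ξ, ← neg_eq_zero, ← S.skew, S.Φ_ξ]; simp

omit S in
/-- `ξ, e₀, Φ e₀, e₁, Φ e₁, e₂, Φ e₂` is orthonormal. -/
structure IsFrame (g : V →ₗ[ℝ] V →ₗ[ℝ] ℝ) (η : V →ₗ[ℝ] ℝ) (Φ : V →ₗ[ℝ] V) (e : Fin 3 → V) :
    Prop where
  orthonormal : ∀ i j, g (e i) (e j) = if i = j then 1 else 0
  isotropic : ∀ i j, g (Φ (e i)) (e j) = 0
  horizontal : ∀ i, η (e i) = 0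

/-- Each new unit vector is taken orthogonal to `ξ`, to the earlier vectors and to their images
under `Φ`, at most five conditions. Skewness of `Φ` provides the remaining orthogonality relations.
-/
theorem exists_frame (hV : Module.finrank ℝ V = 7) : ∃ e, IsFrame g η Φ e := by
  obtain ⟨a, ha, haL⟩ := S.exists_unit hV (by norm_num) ![η]
  obtain ⟨b, hb, hbL⟩ := S.exists_unit hV (by norm_num) ![η, g a, g (Φ a)]
  obtain ⟨c, hc, hcL⟩ := S.exists_unit hV (by norm_num) ![η, g a, g (Φ a), g b, g (Φ b)]
  simp only [Fin.forall_fin_succ, Matrix.cons_val_zero, Matrix.cons_val_succ] at haL hbL hcL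
  have hs : ∀ v, g (Φ v) v = 0 := fun v => by
    have := S.skew v v
    rw [S.symm v] at this
    linarith
  have hab := S.skew b a
  have hac := S.skew c a
  have hbc := S.skew c b
  rw [S.symm _ (Φ _)] at hab hac hbc
  refine ⟨![a, b, c], ⟨fun i j => ?_, fun i j => ?_, fun i => ?_⟩⟩
  · fin_cases i <;> fin_cases j <;> simp [ha, hb, hc, hbL, hcL, S.symm b a, S.symm c]
  · fin_cases i <;> fin_cases j <;> simp [hs, hbL, hcL, hab, hac, hbc]
  · fin_cases i <;> simp [haL, hbL, hcL]

omit S in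
/-- The orthonormal basis of a frame. -/
def frameVec (ξ : V) (Φ : V →ₗ[ℝ] V) (e : Fin 3 → V) : Fin 7 → V :=
  ![ξ, e 0, Φ (e 0), e 1, Φ (e 1), e 2, Φ (e 2)]

theorem frameVec_orthonormal {e : Fin 3 → V} (he : IsFrame g η Φ e) (i j : Fin 7) :
    g (frameVec ξ Φ e i) (frameVec ξ Φ e j) = if i = j then 1 else 0 := by
  have h1 : ∀ i j, g (e i) (Φ (e j)) = 0 := fun i j => by rw [S.symm, he.isotropic]
  fin_cases i <;> fin_cases j <;>
    simp [frameVec, S.compat, S.g_ξ, S.g_ξ', S.η_ξ, S.η_Φ, he.orthonormal, he.isotropic,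
      he.horizontal, h1]

theorem exists_frameBasis (hV : Module.finrank ℝ V = 7) {e : Fin 3 → V} (he : IsFrame g η Φ e) :
    ∃ B : Module.Basis (Fin 7) ℝ V, (∀ i, B i = frameVec ξ Φ e i) ∧
      ∀ u i, B.repr u i = g (frameVec ξ Φ e i) u :=
  exists_basis_of_orthonormal hV _ (S.frameVec_orthonormal he)

theorem expand (hV : Module.finrank ℝ V = 7) {e : Fin 3 → V} (he : IsFrame g η Φ e) (u : V) :
    u = η u • ξ + ∑ k, (g (e k) u • e k + g (Φ (e k)) u • Φ (e k)) := by
  obtain ⟨B, hB, hr⟩ := S.exists_frameBasis hV he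
  conv_lhs => rw [← B.sum_repr u]
  simp only [hB, hr, frameVec, Fin.sum_univ_succ]
  simp [S.g_ξ]
  abel

theorem g_expand (hV : Module.finrank ℝ V = 7) {e : Fin 3 → V} (he : IsFrame g η Φ e) (u v : V) :
    g u v = η u * η v + ∑ k, (g (e k) u * g (e k) v + g (Φ (e k)) u * g (Φ (e k)) v) := by
  conv_lhs => rw [S.expand hV he u]
  simp [map_sum, S.g_ξ]

theorem g_Φ_expand (hV : Module.finrank ℝ V = 7) {e : Fin 3 → V} (he : IsFrame g η Φ e) (u v : V) :
    g (Φ u) v = ∑ k, (g (e k) u * g (Φ (e k)) v - g (Φ (e k)) u * g (e k) v) := by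
  rw [S.g_expand hV he (Φ u) v, S.η_Φ]
  have h1 : ∀ k, g (e k) (Φ u) = - g (Φ (e k)) u := fun k => by rw [S.skew, neg_neg]
  have h2 : ∀ k, g (Φ (e k)) (Φ u) = g (e k) u := fun k => by rw [S.compat, he.horizontal]; ring
  simp only [h1, h2]
  rw [zero_mul, zero_add]
  exact Finset.sum_congr rfl fun k _ => by ring

theorem trace_eq (hV : Module.finrank ℝ V = 7) {e : Fin 3 → V} (he : IsFrame g η Φ e)
    (T : V →ₗ[ℝ] V) :
    LinearMap.trace ℝ V T =
      η (T ξ) + ∑ k, (g (e k) (T (e k)) + g (Φ (e k)) (T (Φ (e k)))) := by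
  obtain ⟨B, hB, hr⟩ := S.exists_frameBasis hV he
  rw [LinearMap.trace_eq_matrix_trace ℝ B, Matrix.trace]
  simp only [Matrix.diag_apply, LinearMap.toMatrix_apply, hB, hr]
  simp only [frameVec, Fin.sum_univ_succ]
  simp [S.g_ξ]
  ring

omit S in
/-- The complex coordinates of a frame. -/
def zcoord (g : V →ₗ[ℝ] V →ₗ[ℝ] ℝ) (Φ : V →ₗ[ℝ] V) (e : Fin 3 → V) (k : Fin 3) (u : V) : ℂ :=
  g (e k) u + Complex.I * g (Φ (e k)) u

omit S in
/-- Transversal forms of type `(3, 0)`. -/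
structure IsThreeZero (ξ : V) (Φ : V →ₗ[ℝ] V) (Υ : V [⋀^Fin 3]→ₗ[ℝ] ℂ) : Prop where
  transversal : ∀ v w, Υ ![ξ, v, w] = 0
  type : ∀ u v w, Υ ![Φ u, v, w] = Complex.I * Υ ![u, v, w]

omit S in
theorem swap_zero_one (Υ : V [⋀^Fin 3]→ₗ[ℝ] ℂ) (u v w : V) : Υ ![v, u, w] = - Υ ![u, v, w] := by
  rw [← Υ.map_swap (v := ![u, v, w]) (i := 0) (j := 1) (by decide)]
  congr 1
  funext i; fin_cases i <;> rfl

omit S in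
theorem swap_one_two (Υ : V [⋀^Fin 3]→ₗ[ℝ] ℂ) (u v w : V) : Υ ![u, w, v] = - Υ ![u, v, w] := by
  rw [← Υ.map_swap (v := ![u, v, w]) (i := 1) (j := 2) (by decide)]
  congr 1
  funext i; fin_cases i <;> rfl

omit S in
theorem same_zero_one (Υ : V [⋀^Fin 3]→ₗ[ℝ] ℂ) (u w : V) : Υ ![u, u, w] = 0 :=
  Υ.map_eq_zero_of_eq _ (i := 0) (j := 1) rfl (by decide)

omit S in
theorem same_one_two (Υ : V [⋀^Fin 3]→ₗ[ℝ] ℂ) (u w : V) : Υ ![w, u, u] = 0 :=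
  Υ.map_eq_zero_of_eq _ (i := 1) (j := 2) rfl (by decide)

omit S in
theorem same_zero_two (Υ : V [⋀^Fin 3]→ₗ[ℝ] ℂ) (u w : V) : Υ ![u, w, u] = 0 :=
  Υ.map_eq_zero_of_eq _ (i := 0) (j := 2) rfl (by decide)

/-- The `ξ` component drops out by transversality, and the (3,0) type merges the `e k` and `Φ (e k)`
components into one complex coordinate. -/
theorem threeZero_expand_zero (hV : Module.finrank ℝ V = 7) {e : Fin 3 → V}
    (he : IsFrame g η Φ e) {Υ : V [⋀^Fin 3]→ₗ[ℝ] ℂ} (hΥ : IsThreeZero ξ Φ Υ) (u v w : V) :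
    Υ ![u, v, w] = ∑ k, zcoord g Φ e k u * Υ ![e k, v, w] := by
  have h : ∀ u, Υ ![u, v, w] = Υ.curryLeft u ![v, w] := fun u => rfl
  conv_lhs => rw [S.expand hV he u, h]
  simp only [Fin.sum_univ_three, map_add, map_smul, AlternatingMap.add_apply,
    AlternatingMap.smul_apply, ← h, hΥ.transversal, hΥ.type, zcoord, Complex.real_smul]
  ring

/-- Complex linearity in one slot spreads to all slots by antisymmetry. Hence the transversal
(3,0)-forms make up a complex line, and such a form is known from its value on one frame. -/
theorem threeZero_expand (hV : Module.finrank ℝ V = 7) {e : Fin 3 → V}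
    (he : IsFrame g η Φ e) {Υ : V [⋀^Fin 3]→ₗ[ℝ] ℂ} (hΥ : IsThreeZero ξ Φ Υ) (u : Fin 3 → V) :
    Υ u = Matrix.det (Matrix.of fun i k => zcoord g Φ e k (u i)) * Υ e := by
  have h0 := fun u v w => S.threeZero_expand_zero hV he hΥ u v w
  have h1 : ∀ u v w, Υ ![u, v, w] = ∑ k, zcoord g Φ e k v * Υ ![u, e k, w] := fun u v w => by
    rw [swap_zero_one, h0, ← Finset.sum_neg_distrib]
    exact Finset.sum_congr rfl fun k _ => by rw [swap_zero_one Υ u]; ring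
  have h2 : ∀ u v w, Υ ![u, v, w] = ∑ k, zcoord g Φ e k w * Υ ![u, v, e k] := fun u v w => by
    rw [swap_one_two, h1, ← Finset.sum_neg_distrib]
    exact Finset.sum_congr rfl fun k _ => by rw [swap_one_two Υ u v]; ring
  have hu : u = ![u 0, u 1, u 2] := by funext i; fin_cases i <;> rfl
  have hE : e = ![e 0, e 1, e 2] := by funext i; fin_cases i <;> rfl
  have hE' : Υ e = Υ ![e 0, e 1, e 2] := by rw [← hE]
  conv_lhs => rw [hu]
  rw [h0, hE', Matrix.det_fin_three]
  simp only [h1 _ (u 1) _, h2 _ _ (u 2), Fin.sum_univ_three, same_zero_one, same_zero_two,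
    same_one_two, Matrix.of_apply]
  rw [swap_zero_one Υ (e 0) (e 1) (e 2), swap_one_two Υ (e 0) (e 1) (e 2),
    swap_zero_one Υ (e 0) (e 2) (e 1), swap_one_two Υ (e 1) (e 0) (e 2),
    swap_one_two Υ (e 2) (e 0) (e 1), swap_zero_one Υ (e 0) (e 2) (e 1),
    swap_zero_one Υ (e 0) (e 1) (e 2), swap_one_two Υ (e 0) (e 1) (e 2)]
  ring

omit S in
/-- The Hermitian form of the transverse structure. -/
def hermitian (g : V →ₗ[ℝ] V →ₗ[ℝ] ℝ) (η : V →ₗ[ℝ] ℝ) (Φ : V →ₗ[ℝ] V) (u v : V) : ℂ :=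
  (g u v - η u * η v : ℝ) - Complex.I * (g (Φ u) v : ℝ)

theorem hermitian_eq (hV : Module.finrank ℝ V = 7) {e : Fin 3 → V} (he : IsFrame g η Φ e)
    (u v : V) :
    hermitian g η Φ u v = ∑ k, zcoord g Φ e k u * (starRingEnd ℂ) (zcoord g Φ e k v) := by
  rw [hermitian, S.g_Φ_expand hV he, S.g_expand hV he u v]
  simp only [zcoord, map_add, map_mul, Complex.conj_ofReal, Complex.conj_I]
  push_cast
  rw [add_sub_cancel_left, Finset.mul_sum, ← Finset.sum_sub_distrib]
  refine Finset.sum_congr rfl fun k _ => ?_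
  ring_nf
  rw [Complex.I_sq]
  ring

/-- With `Z` the matrix of complex coordinates, `|det Z|² = det (Z Z*)`, and `Z Z*` is the Gram
matrix of the Hermitian form. The result mentions no frame, so it can later be differentiated and
rescaled. -/
theorem normSq_threeZero (hV : Module.finrank ℝ V = 7) {e : Fin 3 → V} (he : IsFrame g η Φ e)
    {Υ : V [⋀^Fin 3]→ₗ[ℝ] ℂ} (hΥ : IsThreeZero ξ Φ Υ)
    (h1 : Υ e * (starRingEnd ℂ) (Υ e) = 1) (u : Fin 3 → V) :
    Υ u * (starRingEnd ℂ) (Υ u) = Matrix.det (Matrix.of fun i j => hermitian g η Φ (u i) (u j)) := by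
  rw [S.threeZero_expand hV he hΥ u]
  set Z : Matrix (Fin 3) (Fin 3) ℂ := Matrix.of fun i k => zcoord g Φ e k (u i) with hZ
  have h : (Matrix.of fun i j => hermitian g η Φ (u i) (u j)) = Z * Z.conjTranspose := by
    ext i j
    simp [Matrix.mul_apply, S.hermitian_eq hV he, hZ]
  rw [h, Matrix.det_mul, Matrix.det_conjTranspose, map_mul, mul_mul_mul_comm, h1, mul_one]
  rfl

theorem exists_special_frame {e : Fin 3 → V} (he : IsFrame g η Φ e)
    {Υ : V [⋀^Fin 3]→ₗ[ℝ] ℂ} (hΥ : IsThreeZero ξ Φ Υ)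
    (h1 : Υ e * (starRingEnd ℂ) (Υ e) = 1) : ∃ e', IsFrame g η Φ e' ∧ Υ e' = 1 := by
  have hn : (Υ e).re * (Υ e).re + (Υ e).im * (Υ e).im = 1 := by
    have := congrArg Complex.re h1
    simpa using this
  have hE : e = ![e 0, e 1, e 2] := by funext i; fin_cases i <;> rfl
  have hE' : Υ e = Υ ![e 0, e 1, e 2] := by rw [← hE]
  have h1' : ∀ i j, g (e i) (Φ (e j)) = 0 := fun i j => by rw [S.symm, he.isotropic]
  -- The first vector is multiplied, in the complex line of `e 0` and `Φ (e 0)`, by the conjugate of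
  -- `Υ e`. The value of `Υ` becomes `|Υ e|² = 1`.
  refine ⟨![(Υ e).re • e 0 - (Υ e).im • Φ (e 0), e 1, e 2], ⟨fun i j => ?_, fun i j => ?_,
    fun i => ?_⟩, ?_⟩
  · fin_cases i <;> fin_cases j <;>
      simp [he.orthonormal, he.isotropic, h1', S.compat, he.horizontal, hn]
  · fin_cases i <;> fin_cases j <;>
      simp [he.orthonormal, he.isotropic, h1', S.compat, he.horizontal, S.Φ_sq]
    ring
  · fin_cases i <;> simp [he.horizontal, S.η_Φ]
  · have h : ∀ u, Υ ![u, e 1, e 2] = Υ.curryLeft u ![e 1, e 2] := fun u => rfl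
    rw [h, map_sub, map_smul, map_smul, AlternatingMap.sub_apply, AlternatingMap.smul_apply,
      AlternatingMap.smul_apply, ← h, ← h, hΥ.type, ← hE', Complex.real_smul, Complex.real_smul]
    apply Complex.ext
    · simp; linarith
    · simp; ring

end IsContactMetric
end ContactLinearAlgebra

/-! ### The model G₂-form and the metric it determines -/

section GTwo

variable {V : Type*} [AddCommGroup V] [Module ℝ V]

namespace IsContactMetric

variable {g : V →ₗ[ℝ] V →ₗ[ℝ] ℝ} {η : V →ₗ[ℝ] ℝ} {ξ : V} {Φ : V →ₗ[ℝ] V}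

theorem IsThreeZero.type_one {Υ : V [⋀^Fin 3]→ₗ[ℝ] ℂ} (hΥ : IsThreeZero ξ Φ Υ) (u v w : V) :
    Υ ![u, Φ v, w] = Complex.I * Υ ![u, v, w] := by
  rw [swap_zero_one, hΥ.type, swap_zero_one Υ u v]; ring

theorem IsThreeZero.type_two {Υ : V [⋀^Fin 3]→ₗ[ℝ] ℂ} (hΥ : IsThreeZero ξ Φ Υ) (u v w : V) :
    Υ ![u, v, Φ w] = Complex.I * Υ ![u, v, w] := by
  rw [swap_one_two, hΥ.type_one, swap_one_two Υ u v]; ring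

set_option maxRecDepth 10000 in
theorem normSq_eq_one_of_normalised (S : IsContactMetric g η ξ Φ) {e : Fin 3 → V}
    (he : IsFrame g η Φ e) {Υ : V [⋀^Fin 3]→ₗ[ℝ] ℂ} (hΥ : IsThreeZero ξ Φ Υ)
    {κ : V [⋀^Fin 2]→ₗ[ℝ] ℝ} (hκ : ∀ u v, κ ![u, v] = g (Φ u) v)
    (h : ∀ v : Fin 6 → V, wedge Υ (conjForm Υ) v =
      (-4 * Complex.I / 3) * (wedge (wedge κ κ) κ v : ℝ)) :
    Υ e * (starRingEnd ℂ) (Υ e) = 1 := by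
  have hE : e = ![e 0, e 1, e 2] := by funext i; fin_cases i <;> rfl
  have hE' : Υ e = Υ ![e 0, e 1, e 2] := by rw [← hE]
  -- On these six vectors `ω³` takes the value 6, so the right side is `-8 i`, while the left side
  -- is `-8 i |Υ e|²`.
  have h0 := h ![e 0, Φ (e 0), e 1, Φ (e 1), e 2, Φ (e 2)]
  have hc : ∀ v, conjForm Υ v = (starRingEnd ℂ) (Υ v) := fun v => rfl
  have h1' : ∀ i j, g (e i) (Φ (e j)) = 0 := fun i j => by rw [S.symm, he.isotropic]
  rw [wedge_three_three, wedge_four_two] at h0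
  simp only [hc, hΥ.type, hΥ.type_one, hΥ.type_two, same_zero_one, same_one_two,
    wedge_two_two, hκ, S.compat, he.horizontal, he.isotropic, he.orthonormal, S.Φ_sq, map_mul,
    Complex.conj_I, ← hE'] at h0
  simp [he.orthonormal] at h0
  have hI := Complex.I_sq
  linear_combination (Complex.I / 8) * h0 +
    ((Υ e * (starRingEnd ℂ) (Υ e)) * (1 - Complex.I ^ 2) - 1) * hI

/-- The determinant form `eⁱ ∧ eʲ ∧ eᵏ` on coordinate vectors. -/
def coordDet (i j k : Fin 7) (x y z : Fin 7 → ℝ) : ℝ :=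
  x i * (y j * z k - y k * z j) - x j * (y i * z k - y k * z i) + x k * (y i * z j - y j * z i)

/-- The model `G₂`-form in coordinates. -/
def modelG2 (x y z : Fin 7 → ℝ) : ℝ :=
  coordDet 0 1 2 x y z + coordDet 0 3 4 x y z + coordDet 0 5 6 x y z + coordDet 1 3 5 x y z
    - coordDet 1 4 6 x y z - coordDet 2 3 6 x y z - coordDet 2 4 5 x y z

theorem re_det_fin_three (a b : Fin 3 → Fin 3 → ℝ) :
    (Matrix.det (Matrix.of fun i k => (a i k : ℂ) + Complex.I * (b i k : ℂ))).re =
      (a 0 0 * a 1 1 * a 2 2 - a 0 0 * b 1 1 * b 2 2 - b 0 0 * a 1 1 * b 2 2 - b 0 0 * b 1 1 * a 2 2)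
      - (a 0 0 * a 1 2 * a 2 1 - a 0 0 * b 1 2 * b 2 1 - b 0 0 * a 1 2 * b 2 1
          - b 0 0 * b 1 2 * a 2 1)
      - (a 0 1 * a 1 0 * a 2 2 - a 0 1 * b 1 0 * b 2 2 - b 0 1 * a 1 0 * b 2 2
          - b 0 1 * b 1 0 * a 2 2)
      + (a 0 1 * a 1 2 * a 2 0 - a 0 1 * b 1 2 * b 2 0 - b 0 1 * a 1 2 * b 2 0
          - b 0 1 * b 1 2 * a 2 0)
      + (a 0 2 * a 1 0 * a 2 1 - a 0 2 * b 1 0 * b 2 1 - b 0 2 * a 1 0 * b 2 1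
          - b 0 2 * b 1 0 * a 2 1)
      - (a 0 2 * a 1 1 * a 2 0 - a 0 2 * b 1 1 * b 2 0 - b 0 2 * a 1 1 * b 2 0
          - b 0 2 * b 1 1 * a 2 0) := by
  rw [Matrix.det_fin_three]
  simp only [Matrix.of_apply, Complex.add_re, Complex.sub_re, Complex.mul_re, Complex.add_im,
    Complex.mul_im, Complex.ofReal_re, Complex.ofReal_im, Complex.I_re, Complex.I_im]
  ring

/-- In a frame with `Υ e = 1` the 2-form is `e¹² + e³⁴ + e⁵⁶`, and `Re Υ` is the real part of the
complex determinant, `e¹³⁵ - e¹⁴⁶ - e²³⁶ - e²⁴⁵`. -/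
theorem phi_eq_modelG2 (S : IsContactMetric g η ξ Φ) (hV : Module.finrank ℝ V = 7) {e : Fin 3 → V}
    (he : IsFrame g η Φ e) {Υ : V [⋀^Fin 3]→ₗ[ℝ] ℂ} (hΥ : IsThreeZero ξ Φ Υ) (h1 : Υ e = 1)
    {κ : V [⋀^Fin 2]→ₗ[ℝ] ℝ} (hκ : ∀ u v, κ ![u, v] = g (Φ u) v)
    {η₁ : V [⋀^Fin 1]→ₗ[ℝ] ℝ} (hη : ∀ u, η₁ ![u] = η u) (u v w : V) :
    (wedge η₁ κ + rePart Υ) ![u, v, w] =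
      modelG2 (fun i => g (frameVec ξ Φ e i) u) (fun i => g (frameVec ξ Φ e i) v)
        (fun i => g (frameVec ξ Φ e i) w) := by
  have hr : rePart Υ ![u, v, w] = (Υ ![u, v, w]).re := rfl
  have hd : (Matrix.of fun i k => zcoord g Φ e k (![u, v, w] i)) = Matrix.of fun i k =>
      ((fun i k => g (e k) (![u, v, w] i) : Fin 3 → Fin 3 → ℝ) i k : ℂ)
        + Complex.I * ((fun i k => g (Φ (e k)) (![u, v, w] i) : Fin 3 → Fin 3 → ℝ) i k : ℂ) := rfl
  rw [AlternatingMap.add_apply, wedge_one_two, hr, S.threeZero_expand hV he hΥ, h1, hd, mul_one,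
    re_det_fin_three]
  rw [hκ, hκ, hκ, S.g_Φ_expand hV he v w, S.g_Φ_expand hV he u w, S.g_Φ_expand hV he u v]
  simp only [hη, Fin.sum_univ_three, modelG2, coordDet]
  simp only [frameVec, Matrix.cons_val, Matrix.cons_val_zero, Matrix.cons_val_one, S.g_ξ]
  ring

theorem wedge_modelG2 {φ : V [⋀^Fin 3]→ₗ[ℝ] ℝ} {b : Fin 7 → V} {x : V → Fin 7 → ℝ}
    (hx : ∀ i j, x (b i) j = if i = j then 1 else 0)
    (hφ : ∀ u v w, φ ![u, v, w] = modelG2 (x u) (x v) (x w)) (X Y : V) :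
    wedge (wedge (φ.curryLeft X) (φ.curryLeft Y)) φ b = 6 * ∑ i, x X i * x Y i := by
  have hb : b = ![b 0, b 1, b 2, b 3, b 4, b 5, b 6] := by
    funext i; fin_cases i <;> rfl
  refine (congrArg (fun v : Fin 7 → V =>
    wedge (wedge (φ.curryLeft X) (φ.curryLeft Y)) φ v) hb).trans ?_
  have hx' : ∀ i, x (b i) = fun j => if i = j then 1 else 0 := fun i => funext fun j => hx i j
  rw [wedge_four_three]
  simp only [hφ, hx']
  simp [modelG2, coordDet, wedge_two_two, hφ, hx', AlternatingMap.curryLeft_apply_apply, Fin.sum_univ_succ]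
  ring

/-- The transition matrix between orthonormal frames is orthogonal, so its determinant squares to 1.
-/
theorem isUnitVolume_det {B : Module.Basis (Fin 7) ℝ V}
    (hr : ∀ u v, g u v = ∑ i, B.repr u i * B.repr v i) :
    IsUnitVolume (fun u v => g u v) B.det := by
  intro e he
  rw [Module.Basis.det_apply]
  set Q := B.toMatrix e with hQ
  have h : Q.transpose * Q = 1 := by
    ext i j
    have := he i j
    simp only [hr] at this
    simp only [Matrix.mul_apply, Matrix.transpose_apply, Matrix.one_apply, ← this]
    rfl
  have h2 := congrArg Matrix.det h
  rw [Matrix.det_mul, Matrix.det_transpose, Matrix.det_one] at h2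
  rw [← sq_eq_sq₀ (abs_nonneg _) zero_le_one, sq_abs, one_pow, sq, h2]

theorem eq_smul_det {B : Module.Basis (Fin 7) ℝ V} {W : V [⋀^Fin 7]→ₗ[ℝ] ℝ} {c : ℝ}
    (h : W B = c) : W = c • B.det := by
  rw [AlternatingMap.eq_smul_basis_det B W, h]

theorem exists_orthonormal_basis (S : IsContactMetric g η ξ Φ) (hV : Module.finrank ℝ V = 7)
    {e : Fin 3 → V} (he : IsFrame g η Φ e) :
    ∃ B : Module.Basis (Fin 7) ℝ V, (∀ i, B i = frameVec ξ Φ e i) ∧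
      (∀ u i, B.repr u i = g (frameVec ξ Φ e i) u) ∧
      ∀ u v, g u v = ∑ i, B.repr u i * B.repr v i := by
  obtain ⟨B, hB, hr⟩ := S.exists_frameBasis hV he
  refine ⟨B, hB, hr, fun u v => ?_⟩
  conv_lhs => rw [← B.sum_repr u]
  rw [map_sum, LinearMap.sum_apply]
  refine Finset.sum_congr rfl fun i _ => ?_
  rw [map_smul, LinearMap.smul_apply, smul_eq_mul, hB, hr v]

/-- The metric of the `G₂`-form `η ∧ κ + Re Υ`. -/
theorem exists_wedge_phi (S : IsContactMetric g η ξ Φ) (hV : Module.finrank ℝ V = 7)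
    {e : Fin 3 → V} (he : IsFrame g η Φ e) {Υ : V [⋀^Fin 3]→ₗ[ℝ] ℂ} (hΥ : IsThreeZero ξ Φ Υ)
    (h1 : Υ e = 1) {κ : V [⋀^Fin 2]→ₗ[ℝ] ℝ} (hκ : ∀ u v, κ ![u, v] = g (Φ u) v)
    {η₁ : V [⋀^Fin 1]→ₗ[ℝ] ℝ} (hη : ∀ u, η₁ ![u] = η u) {φ : V [⋀^Fin 3]→ₗ[ℝ] ℝ}
    (hφ : φ = wedge η₁ κ + rePart Υ) :
    ∃ B : Module.Basis (Fin 7) ℝ V, (∀ i j, g (B i) (B j) = if i = j then 1 else 0) ∧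
      IsUnitVolume (fun u v => g u v) B.det ∧
      ∀ X Y, wedge (wedge (φ.curryLeft X) (φ.curryLeft Y)) φ = (6 * g X Y) • B.det := by
  obtain ⟨B, hB, hr, hg⟩ := S.exists_orthonormal_basis hV he
  refine ⟨B, fun i j => ?_, isUnitVolume_det hg, fun X Y => ?_⟩
  · rw [hB, hB, S.frameVec_orthonormal he]
  · have h := wedge_modelG2 (φ := φ) (b := B) (x := fun u i => g (frameVec ξ Φ e i) u)
      (fun i j => by rw [hB, S.frameVec_orthonormal he]; exact if_congr eq_comm rfl rfl)
      (fun u v w => by rw [hφ, S.phi_eq_modelG2 hV he hΥ h1 hκ hη]) X Y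
    simp only [← hr, ← hg] at h
    exact eq_smul_det h

/-- A metric is determined by the normalised wedge identity. -/
theorem metric_unique {g' : V →ₗ[ℝ] V →ₗ[ℝ] ℝ} (hg' : IsMetric g')
    {B : Module.Basis (Fin 7) ℝ V} (hB : ∀ i j, g (B i) (B j) = if i = j then 1 else 0)
    {vol : V [⋀^Fin 7]→ₗ[ℝ] ℝ} (hvol : IsUnitVolume (fun u v => g' u v) vol)
    (h : ∀ X Y, (6 * g X Y) • B.det = (6 * g' X Y) • vol) (X Y : V) : g' X Y = g X Y := by
  have hd : B.det B = 1 := B.det_self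
  have h0 : ∀ X Y, g X Y = g' X Y * vol B := fun X Y => by
    have := congrArg (fun α => α B) (h X Y)
    simp only [AlternatingMap.smul_apply, hd, smul_eq_mul] at this
    linarith
  set l := g' (B 0) (B 0) with hl
  have hl0 : 0 < l := hg'.pos _ (B.ne_zero 0)
  have h1 : l * vol B = 1 := by
    rw [hl, ← h0, hB]; simp
  have h2 : ∀ X Y, g' X Y = l * g X Y := fun X Y => by
    rw [h0 X Y]; linear_combination (-(g' X Y)) * h1
  set s := Real.sqrt l with hs
  have hs0 : 0 < s := Real.sqrt_pos.2 hl0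
  have hsl : s * s = l := Real.mul_self_sqrt hl0.le
  -- Since `g' = s² g`, the frame `s⁻¹ • B` is orthonormal for `g'`. Its volume is `s⁻⁷ vol B`, and
  -- `vol B = s⁻²` by `h1`; so `s⁻⁹` has absolute value 1, and `s > 0` gives `s = 1`.
  have h3 := hvol (fun i => s⁻¹ • B i) fun i j => by
    simp only [map_smul, LinearMap.smul_apply, smul_eq_mul, h2, hB, ← hsl]
    split_ifs <;> field_simp
  rw [AlternatingMap.map_smul_univ] at h3
  have h4 : vol B = (s ^ 2)⁻¹ := by
    rw [pow_two, hsl]; field_simp; linarith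
  rw [h4] at h3
  have h5 : (s⁻¹) ^ 9 = 1 := by
    rw [abs_of_pos (by simp only [Finset.prod_const, smul_eq_mul]; positivity)] at h3
    simp only [Finset.prod_const, Finset.card_univ, Fintype.card_fin, smul_eq_mul] at h3
    rw [← h3]; field_simp
  have h6 : s⁻¹ = 1 := (pow_eq_one_iff_of_nonneg (by positivity) (by norm_num)).1 h5
  have h7 : s = 1 := by simpa using h6
  rw [h2, ← hsl, h7]; ring

end IsContactMetric
end GTwo

/-! ### Covariant derivatives of the Reeb field and of `Φ`: the algebra -/

section SasakianAlgebra

variable {V : Type*} [AddCommGroup V] [Module ℝ V]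

namespace IsContactMetric

variable {g : V →ₗ[ℝ] V →ₗ[ℝ] ℝ} {η : V →ₗ[ℝ] ℝ} {ξ : V} {Φ : V →ₗ[ℝ] V}

/-- The Reeb field of a normal contact metric structure is Killing. -/
theorem nabla_reeb (S : IsContactMetric g η ξ Φ) {c : ℝ} {A : V →ₗ[ℝ] V →ₗ[ℝ] V} {B : V →ₗ[ℝ] V}
    (hA : ∀ u v w, g (A u v) w = -g v (A u w))
    (hcyc : ∀ u v w, g (A u v) w + g (A v w) u + g (A w u) v = 0)
    (hB : ∀ u v, g (B u) v - g (B v) u = c * g (Φ u) v)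
    (hη : ∀ u, η (B u) = 0) (hAξ : ∀ u, A u ξ = -Φ (B u))
    (hN : ∀ u v, A (Φ u) v - A (Φ v) u + Φ (A v u) - Φ (A u v) + (c * g (Φ u) v) • ξ = 0) (u : V) :
    B u = (c / 2) • Φ u := by
  -- Here `A = ∇Φ` and `B = ∇ξ`. The hypotheses come, in order, from skewness of `Φ`, `d(dη) = 0`,
  -- the formula for `dη`, `|ξ| = 1`, `Φ ξ = 0` and normality. The plan is to kill the symmetric
  -- part of `B`; its skew part is given by `hB`.
  have hBξ : B ξ = 0 := S.ext fun v => by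
    have := hB ξ v
    rw [S.Φ_ξ, S.g_ξ', hη] at this
    simpa using this
  have hL : ∀ u, A ξ u = B (Φ u) - Φ (B u) := fun u => by
    have h1 := hN u ξ
    rw [hAξ, hAξ, S.Φ_ξ, S.g_ξ', S.η_Φ] at h1
    simp only [map_zero, LinearMap.zero_apply, sub_zero, mul_zero, zero_smul, add_zero, map_neg]
      at h1
    have h2 : Φ (A ξ u - B (Φ u) + Φ (B u)) = 0 := by
      rw [← h1, map_add, map_sub]; abel
    have h3 : η (A ξ u) = 0 := by
      rw [← S.g_ξ', hA, hAξ, hBξ]; simp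
    have h4 := S.Φ_sq (A ξ u - B (Φ u) + Φ (B u))
    rw [h2, map_add, map_sub, h3, hη, S.η_Φ] at h4
    simp only [map_zero, sub_zero, add_zero, zero_smul] at h4
    rw [eq_comm, neg_eq_zero] at h4
    rw [← sub_eq_zero, ← h4]; abel
  -- This is `d(dη) = 0` with one argument `ξ`, where normality has expressed `∇_ξ Φ` as a
  -- commutator with `B`. It says that the symmetric part of `B` vanishes on the image of `Φ`; it
  -- vanishes on `ξ` as well.
  have h5 : ∀ v w, g (B (Φ v)) w + g (B w) (Φ v) = 0 := fun v w => by
    have h := hcyc ξ v w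
    rw [hL, hA v w ξ, hAξ, hAξ] at h
    simp only [map_sub, map_neg, LinearMap.sub_apply, LinearMap.neg_apply] at h
    have e1 := S.skew (B w) v
    rw [S.symm w] at h
    linarith
  refine S.ext fun v => ?_
  have h6 : g (B u) v + g (B v) u = 0 := by
    have h7 := h5 (Φ u) v
    rw [S.Φ_sq] at h7
    simp only [map_add, map_neg, map_smul, LinearMap.add_apply, LinearMap.neg_apply,
      hBξ, S.g_ξ', hη, map_zero, LinearMap.zero_apply, smul_zero] at h7
    linarith
  have h8 := hB u v
  rw [map_smul, LinearMap.smul_apply, smul_eq_mul]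
  linarith

/-- The covariant derivative of the endomorphism of a normal contact metric structure. -/
theorem nabla_endo (S : IsContactMetric g η ξ Φ) {c : ℝ} {A : V →ₗ[ℝ] V →ₗ[ℝ] V} {B : V →ₗ[ℝ] V}
    (hA : ∀ u v w, g (A u v) w = -g v (A u w))
    (hcyc : ∀ u v w, g (A u v) w + g (A v w) u + g (A w u) v = 0)
    (hB : ∀ u, B u = (c / 2) • Φ u) (hAξ : ∀ u, A u ξ = -Φ (B u))
    (hAΦ : ∀ u v, A u (Φ v) + Φ (A u v) = g (B u) v • ξ + η v • B u)
    (hN : ∀ u v, A (Φ u) v - A (Φ v) u + Φ (A v u) - Φ (A u v) + (c * g (Φ u) v) • ξ = 0)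
    (u v : V) : A u v = (c / 2) • (η v • u - g u v • ξ) := by
  -- The defect `s` between `∇Φ` and its expected value satisfies homogeneous versions of all the
  -- identities, since the expected value accounts for their right sides.
  set s : V → V → V → ℝ := fun u v w => g (A u v) w - (c / 2) * (η v * g u w - g u v * η w) with hs
  have hskew : ∀ u v w, s u v w = -s u w v := fun u v w => by
    simp only [hs, hA u v w, S.symm v]; ring
  have hscyc : ∀ u v w, s u v w + s v w u + s w u v = 0 := fun u v w => by
    have := hcyc u v w
    simp only [hs, S.symm v u, S.symm w]
    linarith
  have hsξ : ∀ u w, s u ξ w = 0 := fun u w => by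
    simp only [hs, hAξ, hB, map_smul, S.Φ_sq, S.η_ξ, S.g_ξ']
    simp [S.g_ξ]
    ring
  have hsΦ : ∀ u v w, s u (Φ v) w = s u v (Φ w) := fun u v w => by
    have h := congrArg (fun x => g x w) (hAΦ u v)
    simp only [map_add, map_smul, LinearMap.add_apply, LinearMap.smul_apply, smul_eq_mul, S.g_ξ,
      S.skew (A u v), hB] at h
    simp only [hs, S.η_Φ]
    rw [S.skew u v, S.skew u w] at h
    linarith
  have hsN : ∀ u v w, s (Φ u) v w - s (Φ v) u w - s v u (Φ w) + s u v (Φ w) = 0 := fun u v w => by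
    have h := congrArg (fun x => g x w) (hN u v)
    simp only [map_add, map_sub, map_smul, LinearMap.add_apply, LinearMap.sub_apply, map_zero,
      LinearMap.zero_apply, LinearMap.smul_apply, smul_eq_mul, S.g_ξ, S.skew (A u v),
      S.skew (A v u)] at h
    simp only [hs, S.η_Φ]
    rw [S.skew v u, S.symm v, S.skew u v, S.skew u w, S.skew v w]
    rw [S.skew u v] at h
    linarith
  -- Normality is combined with the cyclic identity at `(Φ u, v, w)` and `(Φ v, u, w)`, in the
  -- manner of the Koszul formula. Replacing `u` by a further `Φ`-image then recovers `s` itself, as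
  -- `s` vanishes when an argument after the first is `ξ`.
  have hsT : ∀ u v w, s w v (Φ u) = 0 := fun u v w => by
    have h1 := hsN u v w
    have h2 := hscyc (Φ u) v w
    have h3 := hscyc (Φ v) u w
    have := hskew w u (Φ v)
    have := hskew w v (Φ u)
    have := hskew v w (Φ u)
    have := hskew v u (Φ w)
    have := hskew u w (Φ v)
    have := hskew u v (Φ w)
    have := hsΦ w u v
    have := hsΦ w v u
    have := hsΦ v w u
    have := hsΦ v u w
    have := hsΦ u w v
    have := hsΦ u v w
    linarith
  refine S.ext fun w => ?_
  have h1 := hsT (Φ w) v u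
  have h2 := hskew u v ξ
  rw [hsξ] at h2
  have h3 : s u v (Φ (Φ w)) = -s u v w + η w * s u v ξ := by
    simp only [hs, S.Φ_sq, map_add, map_neg, map_smul, smul_eq_mul]; ring
  rw [h3, h2] at h1
  have h4 : s u v w = 0 := by linarith
  simp only [hs] at h4
  simp only [map_smul, map_sub, LinearMap.smul_apply, LinearMap.sub_apply, smul_eq_mul, S.g_ξ]
  linarith

end IsContactMetric
end SasakianAlgebra

/-! ### Algebra of curvature operators and their Ricci traces -/

section CurvatureAlgebra

variable {V : Type*} [AddCommGroup V] [Module ℝ V]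

namespace IsContactMetric

variable {g : V →ₗ[ℝ] V →ₗ[ℝ] ℝ} {η : V →ₗ[ℝ] ℝ} {ξ : V} {Φ : V →ₗ[ℝ] V}

theorem trace_skew (S : IsContactMetric g η ξ Φ) (hV : Module.finrank ℝ V = 7) {T : V →ₗ[ℝ] V}
    (hT : ∀ u v, g (T u) v = -g u (T v)) : LinearMap.trace ℝ V T = 0 := by
  obtain ⟨e, he⟩ := S.exists_frame hV
  have h : ∀ v, g v (T v) = 0 := fun v => by
    have := hT v v
    rw [S.symm (T v)] at this
    linarith
  rw [S.trace_eq hV he, ← S.g_ξ, h]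
  simp [h]

/-- A complex linear `T` acts on the complex volume form by its complex trace, which must vanish.
The real trace of `Φ T` is `-2` times the imaginary part of that trace. -/
theorem trace_Φ_comp_eq_zero (S : IsContactMetric g η ξ Φ) (hV : Module.finrank ℝ V = 7)
    {e : Fin 3 → V} (he : IsFrame g η Φ e) {Υ : V [⋀^Fin 3]→ₗ[ℝ] ℂ} (hΥ : IsThreeZero ξ Φ Υ)
    (h1 : Υ e = 1) {T : V →ₗ[ℝ] V}
    (hTΦ : ∀ u, T (Φ u) = Φ (T u))
    (hTΥ : ∀ u v w, Υ ![T u, v, w] + Υ ![u, T v, w] + Υ ![u, v, T w] = 0) :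
    LinearMap.trace ℝ V (Φ ∘ₗ T) = 0 := by
  have hE : e = ![e 0, e 1, e 2] := by funext i; fin_cases i <;> rfl
  have h1' : Υ ![e 0, e 1, e 2] = 1 := by rw [← hE, h1]
  have h := hTΥ (e 0) (e 1) (e 2)
  have hz0 := fun u v w => S.threeZero_expand_zero hV he hΥ u v w
  rw [swap_zero_one Υ (T (e 1)) (e 0) (e 2), swap_one_two Υ (e 0) (T (e 2)) (e 1),
    swap_zero_one Υ (T (e 2)) (e 0) (e 1), hz0, hz0, hz0] at h
  simp only [Fin.sum_univ_three, same_zero_one, same_zero_two, h1',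
    swap_zero_one Υ (e 0) (e 1) (e 2),
    swap_zero_one Υ (e 0) (e 2) (e 1), swap_one_two Υ (e 0) (e 1) (e 2)] at h
  have him := congrArg Complex.im h
  simp [zcoord] at him
  rw [S.trace_eq hV he]
  simp only [LinearMap.comp_apply, S.η_Φ, hTΦ, S.compat, Fin.sum_univ_three, he.horizontal]
  have e1 : ∀ k, g (e k) (Φ (T (e k))) = - g (Φ (e k)) (T (e k)) := fun k => by
    rw [S.skew, neg_neg]
  simp only [e1]
  linarith

/-- The classical argument: four Bianchi identities are added and the skew symmetries cancel all but
the two wanted terms. No torsion-freeness enters, only the Bianchi identity. -/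
theorem pair_symm {R : V →ₗ[ℝ] V →ₗ[ℝ] V →ₗ[ℝ] V} (hg : IsMetric g)
    (hR : ∀ x y z, R x y z = -R y x z)
    (hskew : ∀ x y z w, g (R x y z) w = -g z (R x y w))
    (hB : ∀ x y z, R x y z + R y z x + R z x y = 0) (x y z w : V) :
    g (R x y z) w = g (R z w x) y := by
  have b : ∀ x y z w, g (R x y z) w + g (R y z x) w + g (R z x y) w = 0 := fun x y z w => by
    have := congrArg (fun v => g v w) (hB x y z)
    simpa using this
  have s : ∀ x y z w, g (R x y z) w = -g (R x y w) z := fun x y z w => by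
    rw [hskew, hg.symm z]
  have a : ∀ x y z w, g (R x y z) w = -g (R y x z) w := fun x y z w => by
    rw [hR]; simp
  have b1 := b x y z w
  have b2 := b y z w x
  have b3 := b z w x y
  have b4 := b w x y z
  have := s x y z w
  have := s y z x w
  have := s z x y w
  have := s y z w x
  have := s z w y x
  have := s w y z x
  have := s z w x y
  have := s w x z y
  have := s x z w y
  have := s w x y z
  have := s x y w z
  have := s y w x z
  have := a x z w y
  have := a x z y w
  have := a y w x z
  have := a y w z x
  linarith

/-- A Kähler curvature operator without complex trace is Ricci flat. -/
theorem trace_curvature_eq_zero (S : IsContactMetric g η ξ Φ) (hV : Module.finrank ℝ V = 7)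
    {R : V →ₗ[ℝ] V →ₗ[ℝ] V →ₗ[ℝ] V} (hR : ∀ x y z, R x y z = -R y x z)
    (hskew : ∀ x y z w, g (R x y z) w = -g z (R x y w))
    (hΦ : ∀ x y z, R x y (Φ z) = Φ (R x y z)) (hξ : ∀ x y, R x y ξ = 0)
    (hB : ∀ x y z, R x y z + R y z x + R z x y = 0)
    (htr : ∀ x y, LinearMap.trace ℝ V (Φ ∘ₗ R x y) = 0) (y z : V) :
    LinearMap.trace ℝ V ((R.flip y).flip z) = 0 := by
  set ric : V → V → ℝ := fun y z => LinearMap.trace ℝ V ((R.flip y).flip z) with hric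
  have hsymm : ∀ y z, ric y z = ric z y := fun y z => by
    have h : (R.flip y).flip z = (R.flip z).flip y - R y z := by
      ext x
      have := hB x y z
      rw [hR z x] at this
      simp only [LinearMap.flip_apply, LinearMap.sub_apply]
      rw [eq_sub_iff_add_eq, ← sub_eq_zero, ← this]; abel
    simp only [hric]
    rw [h, map_sub, S.trace_skew hV (fun u v => hskew y z u v), sub_zero]
  have hηR : ∀ x y z, η (R x y z) = 0 := fun x y z => by
    rw [← S.g_ξ', hskew, hξ]; simp
  -- Pair symmetry moves the compatibility of `R` with `Φ` from the last two arguments to the first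
  -- two.
  have hinv : ∀ x y, R (Φ x) (Φ y) = R x y := fun x y => by
    ext z
    refine S.ext fun w => ?_
    rw [pair_symm S.toIsMetric hR hskew hB, hΦ, S.compat, hηR, zero_mul, sub_zero,
      ← pair_symm S.toIsMetric hR hskew hB]
  have hricΦ : ∀ y z, ric (Φ y) (Φ z) = ric y z := fun y z => by
    have h1 : (R.flip (Φ y)).flip (Φ z) = Φ * (R.flip (Φ y)).flip z := by
      ext x; simp [hΦ]
    have h2 : (R.flip (Φ y)).flip z * Φ = (R.flip y).flip z := by
      ext x; simp [hinv]
    simp only [hric]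
    rw [h1, LinearMap.trace_mul_comm, h2]
  have hexch : ∀ y z, ric z (Φ y) = ric y (Φ z) := fun y z => by
    have h : Φ ∘ₗ R y z = (R.flip z).flip (Φ y) - (R.flip y).flip (Φ z) := by
      ext x
      have := congrArg Φ (hB x y z)
      rw [hR z x] at this
      simp only [map_add, map_neg, map_zero] at this
      simp only [LinearMap.flip_apply, LinearMap.sub_apply, hΦ, LinearMap.comp_apply]
      rw [eq_sub_iff_add_eq, ← sub_eq_zero, ← this]; abel
    have h' := htr y z
    rw [h, map_sub] at h'
    simp only [hric]
    linarith
  have hricξ : ∀ y, ric y ξ = 0 := fun y => by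
    have : (R.flip y).flip ξ = 0 := by ext x; simp [hξ]
    simp only [hric]; rw [this, map_zero]
  have hlin : ∀ y z, ric y (Φ (Φ z)) = - ric y z := fun y z => by
    have : (R.flip y).flip (Φ (Φ z)) = -(R.flip y).flip z + η z • (R.flip y).flip ξ := by
      rw [S.Φ_sq, map_add, map_neg, map_smul]
    have h := hricξ y
    simp only [hric] at h ⊢
    rw [this, map_add, map_neg, map_smul, h]; simp
  -- The form `ric y (Φ z)` is symmetric by `hexch`, where the complex trace vanishes, and skew
  -- because `ric` is symmetric and invariant under `Φ`.
  have h0 : ∀ y z, ric y (Φ z) = 0 := fun y z => by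
    have h1 := hexch y z
    have h2 := hsymm z (Φ y)
    have h3 := hlin (Φ y) z
    have h4 := hricΦ y (Φ z)
    linarith
  have h1 := hlin y z
  rw [h0] at h1
  exact (neg_eq_zero.1 h1.symm)

theorem trace_Φ (S : IsContactMetric g η ξ Φ) (hV : Module.finrank ℝ V = 7) :
    LinearMap.trace ℝ V Φ = 0 :=
  S.trace_skew hV S.skew

theorem trace_Φ_Φ (S : IsContactMetric g η ξ Φ) (hV : Module.finrank ℝ V = 7) :
    LinearMap.trace ℝ V (Φ ∘ₗ Φ) = -6 := by
  have : FiniteDimensional ℝ V := Module.finite_of_finrank_pos (by omega)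
  have h : Φ ∘ₗ Φ = -LinearMap.id + η.smulRight ξ := by
    ext v; simp [S.Φ_sq]
  rw [h, map_add, map_neg, LinearMap.trace_id, LinearMap.trace_smulRight, hV, S.η_ξ]
  norm_num

/-- The Ricci trace of the Levi-Civita connection in terms of that of the transverse connection. -/
theorem trace_ricci (S : IsContactMetric g η ξ Φ) (hV : Module.finrank ℝ V = 7) {c : ℝ}
    {M T : V →ₗ[ℝ] V} {K : V → V → V} (hM : LinearMap.trace ℝ V M = 0)
    (hK : ∀ x u, K x u = (c / 2) • (η x • Φ u + η u • Φ x - g (Φ x) u • ξ)) (v w : V)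
    (hT : ∀ x, T x = M x + (c * g (Φ x) v) • K ξ w + K x (K v w) - K v (K x w)) :
    LinearMap.trace ℝ V T = 3 * c ^ 2 / 2 * (η v * η w) - c ^ 2 / 2 * (g v w - η v * η w) := by
  have : FiniteDimensional ℝ V := Module.finite_of_finrank_pos (by omega)
  set a := c / 2 with ha
  -- Everything besides `M` is a combination of rank one operators, `Φ` and `Φ ∘ Φ`, whose traces
  -- are values of covectors, `0` and `-6`.
  have h : T = M + (2 * a ^ 2) • ((g.flip v) ∘ₗ Φ).smulRight (Φ w)
      + a ^ 2 • (η v • (η.smulRight (Φ (Φ w)) - ((g.flip (Φ w)) ∘ₗ Φ).smulRight ξ)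
          + η w • (η.smulRight (Φ (Φ v)) - ((g.flip (Φ v)) ∘ₗ Φ).smulRight ξ)
          - g (Φ v) w • Φ)
      - a ^ 2 • (η.smulRight (η v • Φ (Φ w) - g (Φ v) (Φ w) • ξ)
          + η w • (η v • (Φ ∘ₗ Φ) - ((g (Φ v)) ∘ₗ Φ).smulRight ξ)
          - ((g.flip w) ∘ₗ Φ).smulRight (Φ v)) := by
    ext x
    rw [hT]
    simp only [hK, S.Φ_ξ, S.η_ξ, S.η_Φ, map_zero, map_add, map_sub, map_smul, LinearMap.add_apply,
      LinearMap.sub_apply, LinearMap.smul_apply, LinearMap.smulRight_apply, LinearMap.comp_apply,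
      LinearMap.flip_apply, LinearMap.zero_apply, S.g_ξ', zero_smul, smul_eq_mul, mul_zero,
      mul_one]
    have hc : c = 2 * a := by rw [ha]; ring
    rw [hc]
    module
  rw [h]
  simp only [map_add, map_sub, map_smul, LinearMap.trace_smulRight, hM, S.trace_Φ hV,
    S.trace_Φ_Φ hV, S.η_ξ, S.Φ_ξ, LinearMap.comp_apply, LinearMap.flip_apply, map_zero,
    smul_eq_mul, S.compat, S.Φ_sq]
  simp only [map_neg, LinearMap.neg_apply, S.g_ξ]
  rw [S.symm w v, ha]
  ring

end IsContactMetric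
end CurvatureAlgebra

/-! ### Normal contact metric structures on an open set -/

section LocalGeometry

variable {V : Type*} [NormedAddCommGroup V] [NormedSpace ℝ V]
  {F : Type*} [NormedAddCommGroup F] [NormedSpace ℝ F]
  {G : Type*} [NormedAddCommGroup G] [NormedSpace ℝ G]
  {H : Type*} [NormedAddCommGroup H] [NormedSpace ℝ H]

/-- A continuous bilinear form as a bilinear form. -/
def bil (b : V →L[ℝ] V →L[ℝ] ℝ) : V →ₗ[ℝ] V →ₗ[ℝ] ℝ :=
  (ContinuousLinearMap.coeLM ℝ) ∘ₗ (b : V →ₗ[ℝ] V →L[ℝ] ℝ)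

@[simp]
theorem bil_apply (b : V →L[ℝ] V →L[ℝ] ℝ) (u v : V) : bil b u v = b u v := rfl

theorem fderiv_congr_of_isOpen {U : Set V} (hU : IsOpen U) {y : V} (hy : y ∈ U) {f h : V → F}
    (heq : ∀ z ∈ U, f z = h z) : fderiv ℝ f y = fderiv ℝ h y :=
  Filter.EventuallyEq.fderiv_eq (Filter.eventually_of_mem (hU.mem_nhds hy) heq)

theorem fderiv_apply_fun {T : V → F →L[ℝ] G} {s : V → F} {y : V} (hT : DifferentiableAt ℝ T y)
    (hs : DifferentiableAt ℝ s y) (x : V) :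
    fderiv ℝ (fun z => T z (s z)) y x = fderiv ℝ T y x (s y) + T y (fderiv ℝ s y x) := by
  rw [fderiv_clm_apply hT hs]
  simp [add_comm]

theorem fderiv_apply_const {T : V → F →L[ℝ] G} {y : V} (hT : DifferentiableAt ℝ T y) (u : F)
    (x : V) : fderiv ℝ (fun z => T z u) y x = fderiv ℝ T y x u := by
  rw [fderiv_apply_fun hT (differentiableAt_const u)]; simp

theorem fderiv_apply_fun₂ {T : V → F →L[ℝ] G →L[ℝ] H} {a : V → F} {b : V → G} {y : V}
    (hT : DifferentiableAt ℝ T y) (ha : DifferentiableAt ℝ a y) (hb : DifferentiableAt ℝ b y)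
    (x : V) :
    fderiv ℝ (fun z => T z (a z) (b z)) y x =
      fderiv ℝ T y x (a y) (b y) + T y (fderiv ℝ a y x) (b y) + T y (a y) (fderiv ℝ b y x) := by
  rw [fderiv_apply_fun (hT.clm_apply ha) hb, fderiv_apply_fun hT ha]
  simp

theorem fderiv_alternating_three {T : V → F [⋀^Fin 3]→L[ℝ] G} {a b c : V → F} {y : V}
    (hT : DifferentiableAt ℝ T y) (ha : DifferentiableAt ℝ a y) (hb : DifferentiableAt ℝ b y)
    (hc : DifferentiableAt ℝ c y) (x : V) :
    fderiv ℝ (fun z => T z ![a z, b z, c z]) y x =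
      fderiv ℝ T y x ![a y, b y, c y] + T y ![fderiv ℝ a y x, b y, c y]
        + T y ![a y, fderiv ℝ b y x, c y] + T y ![a y, b y, fderiv ℝ c y x] := by
  have h := fderiv_continuousAlternatingMap_apply_apply (g := ![a, b, c]) hT
    (by intro i; fin_cases i <;> assumption) x
  have e : ∀ z, (fun i => (![a, b, c] : Fin 3 → V → F) i z) = ![a z, b z, c z] := fun z => by
    funext i; fin_cases i <;> rfl
  simp only [e] at h
  rw [h, Fin.sum_univ_three, add_assoc, add_assoc, add_assoc]
  congr 2
  · congr 1; funext i; fin_cases i <;> rfl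
  · congr 1
    · congr 1; funext i; fin_cases i <;> rfl
    · congr 1; funext i; fin_cases i <;> rfl

/-- A normal contact metric structure on an open subset of a vector space, with
`dη(u, v) = c g(Φ u, v)`. -/
structure LocalSasakian (U : Set V) (c : ℝ) (g : V → V →L[ℝ] V →L[ℝ] ℝ) (η : V → V →L[ℝ] ℝ)
    (ξ : V → V) (Φ : V → V →L[ℝ] V) : Prop where
  isOpen : IsOpen U
  c_ne : c ≠ 0
  smooth_g : ContDiffOn ℝ ∞ g U
  smooth_η : ContDiffOn ℝ ∞ η U
  smooth_ξ : ContDiffOn ℝ ∞ ξ U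
  smooth_Φ : ContDiffOn ℝ ∞ Φ U
  contact : ∀ y ∈ U, IsContactMetric (bil (g y)) (η y : V →ₗ[ℝ] ℝ) (ξ y) (Φ y : V →ₗ[ℝ] V)
  dη : ∀ y ∈ U, ∀ u v, fderiv ℝ η y u v - fderiv ℝ η y v u = c * g y (Φ y u) v
  normal : ∀ y ∈ U, ∀ u v, fderiv ℝ Φ y (Φ y u) v - fderiv ℝ Φ y (Φ y v) u
    + Φ y (fderiv ℝ Φ y v u) - Φ y (fderiv ℝ Φ y u v) + (c * g y (Φ y u) v) • ξ y = 0

/-- `Γ` is the Levi-Civita connection of `g` on `U`. -/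
structure IsLeviCivita (U : Set V) (g : V → V →L[ℝ] V →L[ℝ] ℝ) (Γ : V → V →L[ℝ] V →L[ℝ] V) :
    Prop where
  smooth : ∀ y ∈ U, DifferentiableAt ℝ Γ y
  symm : ∀ y ∈ U, ∀ u v, Γ y u v = Γ y v u
  metric : ∀ y ∈ U, ∀ x u v, fderiv ℝ g y x u v = g y (Γ y x u) v + g y u (Γ y x v)

theorem differentiableAt_of_contDiffOn {U : Set V} (hU : IsOpen U) {f : V → F}
    (hf : ContDiffOn ℝ ∞ f U) {y : V} (hy : y ∈ U) : DifferentiableAt ℝ f y :=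
  (hf.contDiffAt (hU.mem_nhds hy)).differentiableAt (by simp)

theorem differentiableAt_fderiv_of_contDiffOn {U : Set V} (hU : IsOpen U) {f : V → F}
    (hf : ContDiffOn ℝ ∞ f U) {y : V} (hy : y ∈ U) : DifferentiableAt ℝ (fderiv ℝ f) y :=
  ((hf.contDiffAt (hU.mem_nhds hy)).fderiv_right (m := 1)
    (by norm_num; exact WithTop.coe_le_coe.2 le_top)).differentiableAt
    (by simp)

theorem fderiv_fderiv_comm {U : Set V} (hU : IsOpen U) {f : V → F}
    (hf : ContDiffOn ℝ ∞ f U) {y : V} (hy : y ∈ U) (u v : V) :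
    fderiv ℝ (fderiv ℝ f) y u v = fderiv ℝ (fderiv ℝ f) y v u :=
  (hf.contDiffAt (hU.mem_nhds hy)).isSymmSndFDerivAt
    (by rw [minSmoothness_of_isRCLikeNormedField]; exact WithTop.coe_le_coe.2 le_top) u v

namespace LocalSasakian

variable {U : Set V} {c : ℝ} {g : V → V →L[ℝ] V →L[ℝ] ℝ} {η : V → V →L[ℝ] ℝ}
    {ξ : V → V} {Φ : V → V →L[ℝ] V} {Γ : V → V →L[ℝ] V →L[ℝ] V}

variable (S : LocalSasakian U c g η ξ Φ) (L : IsLeviCivita U g Γ) {y : V} (hy : y ∈ U)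

include S hy

theorem diff_g : DifferentiableAt ℝ g y := differentiableAt_of_contDiffOn S.isOpen S.smooth_g hy
theorem diff_η : DifferentiableAt ℝ η y := differentiableAt_of_contDiffOn S.isOpen S.smooth_η hy
theorem diff_ξ : DifferentiableAt ℝ ξ y := differentiableAt_of_contDiffOn S.isOpen S.smooth_ξ hy
theorem diff_Φ : DifferentiableAt ℝ Φ y := differentiableAt_of_contDiffOn S.isOpen S.smooth_Φ hy

theorem g_symm (u v : V) : g y u v = g y v u := (S.contact y hy).symm u v
theorem η_ξ : η y (ξ y) = 1 := (S.contact y hy).η_ξ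
theorem Φ_sq (v : V) : Φ y (Φ y v) = -v + η y v • ξ y := (S.contact y hy).Φ_sq v
theorem compat (u v : V) : g y (Φ y u) (Φ y v) = g y u v - η y u * η y v :=
  (S.contact y hy).compat u v
theorem skew (u v : V) : g y (Φ y u) v = -g y u (Φ y v) := (S.contact y hy).skew u v
theorem Φ_ξ : Φ y (ξ y) = 0 := (S.contact y hy).Φ_ξ
theorem g_ξ (v : V) : g y (ξ y) v = η y v := (S.contact y hy).g_ξ v
theorem g_ξ' (v : V) : g y v (ξ y) = η y v := (S.contact y hy).g_ξ' v
theorem η_Φ (v : V) : η y (Φ y v) = 0 := (S.contact y hy).η_Φ v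

/-- The pointwise identities hold throughout the open set `U`, so they may be differentiated. This
lemma and the next ones record the results with ordinary derivatives; the connection terms are added
in `nabla_ξ`. -/
theorem fderiv_η (x v : V) :
    fderiv ℝ η y x v = fderiv ℝ g y x (ξ y) v + g y (fderiv ℝ ξ y x) v := by
  have h := congrArg (fun T => T x) (fderiv_congr_of_isOpen S.isOpen hy
    (f := fun z => η z v) (h := fun z => g z (ξ z) v) fun z hz => (S.g_ξ hz v).symm)
  rw [fderiv_apply_const (S.diff_η hy), fderiv_apply_fun₂ (S.diff_g hy) (S.diff_ξ hy)
    (differentiableAt_const v)] at h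
  simpa using h

theorem fderiv_Φ_ξ (x : V) : fderiv ℝ Φ y x (ξ y) + Φ y (fderiv ℝ ξ y x) = 0 := by
  have h := congrArg (fun T => T x) (fderiv_congr_of_isOpen S.isOpen hy
    (f := fun z => Φ z (ξ z)) (h := fun _ => 0) fun z hz => S.Φ_ξ hz)
  rw [fderiv_apply_fun (S.diff_Φ hy) (S.diff_ξ hy)] at h
  simpa using h

theorem fderiv_Φ_sq (x v : V) : fderiv ℝ Φ y x (Φ y v) + Φ y (fderiv ℝ Φ y x v) =
    fderiv ℝ η y x v • ξ y + η y v • fderiv ℝ ξ y x := by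
  have hΦ := (S.diff_Φ hy).clm_apply (differentiableAt_const v)
  have hη := (S.diff_η hy).clm_apply (differentiableAt_const v)
  have h := congrArg (fun T => T x) (fderiv_congr_of_isOpen S.isOpen hy
    (f := fun z => Φ z (Φ z v)) (h := fun z => -v + η z v • ξ z) fun z hz => S.Φ_sq hz v)
  rw [fderiv_apply_fun (S.diff_Φ hy) hΦ, fderiv_apply_const (S.diff_Φ hy)] at h
  rw [h, fderiv_const_add, fderiv_fun_smul hη (S.diff_ξ hy)]
  simp only [add_apply, smul_apply,
    ContinuousLinearMap.smulRight_apply]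
  rw [fderiv_apply_const (S.diff_η hy), add_comm]

theorem fderiv_skew (x u v : V) : fderiv ℝ g y x (Φ y u) v + g y (fderiv ℝ Φ y x u) v =
    -(fderiv ℝ g y x u (Φ y v) + g y u (fderiv ℝ Φ y x v)) := by
  have hΦ := fun v : V => (S.diff_Φ hy).clm_apply (differentiableAt_const v)
  have h := congrArg (fun T => T x) (fderiv_congr_of_isOpen S.isOpen hy
    (f := fun z => g z (Φ z u) v) (h := fun z => -g z u (Φ z v)) fun z hz => S.skew hz u v)
  rw [fderiv_fun_neg] at h
  change _ = -(fderiv ℝ (fun z => g z u (Φ z v)) y x) at h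
  rw [fderiv_apply_fun₂ (S.diff_g hy) (hΦ u) (differentiableAt_const v),
    fderiv_apply_fun₂ (S.diff_g hy) (differentiableAt_const u) (hΦ v),
    fderiv_apply_const (S.diff_Φ hy), fderiv_apply_const (S.diff_Φ hy)] at h
  simpa using h

theorem fderiv_dη (x u v : V) :
    fderiv ℝ (fderiv ℝ η) y x u v - fderiv ℝ (fderiv ℝ η) y x v u =
      c * (fderiv ℝ g y x (Φ y u) v + g y (fderiv ℝ Φ y x u) v) := by
  have hΦ := fun v : V => (S.diff_Φ hy).clm_apply (differentiableAt_const v)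
  have hη := differentiableAt_fderiv_of_contDiffOn S.isOpen S.smooth_η hy
  have hη' := fun u v : V => (hη.clm_apply (differentiableAt_const u)).clm_apply
    (differentiableAt_const v)
  have hg := ((S.diff_g hy).clm_apply (hΦ u)).clm_apply (differentiableAt_const v)
  have h := congrArg (fun T => T x) (fderiv_congr_of_isOpen S.isOpen hy
    (f := fun z => fderiv ℝ η z u v - fderiv ℝ η z v u) (h := fun z => c * g z (Φ z u) v)
    fun z hz => S.dη z hz u v)
  rw [fderiv_fun_sub (hη' u v) (hη' v u), sub_apply,
    fderiv_apply_fun₂ hη (differentiableAt_const u) (differentiableAt_const v),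
    fderiv_apply_fun₂ hη (differentiableAt_const v) (differentiableAt_const u),
    fderiv_const_mul hg, smul_apply,
    fderiv_apply_fun₂ (S.diff_g hy) (hΦ u) (differentiableAt_const v),
    fderiv_apply_const (S.diff_Φ hy)] at h
  simpa using h

theorem η_fderiv_ξ (x : V) : fderiv ℝ g y x (ξ y) (ξ y) + 2 * η y (fderiv ℝ ξ y x) = 0 := by
  have h := congrArg (fun T => T x) (fderiv_congr_of_isOpen S.isOpen hy
    (f := fun z => g z (ξ z) (ξ z)) (h := fun _ => 1) fun z hz => by rw [S.g_ξ hz, S.η_ξ hz])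
  rw [fderiv_apply_fun₂ (S.diff_g hy) (S.diff_ξ hy) (S.diff_ξ hy), S.g_ξ hy, S.g_ξ' hy] at h
  simp at h
  linarith

include L

/-- The covariant derivatives `A = ∇Φ` and `B = ∇ξ` are shown to satisfy the hypotheses of
`nabla_reeb` and `nabla_endo`. Metric compatibility or the symmetry of `Γ` is what lets covariant
derivatives replace ordinary ones in the differentiated identities. -/
theorem nabla_ξ (u : V) : fderiv ℝ ξ y u + Γ y u (ξ y) = (c / 2) • Φ y u ∧ ∀ v,
    fderiv ℝ Φ y u v + Γ y u (Φ y v) - Φ y (Γ y u v) = (c / 2) • (η y v • u - g y u v • ξ y) := by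
  set A : V →ₗ[ℝ] V →ₗ[ℝ] V := LinearMap.mk₂ ℝ
    (fun u v => fderiv ℝ Φ y u v + Γ y u (Φ y v) - Φ y (Γ y u v))
    (by intros; simp; abel) (by intros; simp [smul_sub]) (by intros; simp; abel)
    (by intros; simp [smul_sub]) with hA
  set B : V →ₗ[ℝ] V := ((fderiv ℝ ξ y + (Γ y).flip (ξ y) : V →L[ℝ] V) : V →ₗ[ℝ] V) with hB
  have hAa : ∀ u v, A u v = fderiv ℝ Φ y u v + Γ y u (Φ y v) - Φ y (Γ y u v) := fun _ _ => rfl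
  have hBa : ∀ u, B u = fderiv ℝ ξ y u + Γ y u (ξ y) := fun _ => rfl
  have hc := S.contact y hy
  have hm := L.metric y hy
  have hs := L.symm y hy
  have h1 : ∀ u v w, bil (g y) (A u v) w = -bil (g y) v (A u w) := fun u v w => by
    have h := S.fderiv_skew hy u v w
    rw [hm, hm] at h
    simp only [bil_apply, hAa, map_add, map_sub, LinearMap.add_apply, LinearMap.sub_apply]
    have e1 := S.skew hy (Γ y u v) w
    have e2 := S.skew hy v (Γ y u w)
    linarith
  have h2 : ∀ u v w, bil (g y) (A u v) w + bil (g y) (A v w) u + bil (g y) (A w u) v = 0 :=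
    fun u v w => by
    have a1 := S.fderiv_dη hy u v w
    have a2 := S.fderiv_dη hy v w u
    have a3 := S.fderiv_dη hy w u v
    have s := fun u v => fderiv_fderiv_comm S.isOpen S.smooth_η hy u v
    rw [s w v] at a3
    rw [s v u] at a2
    rw [s w u] at a3
    have a : c * ((fderiv ℝ g y u (Φ y v) w + g y (fderiv ℝ Φ y u v) w)
      + (fderiv ℝ g y v (Φ y w) u + g y (fderiv ℝ Φ y v w) u)
      + (fderiv ℝ g y w (Φ y u) v + g y (fderiv ℝ Φ y w u) v)) = 0 := by
      linarith
    -- The cyclic sum is `d(dη) = 0` by symmetry of second derivatives; the factor `c` has to be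
    -- cancelled, which needs `c ≠ 0`.
    have a' := (mul_eq_zero.1 a).resolve_left S.c_ne
    rw [hm, hm, hm] at a'
    simp only [bil_apply, hAa, map_add, map_sub, LinearMap.add_apply, LinearMap.sub_apply]
    rw [hs v u, hs w v, hs w u] at *
    have e1 := S.skew hy (Γ y u v) w
    have e2 := S.skew hy (Γ y v w) u
    have e3 := S.skew hy (Γ y u w) v
    have f1 := S.g_symm hy (Φ y v) (Γ y u w)
    have f2 := S.g_symm hy (Φ y w) (Γ y u v)
    have f3 := S.g_symm hy (Φ y u) (Γ y v w)
    linarith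
  have h3 : ∀ u v, bil (g y) (B u) v - bil (g y) (B v) u = c * bil (g y) (Φ y u) v := fun u v => by
    have h := S.dη y hy u v
    rw [S.fderiv_η hy, S.fderiv_η hy, hm, hm, hs v u] at h
    simp only [bil_apply, hBa, map_add, LinearMap.add_apply]
    linarith
  have h4 : ∀ u, (η y : V →ₗ[ℝ] ℝ) (B u) = 0 := fun u => by
    have h := S.η_fderiv_ξ hy u
    rw [hm, S.g_ξ hy, S.g_ξ' hy] at h
    simp only [hBa, ContinuousLinearMap.coe_coe, map_add]
    linarith
  have h5 : ∀ u, A u (ξ y) = -Φ y (B u) := fun u => by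
    have h := S.fderiv_Φ_ξ hy u
    rw [hAa, hBa, S.Φ_ξ hy, map_zero, add_zero, eq_neg_of_add_eq_zero_left h, map_add]
    abel
  have h6 : ∀ u v, A u (Φ y v) + Φ y (A u v) = bil (g y) (B u) v • ξ y + η y v • B u := fun u v => by
    have h := S.fderiv_Φ_sq hy u v
    rw [S.fderiv_η hy, hm, S.g_ξ hy] at h
    simp only [bil_apply, hAa, hBa, map_add, map_sub, LinearMap.add_apply,
      S.Φ_sq hy, map_neg, map_smul]
    rw [← sub_eq_zero] at h ⊢
    rw [← h]
    module
  have h7 : ∀ u v, A (Φ y u) v - A (Φ y v) u + Φ y (A v u) - Φ y (A u v)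
      + (c * bil (g y) (Φ y u) v) • ξ y = 0 := fun u v => by
    rw [← S.normal y hy u v]
    simp only [bil_apply, hAa, map_add, map_sub]
    rw [hs (Φ y v) (Φ y u), hs (Φ y u) v, hs (Φ y v) u, hs v u]
    abel
  have hB' := hc.nabla_reeb h1 h2 h3 h4 h5 h7
  exact ⟨hB' u, fun v => hc.nabla_endo h1 h2 hB' h5 h6 h7 u v⟩

end LocalSasakian
end LocalGeometry

set_option maxSynthPendingDepth 3

/-! ### The transverse connection and its curvature -/

section LocalGeometry

variable {V : Type*} [NormedAddCommGroup V] [NormedSpace ℝ V]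

/-- The difference `(x, u) ↦ (c / 2) (η(x) Φ u + η(u) Φ x - g(Φ x, u) ξ)` of the Levi-Civita
connection and the transverse connection of a contact metric structure. -/
def contactTensor (c : ℝ) (g : V → V →L[ℝ] V →L[ℝ] ℝ) (η : V → V →L[ℝ] ℝ) (ξ : V → V)
    (Φ : V → V →L[ℝ] V) (y : V) : V →L[ℝ] V →L[ℝ] V :=
  (c / 2) • (ContinuousLinearMap.smulRightL ℝ V (V →L[ℝ] V) (η y) (Φ y)
    + ContinuousLinearMap.flipₗᵢ ℝ V V V
      (ContinuousLinearMap.smulRightL ℝ V (V →L[ℝ] V) (η y) (Φ y))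
    - ((ContinuousLinearMap.flipₗᵢ ℝ _ _ _ (ContinuousLinearMap.smulRightL ℝ V V)) (ξ y)).comp
        ((g y).comp (Φ y)))

theorem contactTensor_apply (c : ℝ) (g : V → V →L[ℝ] V →L[ℝ] ℝ) (η : V → V →L[ℝ] ℝ) (ξ : V → V)
    (Φ : V → V →L[ℝ] V) (y x u : V) : contactTensor c g η ξ Φ y x u =
      (c / 2) • (η y x • Φ y u + η y u • Φ y x - g y (Φ y x) u • ξ y) := rfl

/-- `D` is a metric connection on `U` for which `ξ`, `Φ` are parallel, with torsion
`c g(Φ ·, ·) ξ`. -/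
structure IsTransverseConnection (U : Set V) (c : ℝ) (g : V → V →L[ℝ] V →L[ℝ] ℝ)
    (η : V → V →L[ℝ] ℝ) (ξ : V → V) (Φ : V → V →L[ℝ] V) (D : V → V →L[ℝ] V →L[ℝ] V) : Prop where
  diff : ∀ y ∈ U, DifferentiableAt ℝ D y
  metric : ∀ y ∈ U, ∀ x u v, fderiv ℝ g y x u v = g y (D y x u) v + g y u (D y x v)
  reeb : ∀ y ∈ U, ∀ x, fderiv ℝ ξ y x = -D y x (ξ y)
  endo : ∀ y ∈ U, ∀ x u, fderiv ℝ Φ y x u = Φ y (D y x u) - D y x (Φ y u)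
  contact : ∀ y ∈ U, ∀ x u, fderiv ℝ η y x u = η y (D y x u)
  torsion : ∀ y ∈ U, ∀ x u, D y x u - D y u x = (c * g y (Φ y x) u) • ξ y

variable {U : Set V} {c : ℝ} {g : V → V →L[ℝ] V →L[ℝ] ℝ} {η : V → V →L[ℝ] ℝ}
    {ξ : V → V} {Φ : V → V →L[ℝ] V} {Γ : V → V →L[ℝ] V →L[ℝ] V}

namespace LocalSasakian

theorem diff_contactTensor (S : LocalSasakian U c g η ξ Φ) {y : V} (hy : y ∈ U) :
    DifferentiableAt ℝ (contactTensor c g η ξ Φ) y := by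
  have h1 := S.diff_g hy
  have h2 := S.diff_η hy
  have h3 := S.diff_ξ hy
  have h4 := S.diff_Φ hy
  have h5 : DifferentiableAt ℝ
      (fun y => ContinuousLinearMap.smulRightL ℝ V (V →L[ℝ] V) (η y) (Φ y)) y :=
    ((ContinuousLinearMap.differentiableAt _).comp y h2).clm_apply h4
  have h6 := (ContinuousLinearMap.flipₗᵢ ℝ V V V).toContinuousLinearEquiv.differentiableAt.comp y h5
  have h7 := ((ContinuousLinearMap.flipₗᵢ ℝ _ _ _
    (ContinuousLinearMap.smulRightL ℝ V V)).differentiableAt.comp y h3).clm_comp (h1.clm_comp h4)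
  exact ((h5.add h6).sub h7).const_smul (c / 2)

/-- The tensor `K` is made for this: `K x` is skew for `g`, `K x ξ = (c/2) Φ x` equals `∇_x ξ`, and
the commutator of `K x` with `Φ` equals `∇_x Φ`. The torsion is minus the antisymmetric part of `K`,
as `Γ` is symmetric. -/
theorem isTransverseConnection (S : LocalSasakian U c g η ξ Φ) (L : IsLeviCivita U g Γ) :
    IsTransverseConnection U c g η ξ Φ (fun y => Γ y - contactTensor c g η ξ Φ y) := by
  have hmet : ∀ y ∈ U, ∀ x u v, fderiv ℝ g y x u v =
      g y ((Γ y - contactTensor c g η ξ Φ y) x u) v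
        + g y u ((Γ y - contactTensor c g η ξ Φ y) x v) := fun y hy x u v => by
    rw [L.metric y hy]
    simp only [sub_apply, contactTensor_apply, map_sub, map_smul, map_add,
      add_apply, smul_apply, S.g_ξ hy, S.g_ξ' hy,
      smul_eq_mul]
    have e1 := S.skew hy u v
    have e2 := S.g_symm hy u (Φ y x)
    rw [e1, e2]
    ring
  have hreeb : ∀ y ∈ U, ∀ x, fderiv ℝ ξ y x = -(Γ y - contactTensor c g η ξ Φ y) x (ξ y) :=
    fun y hy x => by
    have h := (S.nabla_ξ L hy x).1
    simp only [sub_apply, contactTensor_apply, S.Φ_ξ hy, S.η_ξ hy, S.g_ξ' hy,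
      S.η_Φ hy]
    rw [← eq_sub_iff_add_eq] at h
    rw [h]
    module
  refine ⟨fun y hy => (L.smooth y hy).sub (S.diff_contactTensor hy), hmet, hreeb, ?_, ?_, ?_⟩
  · intro y hy x u
    have h := (S.nabla_ξ L hy x).2 u
    simp only [sub_apply, contactTensor_apply, map_sub, map_smul, map_add,
      S.Φ_ξ hy, S.Φ_sq hy, S.η_Φ hy, S.compat hy, smul_zero, sub_zero]
    rw [← sub_eq_zero] at h ⊢
    rw [← h]
    module
  · intro y hy x u
    rw [S.fderiv_η hy, hmet y hy, hreeb y hy, S.g_ξ hy, map_neg, neg_apply]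
    ring
  · intro y hy x u
    have e1 := S.skew hy u x
    have e2 := S.g_symm hy u (Φ y x)
    simp only [sub_apply, contactTensor_apply]
    rw [e1, e2, L.symm y hy x u]
    module

end LocalSasakian

/-- The curvature `(x, y) ↦ D x y - D y x + [Γ x, Γ y]` of a connection, where `D` is the
derivative of its connection form `Γ` at a point. -/
def curvature (D : V →L[ℝ] V →L[ℝ] V →L[ℝ] V) (Γ : V →L[ℝ] V →L[ℝ] V) :
    V →ₗ[ℝ] V →ₗ[ℝ] V →ₗ[ℝ] V :=
  LinearMap.mk₂ ℝ (fun x y => ((D x y - D y x + (Γ x).comp (Γ y) - (Γ y).comp (Γ x) : V →L[ℝ] V) :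
      V →ₗ[ℝ] V))
    (by intros; ext; simp; abel) (by intros; ext; simp [smul_sub, smul_add])
    (by intros; ext; simp; abel) (by intros; ext; simp [smul_sub, smul_add])

theorem curvature_apply (D : V →L[ℝ] V →L[ℝ] V →L[ℝ] V) (Γ : V →L[ℝ] V →L[ℝ] V) (x y z : V) :
    curvature D Γ x y z = D x y z - D y x z + Γ x (Γ y z) - Γ y (Γ x z) := rfl

namespace IsTransverseConnection

variable {D : V → V →L[ℝ] V →L[ℝ] V}
variable (T : IsTransverseConnection U c g η ξ Φ D) (S : LocalSasakian U c g η ξ Φ) {y : V}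
  (hy : y ∈ U)

include T S hy

theorem curvature_swap (x z u : V) :
    curvature (fderiv ℝ D y) (D y) x z u = -curvature (fderiv ℝ D y) (D y) z x u := by
  simp only [curvature_apply]
  abel

/-- Curvature annihilates a parallel tensor: the equation for its derivative is differentiated once
more, and symmetry of the second derivative leaves the curvature terms. The same argument serves for
`Φ`, for `g` and, later, for `Υ`. -/
theorem curvature_reeb (x z : V) : curvature (fderiv ℝ D y) (D y) x z (ξ y) = 0 := by
  have hξ := differentiableAt_fderiv_of_contDiffOn S.isOpen S.smooth_ξ hy
  have h : ∀ z x, fderiv ℝ (fderiv ℝ ξ) y z x =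
      -(fderiv ℝ D y z x (ξ y) - D y x (D y z (ξ y))) := fun z x => by
    have h := congrArg (fun T => T z) (fderiv_congr_of_isOpen S.isOpen hy
      (f := fun p => fderiv ℝ ξ p x) (h := fun p => -D p x (ξ p)) fun p hp => T.reeb p hp x)
    rw [fderiv_apply_const hξ, fderiv_fun_neg] at h
    change _ = -(fderiv ℝ (fun p => D p x (ξ p)) y z) at h
    rw [h, fderiv_apply_fun₂ (T.diff y hy) (differentiableAt_const x) (S.diff_ξ hy),
      T.reeb y hy]
    simp
    abel
  have h' := fderiv_fderiv_comm S.isOpen S.smooth_ξ hy x z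
  rw [h, h] at h'
  rw [curvature_apply, ← neg_eq_zero, ← sub_eq_zero.2 h']
  abel

theorem curvature_endo (x z u : V) : curvature (fderiv ℝ D y) (D y) x z (Φ y u) =
    Φ y (curvature (fderiv ℝ D y) (D y) x z u) := by
  have hΦ := differentiableAt_fderiv_of_contDiffOn S.isOpen S.smooth_Φ hy
  have hΦu := (S.diff_Φ hy).clm_apply (differentiableAt_const u)
  have h : ∀ z x, fderiv ℝ (fderiv ℝ Φ) y z x u =
      Φ y (D y z (D y x u)) - D y z (Φ y (D y x u)) + Φ y (fderiv ℝ D y z x u)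
        - (fderiv ℝ D y z x (Φ y u) + D y x (Φ y (D y z u) - D y z (Φ y u))) := fun z x => by
    have hDu := ((T.diff y hy).clm_apply (differentiableAt_const x)).clm_apply
      (differentiableAt_const u)
    have hD := ((T.diff y hy).clm_apply (differentiableAt_const x)).clm_apply hΦu
    have h := congrArg (fun T => T z) (fderiv_congr_of_isOpen S.isOpen hy
      (f := fun p => fderiv ℝ Φ p x u) (h := fun p => Φ p (D p x u) - D p x (Φ p u))
      fun p hp => T.endo p hp x u)
    rw [fderiv_apply_fun₂ hΦ (differentiableAt_const x) (differentiableAt_const u),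
      fderiv_fun_sub ((S.diff_Φ hy).clm_apply hDu) hD] at h
    change _ = fderiv ℝ (fun p => Φ p (D p x u)) y z - fderiv ℝ (fun p => D p x (Φ p u)) y z at h
    rw [fderiv_apply_fun₂ (T.diff y hy) (differentiableAt_const x) hΦu,
      fderiv_apply_fun (S.diff_Φ hy) hDu,
      fderiv_apply_fun₂ (T.diff y hy) (differentiableAt_const x) (differentiableAt_const u),
      fderiv_apply_const (S.diff_Φ hy)] at h
    simpa [T.endo y hy] using h
  have h' := fderiv_fderiv_comm S.isOpen S.smooth_Φ hy x z
  have h'' := congrArg (fun T => T u) h'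
  change fderiv ℝ (fderiv ℝ Φ) y x z u = fderiv ℝ (fderiv ℝ Φ) y z x u at h''
  rw [h, h, ← sub_eq_zero] at h''
  rw [← sub_eq_zero, ← neg_eq_zero, ← h'']
  simp only [curvature_apply, map_add, map_sub]
  abel

theorem curvature_skew (x z u v : V) : g y (curvature (fderiv ℝ D y) (D y) x z u) v =
    -g y u (curvature (fderiv ℝ D y) (D y) x z v) := by
  have hg := differentiableAt_fderiv_of_contDiffOn S.isOpen S.smooth_g hy
  have h : ∀ z x, fderiv ℝ (fderiv ℝ g) y z x u v =
      g y (D y z (D y x u)) v + g y (D y x u) (D y z v) + g y (fderiv ℝ D y z x u) v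
      + (g y (D y z u) (D y x v) + g y u (D y z (D y x v)) + g y u (fderiv ℝ D y z x v)) :=
    fun z x => by
    have hD := fun u => ((T.diff y hy).clm_apply (differentiableAt_const x)).clm_apply
      (differentiableAt_const u)
    have h := congrArg (fun T => T z) (fderiv_congr_of_isOpen S.isOpen hy
      (f := fun p => fderiv ℝ g p x u v) (h := fun p => g p (D p x u) v + g p u (D p x v))
      fun p hp => T.metric p hp x u v)
    rw [fderiv_apply_fun₂ (hg.clm_apply (differentiableAt_const x)) (differentiableAt_const u)
        (differentiableAt_const v), fderiv_apply_const hg,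
      fderiv_fun_add (((S.diff_g hy).clm_apply (hD u)).clm_apply (differentiableAt_const v))
        (((S.diff_g hy).clm_apply (differentiableAt_const u)).clm_apply (hD v))] at h
    change _ = fderiv ℝ (fun p => g p (D p x u) v) y z
      + fderiv ℝ (fun p => g p u (D p x v)) y z at h
    rw [fderiv_apply_fun₂ (S.diff_g hy) (hD u) (differentiableAt_const v),
      fderiv_apply_fun₂ (S.diff_g hy) (differentiableAt_const u) (hD v),
      fderiv_apply_fun₂ (T.diff y hy) (differentiableAt_const x) (differentiableAt_const u),
      fderiv_apply_fun₂ (T.diff y hy) (differentiableAt_const x) (differentiableAt_const v),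
      T.metric y hy, T.metric y hy] at h
    simpa [T.metric y hy] using h
  have h' := fderiv_fderiv_comm S.isOpen S.smooth_g hy x z
  have h'' := congrArg (fun T => T u v) h'
  change fderiv ℝ (fderiv ℝ g) y x z u v = fderiv ℝ (fderiv ℝ g) y z x u v at h''
  rw [h, h] at h''
  simp only [curvature_apply, map_add, map_sub, add_apply,
    sub_apply]
  linarith

/-- The torsion is parallel, so it could enter only through its composition with itself. That
vanishes because its values are multiples of `ξ`, while `Φ ξ = 0` and `η ∘ Φ = 0`. -/
theorem bianchi (x v z : V) : curvature (fderiv ℝ D y) (D y) x v z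
    + curvature (fderiv ℝ D y) (D y) v z x + curvature (fderiv ℝ D y) (D y) z x v = 0 := by
  have h : ∀ z x v, fderiv ℝ D y z x v - fderiv ℝ D y z v x =
      (c * (g y (Φ y x) (D y z v) - g y (Φ y v) (D y z x))) • ξ y
        - (c * g y (Φ y x) v) • D y z (ξ y) := fun z x v => by
    have hD := fun x v => ((T.diff y hy).clm_apply (differentiableAt_const x)).clm_apply
      (differentiableAt_const v)
    have hΦx := (S.diff_Φ hy).clm_apply (differentiableAt_const x)
    have hg := ((S.diff_g hy).clm_apply hΦx).clm_apply (differentiableAt_const v)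
    have h := congrArg (fun T => T z) (fderiv_congr_of_isOpen S.isOpen hy
      (f := fun p => D p x v - D p v x) (h := fun p => (c * g p (Φ p x) v) • ξ p)
      fun p hp => T.torsion p hp x v)
    rw [fderiv_fun_sub (hD x v) (hD v x), fderiv_fun_smul (hg.const_mul c) (S.diff_ξ hy),
      fderiv_const_mul hg] at h
    change fderiv ℝ (fun p => D p x v) y z - fderiv ℝ (fun p => D p v x) y z
      = (c * g y (Φ y x) v) • fderiv ℝ ξ y z
        + (c * fderiv ℝ (fun p => g p (Φ p x) v) y z) • ξ y at h
    rw [fderiv_apply_fun₂ (T.diff y hy) (differentiableAt_const x) (differentiableAt_const v),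
      fderiv_apply_fun₂ (T.diff y hy) (differentiableAt_const v) (differentiableAt_const x),
      fderiv_apply_fun₂ (S.diff_g hy) hΦx (differentiableAt_const v),
      fderiv_apply_const (S.diff_Φ hy), T.metric y hy, T.endo y hy, T.reeb y hy] at h
    simp only [fderiv_fun_const, Pi.zero_apply, zero_apply, map_zero,
      add_zero, map_sub, sub_apply, S.skew hy (D y z x) v,
      S.g_symm hy (D y z x) (Φ y v)] at h
    rw [h]
    module
  have t := T.torsion y hy
  have tx : D y x v = D y v x + (c * g y (Φ y x) v) • ξ y := by rw [← t]; abel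
  have tv : D y v z = D y z v + (c * g y (Φ y v) z) • ξ y := by rw [← t]; abel
  have tz : D y z x = D y x z + (c * g y (Φ y z) x) • ξ y := by rw [← t]; abel
  have e : curvature (fderiv ℝ D y) (D y) x v z + curvature (fderiv ℝ D y) (D y) v z x
      + curvature (fderiv ℝ D y) (D y) z x v =
      (fderiv ℝ D y x v z - fderiv ℝ D y x z v) + (fderiv ℝ D y v z x - fderiv ℝ D y v x z)
      + (fderiv ℝ D y z x v - fderiv ℝ D y z v x) + (D y x (D y v z) - D y x (D y z v))
      + (D y v (D y z x) - D y v (D y x z)) + (D y z (D y x v) - D y z (D y v x)) := by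
    simp only [curvature_apply]
    abel
  rw [e, h, h, h, tx, tv, tz]
  simp only [map_add, map_smul, S.g_ξ' hy, S.η_Φ hy, smul_eq_mul, mul_zero, add_zero]
  module

end IsTransverseConnection
end LocalGeometry

/-! ### Covariant derivatives of the transverse volume form -/

section LocalGeometry

variable {V : Type*} [NormedAddCommGroup V] [NormedSpace ℝ V]

variable {U : Set V} {c : ℝ} {g : V → V →L[ℝ] V →L[ℝ] ℝ} {η : V → V →L[ℝ] ℝ}
    {ξ : V → V} {Φ : V → V →L[ℝ] V} {Γ : V → V →L[ℝ] V →L[ℝ] V}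
    {Υ : V → V [⋀^Fin 3]→L[ℝ] ℂ} {D : V → V →L[ℝ] V →L[ℝ] V}

/-- A closed transversal `(3, 0)`-form of constant norm on an open subset of a vector space. -/
structure LocalVolume (U : Set V) (g : V → V →L[ℝ] V →L[ℝ] ℝ) (η : V → V →L[ℝ] ℝ)
    (ξ : V → V) (Φ : V → V →L[ℝ] V) (Υ : V → V [⋀^Fin 3]→L[ℝ] ℂ) : Prop where
  smooth : ContDiffOn ℝ ∞ Υ U
  threeZero : ∀ y ∈ U,
    IsContactMetric.IsThreeZero (ξ y) (Φ y : V →ₗ[ℝ] V) (Υ y).toAlternatingMap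
  normSq : ∀ y ∈ U, ∀ u : Fin 3 → V, Υ y u * (starRingEnd ℂ) (Υ y u) = Matrix.det (Matrix.of
    fun i j => IsContactMetric.hermitian (bil (g y)) (η y : V →ₗ[ℝ] ℝ) (Φ y : V →ₗ[ℝ] V) (u i) (u j))
  closed : ∀ y ∈ U, ∀ a b u v, fderiv ℝ Υ y a ![b, u, v] - fderiv ℝ Υ y b ![a, u, v]
    + fderiv ℝ Υ y u ![a, b, v] - fderiv ℝ Υ y v ![a, b, u] = 0

/-- The covariant derivative of a `3`-form at `p`. -/
def covDeriv (Υ : V → V [⋀^Fin 3]→L[ℝ] ℂ) (D : V →L[ℝ] V →L[ℝ] V) (p x : V) :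
    V [⋀^Fin 3]→L[ℝ] ℂ :=
  fderiv ℝ (fun y => (Υ y).compContinuousLinearMap (ContinuousLinearMap.id ℝ V - D (y - p))) p x

theorem hasFDerivAt_id_sub (D : V →L[ℝ] V →L[ℝ] V) (p : V) :
    HasFDerivAt (fun y => ContinuousLinearMap.id ℝ V - D (y - p)) (-D) p := by
  have h := (D.hasFDerivAt.comp p ((hasFDerivAt_id p).sub_const p)).const_sub
    (ContinuousLinearMap.id ℝ V)
  simpa using h

/-- The field with value `u` at `p` whose derivative at `p` is that of a parallel field. -/
def parallelField (D : V →L[ℝ] V →L[ℝ] V) (p u y : V) : V := u - D (y - p) u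

theorem parallelField_self (D : V →L[ℝ] V →L[ℝ] V) (p u : V) : parallelField D p u p = u := by
  simp [parallelField]

theorem hasFDerivAt_parallelField (D : V →L[ℝ] V →L[ℝ] V) (p u : V) :
    HasFDerivAt (parallelField D p u) (-D.flip u) p := by
  have h := (hasFDerivAt_id_sub D p).clm_apply (hasFDerivAt_const u p)
  rw [ContinuousLinearMap.comp_zero, zero_add] at h
  exact h

theorem fderiv_parallelField (D : V →L[ℝ] V →L[ℝ] V) (p u x : V) :
    fderiv ℝ (parallelField D p u) p x = -D x u := by
  rw [(hasFDerivAt_parallelField D p u).fderiv]; rfl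

theorem covDeriv_apply_eq {p : V} (hΥ : DifferentiableAt ℝ Υ p) (D : V →L[ℝ] V →L[ℝ] V)
    (x u v w : V) : covDeriv Υ D p x ![u, v, w] = fderiv ℝ (fun y => Υ y
      ![parallelField D p u y, parallelField D p v y, parallelField D p w y]) p x := by
  have h := fderiv_alternating_three
    (hΥ.continuousAlternatingMapCompContinuousLinearMap (hasFDerivAt_id_sub D p).differentiableAt)
    (differentiableAt_const u) (differentiableAt_const v) (differentiableAt_const w) x
  simp only [fderiv_fun_const, Pi.zero_apply, zero_apply] at h
  rw [ContinuousAlternatingMap.map_coord_zero _ (m := ![0, v, w]) (0 : Fin 3) rfl,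
    ContinuousAlternatingMap.map_coord_zero _ (m := ![u, 0, w]) (1 : Fin 3) rfl,
    ContinuousAlternatingMap.map_coord_zero _ (m := ![u, v, 0]) (2 : Fin 3) rfl,
    add_zero, add_zero, add_zero] at h
  rw [covDeriv, ← h]
  congr 2
  funext y
  rw [ContinuousAlternatingMap.compContinuousLinearMap_apply]
  congr 1
  funext i
  fin_cases i <;> rfl

/-- This identifies the derivative of the pulled back form with the usual covariant derivative. The
definition by pullback has the advantage of being an alternating form, linear in the direction, by
construction. -/
theorem covDeriv_apply {p : V} (hΥ : DifferentiableAt ℝ Υ p) (D : V →L[ℝ] V →L[ℝ] V)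
    (x u v w : V) : covDeriv Υ D p x ![u, v, w] = fderiv ℝ Υ p x ![u, v, w]
      - Υ p ![D x u, v, w] - Υ p ![u, D x v, w] - Υ p ![u, v, D x w] := by
  have d := fun u => (hasFDerivAt_parallelField D p u).differentiableAt
  rw [covDeriv_apply_eq hΥ, fderiv_alternating_three hΥ (d u) (d v) (d w)]
  simp only [parallelField_self, fderiv_parallelField]
  have e0 := (Υ p).toAlternatingMap.map_update_neg ![u, v, w] 0 (D x u)
  have e1 := (Υ p).toAlternatingMap.map_update_neg ![u, v, w] 1 (D x v)
  have e2 := (Υ p).toAlternatingMap.map_update_neg ![u, v, w] 2 (D x w)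
  simp only [ContinuousAlternatingMap.coe_toAlternatingMap] at e0 e1 e2
  have f0 : ∀ a, Function.update ![u, v, w] 0 a = ![a, v, w] := fun a => by
    funext i; fin_cases i <;> rfl
  have f1 : ∀ a, Function.update ![u, v, w] 1 a = ![u, a, w] := fun a => by
    funext i; fin_cases i <;> rfl
  have f2 : ∀ a, Function.update ![u, v, w] 2 a = ![u, v, a] := fun a => by
    funext i; fin_cases i <;> rfl
  rw [f0, f0] at e0
  rw [f1, f1] at e1
  rw [f2, f2] at e2
  rw [e0, e1, e2]
  ring

theorem hasFDerivAt_mul_zero {a b : V → ℂ} {p : V} (ha : HasFDerivAt a (0 : V →L[ℝ] ℂ) p)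
    (hb : HasFDerivAt b (0 : V →L[ℝ] ℂ) p) :
    HasFDerivAt (fun y => a y * b y) (0 : V →L[ℝ] ℂ) p := by
  have h := ha.mul hb
  simp only [smul_zero, add_zero] at h
  exact h

theorem hasFDerivAt_det_zero {a : Fin 3 → Fin 3 → V → ℂ} {p : V}
    (ha : ∀ i j, HasFDerivAt (a i j) (0 : V →L[ℝ] ℂ) p) :
    HasFDerivAt (fun y => Matrix.det (Matrix.of fun i j => a i j y)) (0 : V →L[ℝ] ℂ) p := by
  simp only [Matrix.det_fin_three, Matrix.of_apply]
  have h := fun i j k l m n => hasFDerivAt_mul_zero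
    (hasFDerivAt_mul_zero (ha i j) (ha k l)) (ha m n)
  have e := ((((((h 0 0 1 1 2 2).sub (h 0 0 1 2 2 1)).sub (h 0 1 1 0 2 2)).add
    (h 0 1 1 2 2 0)).add (h 0 2 1 0 2 1)).sub (h 0 2 1 1 2 0))
  simp only [sub_zero, add_zero] at e
  exact e

theorem hasFDerivAt_zero_of_fderiv {F : Type*} [NormedAddCommGroup F] [NormedSpace ℝ F] {a : V → F}
    {p : V} (ha : DifferentiableAt ℝ a p) (h : ∀ x, fderiv ℝ a p x = 0) :
    HasFDerivAt a (0 : V →L[ℝ] F) p := by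
  have := ha.hasFDerivAt
  rwa [show fderiv ℝ a p = 0 from ContinuousLinearMap.ext h] at this

namespace IsTransverseConnection

variable (T : IsTransverseConnection U c g η ξ Φ D) (S : LocalSasakian U c g η ξ Φ) {y : V}
  (hy : y ∈ U)

include T S hy

/-- The Hermitian form is built from the parallel tensors `g`, `η` and `Φ`, so it is stationary at
`y` on fields that are parallel at `y`. -/
theorem hasFDerivAt_hermitian (u v : V) : HasFDerivAt (fun p => IsContactMetric.hermitian
      (bil (g p)) (η p : V →ₗ[ℝ] ℝ) (Φ p : V →ₗ[ℝ] V)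
      (parallelField (D y) y u p) (parallelField (D y) y v p)) (0 : V →L[ℝ] ℂ) y := by
  have d := fun u => (hasFDerivAt_parallelField (D y) y u).differentiableAt
  have dη := fun u => (S.diff_η hy).clm_apply (d u)
  have dΦ := fun u => (S.diff_Φ hy).clm_apply (d u)
  have h1 : ∀ u, HasFDerivAt (fun p => η p (parallelField (D y) y u p)) (0 : V →L[ℝ] ℝ) y :=
    fun u => hasFDerivAt_zero_of_fderiv (dη u) fun x => by
      rw [fderiv_apply_fun (S.diff_η hy) (d u), T.contact y hy, fderiv_parallelField,
        parallelField_self, map_neg, add_neg_cancel]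
  have h2 : HasFDerivAt (fun p => g p (parallelField (D y) y u p) (parallelField (D y) y v p))
      (0 : V →L[ℝ] ℝ) y :=
    hasFDerivAt_zero_of_fderiv (((S.diff_g hy).clm_apply (d u)).clm_apply (d v)) fun x => by
      rw [fderiv_apply_fun₂ (S.diff_g hy) (d u) (d v), T.metric y hy, fderiv_parallelField,
        fderiv_parallelField, parallelField_self, parallelField_self]
      simp
  have h3 : HasFDerivAt (fun p => g p (Φ p (parallelField (D y) y u p))
      (parallelField (D y) y v p)) (0 : V →L[ℝ] ℝ) y :=
    hasFDerivAt_zero_of_fderiv (((S.diff_g hy).clm_apply (dΦ u)).clm_apply (d v)) fun x => by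
      rw [fderiv_apply_fun₂ (S.diff_g hy) (dΦ u) (d v), T.metric y hy,
        fderiv_apply_fun (S.diff_Φ hy) (d u), T.endo y hy, fderiv_parallelField,
        fderiv_parallelField, parallelField_self, parallelField_self]
      simp only [map_add, map_sub, map_neg, add_apply,
        sub_apply, neg_apply]
      ring
  have h4 := h2.sub ((h1 u).mul (h1 v))
  have e4 := Complex.ofRealCLM.hasFDerivAt.comp y h4
  have e3 := (Complex.ofRealCLM.hasFDerivAt.comp y h3).const_mul Complex.I
  have e := e4.sub e3
  simp only [smul_zero, add_zero, sub_zero, ContinuousLinearMap.comp_zero] at e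
  exact e

/-- Parallel `ξ` and `Φ` make covariant differentiation preserve type. The derivative of `Υ` is then
a multiple of `Υ`. -/
theorem covDeriv_threeZero (Y : LocalVolume U g η ξ Φ Υ) (x : V) :
    IsContactMetric.IsThreeZero (ξ y) (Φ y : V →ₗ[ℝ] V)
      (covDeriv Υ (D y) y x).toAlternatingMap := by
  have dΥ := differentiableAt_of_contDiffOn S.isOpen Y.smooth hy
  have z : ∀ p ∈ U, ∀ v w, Υ p ![ξ p, v, w] = 0 := fun p hp v w => (Y.threeZero p hp).transversal v w
  have z1 : ∀ v w, Υ y ![v, ξ y, w] = 0 := fun v w => by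
    have := IsContactMetric.swap_zero_one (Υ y).toAlternatingMap (ξ y) v w
    simpa [z y hy] using this
  have t : ∀ p ∈ U, ∀ u v w, Υ p ![Φ p u, v, w] = Complex.I * Υ p ![u, v, w] :=
    fun p hp u v w => (Y.threeZero p hp).type u v w
  refine ⟨fun v w => ?_, fun u v w => ?_⟩
  · have h := congrArg (fun T => T x) (fderiv_congr_of_isOpen S.isOpen hy
      (f := fun p => Υ p ![ξ p, v, w]) (h := fun _ => 0) fun p hp => z p hp v w)
    rw [fderiv_alternating_three dΥ (S.diff_ξ hy) (differentiableAt_const v)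
      (differentiableAt_const w), T.reeb y hy] at h
    change covDeriv Υ (D y) y x ![ξ y, v, w] = 0
    rw [covDeriv_apply dΥ]
    simp only [fderiv_fun_const, Pi.zero_apply, zero_apply, z y hy] at h ⊢
    have e := (Υ y).toAlternatingMap.map_update_neg ![ξ y, v, w] 0 (D y x (ξ y))
    have f0 : ∀ a, Function.update ![ξ y, v, w] 0 a = ![a, v, w] := fun a => by
      funext i; fin_cases i <;> rfl
    rw [f0, f0] at e
    simp only [ContinuousAlternatingMap.coe_toAlternatingMap] at e
    rw [e] at h
    linear_combination h
  · have dΦ := (S.diff_Φ hy).clm_apply (differentiableAt_const u)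
    have dΥu : DifferentiableAt ℝ (fun p => Υ p ![u, v, w]) y :=
      dΥ.continuousAlternatingMap_apply fun _ => differentiableAt_const _
    have h := congrArg (fun T => T x) (fderiv_congr_of_isOpen S.isOpen hy
      (f := fun p => Υ p ![Φ p u, v, w]) (h := fun p => Complex.I * Υ p ![u, v, w])
      fun p hp => t p hp u v w)
    rw [fderiv_const_mul dΥu] at h
    change _ = Complex.I * fderiv ℝ (fun p => Υ p ![u, v, w]) y x at h
    rw [fderiv_alternating_three dΥ dΦ (differentiableAt_const v) (differentiableAt_const w),
      fderiv_alternating_three dΥ (differentiableAt_const u) (differentiableAt_const v)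
        (differentiableAt_const w), fderiv_apply_const (S.diff_Φ hy), T.endo y hy] at h
    change covDeriv Υ (D y) y x ![Φ y u, v, w] = Complex.I * covDeriv Υ (D y) y x ![u, v, w]
    have e := (Υ y).toAlternatingMap.map_update_sub ![u, v, w] 0 (Φ y (D y x u)) (D y x (Φ y u))
    have f0 : ∀ a, Function.update ![u, v, w] 0 a = ![a, v, w] := fun a => by
      funext i; fin_cases i <;> rfl
    rw [f0, f0, f0] at e
    simp only [ContinuousAlternatingMap.coe_toAlternatingMap] at e
    rw [e, t y hy] at h
    have n0 : ∀ a b, Υ y ![0, a, b] = 0 := fun a b =>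
      ContinuousAlternatingMap.map_coord_zero _ (0 : Fin 3) rfl
    have n1 : ∀ a b, Υ y ![a, 0, b] = 0 := fun a b =>
      ContinuousAlternatingMap.map_coord_zero _ (1 : Fin 3) rfl
    have n2 : ∀ a b, Υ y ![a, b, 0] = 0 := fun a b =>
      ContinuousAlternatingMap.map_coord_zero _ (2 : Fin 3) rfl
    rw [covDeriv_apply dΥ, covDeriv_apply dΥ]
    simp only [fderiv_fun_const, Pi.zero_apply, zero_apply, t y hy, n0, n1, n2,
      add_zero] at h ⊢
    linear_combination h

end IsTransverseConnection
end LocalGeometry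

theorem IsContactMetric.exists_special_frame_of_normSq {V : Type*} [AddCommGroup V] [Module ℝ V]
    {g : V →ₗ[ℝ] V →ₗ[ℝ] ℝ} {η : V →ₗ[ℝ] ℝ} {ξ : V} {Φ : V →ₗ[ℝ] V} (S : IsContactMetric g η ξ Φ)
    (hV : Module.finrank ℝ V = 7) {Υ : V [⋀^Fin 3]→ₗ[ℝ] ℂ} (hΥ : IsThreeZero ξ Φ Υ)
    (h : ∀ u, Υ u * (starRingEnd ℂ) (Υ u) =
      Matrix.det (Matrix.of fun i j => hermitian g η Φ (u i) (u j))) :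
    ∃ e, IsFrame g η Φ e ∧ Υ e = 1 := by
  obtain ⟨e, he⟩ := S.exists_frame hV
  refine S.exists_special_frame he hΥ ((h e).trans ?_)
  simp only [Matrix.det_fin_three, Matrix.of_apply, hermitian, he.orthonormal, he.horizontal,
    he.isotropic]
  simp

/-! ### The volume form is parallel, and the Ricci trace follows -/

section LocalGeometry

variable {V : Type*} [NormedAddCommGroup V] [NormedSpace ℝ V]

variable {U : Set V} {c : ℝ} {g : V → V →L[ℝ] V →L[ℝ] ℝ} {η : V → V →L[ℝ] ℝ}
    {ξ : V → V} {Φ : V → V →L[ℝ] V} {Γ : V → V →L[ℝ] V →L[ℝ] V}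
    {Υ : V → V [⋀^Fin 3]→L[ℝ] ℂ} {D : V → V →L[ℝ] V →L[ℝ] V}

namespace IsTransverseConnection

variable (T : IsTransverseConnection U c g η ξ Φ D) (S : LocalSasakian U c g η ξ Φ) {y : V}
  (hy : y ∈ U)

include T S hy

theorem exists_frame (hV : Module.finrank ℝ V = 7) (Y : LocalVolume U g η ξ Φ Υ) : ∃ e,
    IsContactMetric.IsFrame (bil (g y)) (η y : V →ₗ[ℝ] ℝ) (Φ y : V →ₗ[ℝ] V) e ∧ Υ y e = 1 :=
  (S.contact y hy).exists_special_frame_of_normSq hV (Y.threeZero y hy) (Y.normSq y hy)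

/-- On the parallel extension of the frame, `|Υ|²` is a determinant of Hermitian products and hence
stationary. Since `Υ e = 1`, its derivative is twice the real part in question. -/
theorem covDeriv_re_eq_zero (Y : LocalVolume U g η ξ Φ Υ) {e : Fin 3 → V} (he : Υ y e = 1)
    (x : V) : (covDeriv Υ (D y) y x e).re = 0 := by
  have dΥ := differentiableAt_of_contDiffOn S.isOpen Y.smooth hy
  have d := fun u => (hasFDerivAt_parallelField (D y) y u).differentiableAt
  have hE : e = ![e 0, e 1, e 2] := by funext i; fin_cases i <;> rfl
  set F : V → ℂ := fun p => Υ p ![parallelField (D y) y (e 0) p, parallelField (D y) y (e 1) p,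
    parallelField (D y) y (e 2) p] with hF
  have dF : DifferentiableAt ℝ F y := dΥ.continuousAlternatingMap_apply fun i => by
    fin_cases i <;> exact d _
  have hFy : F y = 1 := by
    simp only [hF, parallelField_self]
    rw [← hE, he]
  have hdF : fderiv ℝ F y x = covDeriv Υ (D y) y x e := by
    conv_rhs => rw [hE]
    rw [covDeriv_apply_eq dΥ]
  have h0 : HasFDerivAt (fun p => F p * (starRingEnd ℂ) (F p)) (0 : V →L[ℝ] ℂ) y := by
    have := hasFDerivAt_det_zero (p := y) fun i j => T.hasFDerivAt_hermitian S hy (e i) (e j)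
    refine this.congr_of_eventuallyEq (Filter.eventually_of_mem (S.isOpen.mem_nhds hy) fun p hp => ?_)
    have h := Y.normSq p hp ![parallelField (D y) y (e 0) p, parallelField (D y) y (e 1) p,
      parallelField (D y) y (e 2) p]
    refine h.trans ?_
    congr 1
    ext i j
    fin_cases i <;> fin_cases j <;> rfl
  have h1 := dF.hasFDerivAt.mul
    ((Complex.conjCLE : ℂ →L[ℝ] ℂ).hasFDerivAt.comp y dF.hasFDerivAt)
  have h2 := congrArg (fun T => (T x).re) (h0.unique h1)
  change 0 = (F y * (starRingEnd ℂ) (fderiv ℝ F y x)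
    + (starRingEnd ℂ) (F y) * fderiv ℝ F y x).re at h2
  rw [hFy, hdF] at h2
  simp at h2
  linarith

/-- The derivative is `θ ⊗ Υ` by type, with `θ` imaginary by constancy of the norm. Closedness gives
`θ ∧ Υ = 0`, which forces `θ(ξ) = 0` and `θ ∘ Φ = i θ` on the frame. An imaginary form with this
property is zero. -/
theorem covDeriv_eq_zero (hV : Module.finrank ℝ V = 7) (Y : LocalVolume U g η ξ Φ Υ) (x : V) :
    covDeriv Υ (D y) y x = 0 := by
  obtain ⟨e, he, he1⟩ := T.exists_frame S hy hV Y
  have hc := S.contact y hy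
  have hE : e = ![e 0, e 1, e 2] := by funext i; fin_cases i <;> rfl
  have dΥ := differentiableAt_of_contDiffOn S.isOpen Y.smooth hy
  set θ : V →ₗ[ℝ] ℂ := LinearMap.mk ⟨fun x => covDeriv Υ (D y) y x e, fun a b => by
    simp [covDeriv]⟩ (fun a b => by simp [covDeriv]) with hθ
  have hY := Y.threeZero y hy
  have hC : ∀ x u, covDeriv Υ (D y) y x u = θ x * Υ y u := fun x u => by
    have h1 := hc.threeZero_expand hV he (T.covDeriv_threeZero S hy Y x) u
    have h2 := hc.threeZero_expand hV he hY u
    simp only [ContinuousAlternatingMap.coe_toAlternatingMap] at h1 h2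
    rw [h1, h2, he1, mul_one, mul_comm]
    rfl
  have hre : ∀ x, (θ x).re = 0 := T.covDeriv_re_eq_zero S hy Y he1
  have tr : ∀ v w, Υ y ![ξ y, v, w] = 0 := hY.transversal
  have ty : ∀ u v w, Υ y ![Φ y u, v, w] = Complex.I * Υ y ![u, v, w] := hY.type
  have s01 : ∀ u v w, Υ y ![v, u, w] = -Υ y ![u, v, w] :=
    IsContactMetric.swap_zero_one (Υ y).toAlternatingMap
  have s12 : ∀ u v w, Υ y ![u, w, v] = -Υ y ![u, v, w] :=
    IsContactMetric.swap_one_two (Υ y).toAlternatingMap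
  have a0 : ∀ a b v w, Υ y ![a, v, w] - Υ y ![b, v, w] = Υ y ![a - b, v, w] := fun a b v w => by
    have e := (Υ y).toAlternatingMap.map_update_sub ![a, v, w] 0 a b
    have f0 : ∀ b, Function.update ![a, v, w] 0 b = ![b, v, w] := fun b => by
      funext i; fin_cases i <;> rfl
    rw [f0, f0, f0] at e
    exact e.symm
  -- The torsion points along `ξ`, which `Υ` annihilates. Thus `dΥ` is the alternation of the
  -- covariant derivative, as for a torsion-free connection.
  have tor : ∀ a b v w, Υ y ![D y a b, v, w] - Υ y ![D y b a, v, w] = 0 := fun a b v w => by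
    have m := (Υ y).toAlternatingMap.map_update_smul ![ξ y, v, w] 0 (c * g y (Φ y a) b) (ξ y)
    have f0 : ∀ b, Function.update ![ξ y, v, w] 0 b = ![b, v, w] := fun b => by
      funext i; fin_cases i <;> rfl
    rw [f0, f0] at m
    simp only [ContinuousAlternatingMap.coe_toAlternatingMap] at m
    rw [a0, T.torsion y hy, m, tr, smul_zero]
  have hcl : ∀ a b u v, θ a * Υ y ![b, u, v] - θ b * Υ y ![a, u, v] + θ u * Υ y ![a, b, v]
      - θ v * Υ y ![a, b, u] = 0 := fun a b u v => by
    have h := Y.closed y hy a b u v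
    rw [← hC, ← hC, ← hC, ← hC, covDeriv_apply dΥ, covDeriv_apply dΥ, covDeriv_apply dΥ,
      covDeriv_apply dΥ]
    have t1 := tor a b u v
    have t2 := tor a u b v
    have t3 := tor a v b u
    have t4 := tor b u a v
    have t5 := tor b v a u
    have t6 := tor u v a b
    rw [s01 (D y a u) b v, s12 b (D y a v) u, s01 (D y a v) b u,
      s01 (D y b u) a v, s12 a (D y b v) u, s01 (D y b v) a u,
      s01 (D y u b) a v, s12 a (D y u v) b, s01 (D y u v) a b,
      s01 (D y v b) a u, s12 a (D y v u) b, s01 (D y v u) a b]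
    linear_combination h - t1 + t2 - t3 - t4 + t5 - t6
  have e1 : Υ y ![e 0, e 1, e 2] = 1 := by rw [← hE, he1]
  have z01 : ∀ u w, Υ y ![u, u, w] = 0 := IsContactMetric.same_zero_one (Υ y).toAlternatingMap
  have z02 : ∀ u w, Υ y ![u, w, u] = 0 := IsContactMetric.same_zero_two (Υ y).toAlternatingMap
  have z12 : ∀ u w, Υ y ![w, u, u] = 0 := IsContactMetric.same_one_two (Υ y).toAlternatingMap
  have hξ : θ (ξ y) = 0 := by
    have h := hcl (ξ y) (e 0) (e 1) (e 2)
    simpa [tr, e1] using h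
  -- In `(θ ∧ Υ)(Φ e_k, e₀, e₁, e₂) = 0` every term in which `Υ` meets `e_k` twice vanishes, so one
  -- term remains besides `θ(Φ e_k)`.
  have hΦ : ∀ k, θ (Φ y (e k)) = Complex.I * θ (e k) := by
    have h := fun k => hcl (Φ y (e k)) (e 0) (e 1) (e 2)
    simp only [ty, e1] at h
    have h102 : Υ y ![e 1, e 0, e 2] = -1 := by rw [s01, e1]
    have h201 : Υ y ![e 2, e 0, e 1] = 1 := by rw [s01, s12, e1, neg_neg]
    have h0 := h 0
    have h1 := h 1
    have h2 := h 2
    rw [e1, z01, z01] at h0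
    rw [z01, h102, z02] at h1
    rw [z02, z02, h201] at h2
    intro k
    fin_cases k
    · change θ (Φ y (e 0)) = Complex.I * θ (e 0)
      linear_combination h0
    · change θ (Φ y (e 1)) = Complex.I * θ (e 1)
      linear_combination h1
    · change θ (Φ y (e 2)) = Complex.I * θ (e 2)
      linear_combination h2
  have hk : ∀ k, θ (e k) = 0 := fun k => by
    have h := hre (Φ y (e k))
    rw [hΦ] at h
    apply Complex.ext (hre (e k))
    simpa using h
  have hx : θ x = 0 := by
    have h := hc.expand hV he x
    rw [h]
    simp only [map_add, map_smul, map_sum, hξ, ContinuousLinearMap.coe_coe, hΦ, hk]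
    simp
  ext u
  rw [hC, hx, zero_mul]
  rfl

theorem fderiv_volume (hV : Module.finrank ℝ V = 7) (Y : LocalVolume U g η ξ Φ Υ) (x u v w : V) :
    fderiv ℝ Υ y x ![u, v, w] = Υ y ![D y x u, v, w] + Υ y ![u, D y x v, w]
      + Υ y ![u, v, D y x w] := by
  have dΥ := differentiableAt_of_contDiffOn S.isOpen Y.smooth hy
  have h := covDeriv_apply dΥ (D y) x u v w
  rw [T.covDeriv_eq_zero S hy hV Y] at h
  change 0 = _ at h
  linear_combination -h

omit S in
theorem fderiv_apply_volume (dΥ : DifferentiableAt ℝ Υ y) (x z u v w : V) :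
    fderiv ℝ (fun p => Υ p ![D p x u, v, w]) y z = fderiv ℝ Υ y z ![D y x u, v, w]
      + Υ y ![fderiv ℝ D y z x u, v, w] := by
  have hD := ((T.diff y hy).clm_apply (differentiableAt_const x)).clm_apply
    (differentiableAt_const u)
  rw [fderiv_alternating_three dΥ hD (differentiableAt_const v) (differentiableAt_const w),
    fderiv_apply_fun₂ (T.diff y hy) (differentiableAt_const x) (differentiableAt_const u)]
  have n1 : ∀ a b, Υ y ![a, 0, b] = 0 := fun a b =>
    ContinuousAlternatingMap.map_coord_zero _ (1 : Fin 3) rfl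
  have n2 : ∀ a b, Υ y ![a, b, 0] = 0 := fun a b =>
    ContinuousAlternatingMap.map_coord_zero _ (2 : Fin 3) rfl
  simp [n1, n2]

theorem curvature_volume (hV : Module.finrank ℝ V = 7) (Y : LocalVolume U g η ξ Φ Υ)
    (x z u v w : V) :
    Υ y ![curvature (fderiv ℝ D y) (D y) x z u, v, w]
      + Υ y ![u, curvature (fderiv ℝ D y) (D y) x z v, w]
      + Υ y ![u, v, curvature (fderiv ℝ D y) (D y) x z w] = 0 := by
  have dΥ := differentiableAt_of_contDiffOn S.isOpen Y.smooth hy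
  have ddΥ := differentiableAt_fderiv_of_contDiffOn S.isOpen Y.smooth hy
  have s01 : ∀ p u v w, Υ p ![v, u, w] = -Υ p ![u, v, w] :=
    fun p => IsContactMetric.swap_zero_one (Υ p).toAlternatingMap
  have s12 : ∀ p u v w, Υ p ![u, w, v] = -Υ p ![u, v, w] :=
    fun p => IsContactMetric.swap_one_two (Υ p).toAlternatingMap
  have cyc : ∀ p u v w, Υ p ![v, w, u] = Υ p ![u, v, w] := fun p u v w => by
    rw [s12, s01, neg_neg]
  -- The arguments are rotated cyclically, without sign, so that the connection always acts in the
  -- first slot and `fderiv_apply_volume` handles all three terms.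
  have hpar : ∀ p ∈ U, ∀ x u v w, fderiv ℝ Υ p x ![u, v, w] =
      Υ p ![D p x u, v, w] + Υ p ![D p x v, w, u] + Υ p ![D p x w, u, v] :=
    fun p hp x u v w => by
    rw [T.fderiv_volume S hp hV Y, cyc p u (D p x v) w, ← cyc p (D p x w) u v]
  have dD := fun x u : V => ((T.diff y hy).clm_apply (differentiableAt_const x)).clm_apply
    (differentiableAt_const u)
  have dF : ∀ x u v w, DifferentiableAt ℝ (fun p => Υ p ![D p x u, v, w]) y := fun x u v w =>
    dΥ.continuousAlternatingMap_apply fun i => by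
      fin_cases i
      · exact dD x u
      · exact differentiableAt_const v
      · exact differentiableAt_const w
  have h : ∀ z x, fderiv ℝ (fderiv ℝ Υ) y z x ![u, v, w] =
      (fderiv ℝ Υ y z ![D y x u, v, w] + Υ y ![fderiv ℝ D y z x u, v, w])
      + (fderiv ℝ Υ y z ![D y x v, w, u] + Υ y ![fderiv ℝ D y z x v, w, u])
      + (fderiv ℝ Υ y z ![D y x w, u, v] + Υ y ![fderiv ℝ D y z x w, u, v]) := fun z x => by
    have h := congrArg (fun T => T z) (fderiv_congr_of_isOpen S.isOpen hy
      (f := fun p => fderiv ℝ Υ p x ![u, v, w])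
      (h := fun p => Υ p ![D p x u, v, w] + Υ p ![D p x v, w, u] + Υ p ![D p x w, u, v])
      fun p hp => hpar p hp x u v w)
    rw [fderiv_fun_add ((dF x u v w).fun_add (dF x v w u)) (dF x w u v),
      fderiv_fun_add (dF x u v w) (dF x v w u)] at h
    change _ = fderiv ℝ (fun p => Υ p ![D p x u, v, w]) y z
      + fderiv ℝ (fun p => Υ p ![D p x v, w, u]) y z
      + fderiv ℝ (fun p => Υ p ![D p x w, u, v]) y z at h
    rw [T.fderiv_apply_volume hy dΥ, T.fderiv_apply_volume hy dΥ,
      T.fderiv_apply_volume hy dΥ] at h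
    rw [← h, fderiv_alternating_three (ddΥ.clm_apply (differentiableAt_const x))
      (differentiableAt_const u) (differentiableAt_const v) (differentiableAt_const w),
      fderiv_apply_const ddΥ]
    have n0 : ∀ a b, fderiv ℝ Υ y x ![0, a, b] = 0 := fun a b =>
      ContinuousAlternatingMap.map_coord_zero _ (0 : Fin 3) rfl
    have n1 : ∀ a b, fderiv ℝ Υ y x ![a, 0, b] = 0 := fun a b =>
      ContinuousAlternatingMap.map_coord_zero _ (1 : Fin 3) rfl
    have n2 : ∀ a b, fderiv ℝ Υ y x ![a, b, 0] = 0 := fun a b =>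
      ContinuousAlternatingMap.map_coord_zero _ (2 : Fin 3) rfl
    simp [n0, n1, n2]
  have h' := congrArg (fun T => T ![u, v, w]) (fderiv_fderiv_comm S.isOpen Y.smooth hy x z)
  change fderiv ℝ (fderiv ℝ Υ) y x z ![u, v, w] = fderiv ℝ (fderiv ℝ Υ) y z x ![u, v, w] at h'
  rw [h, h] at h'
  simp only [hpar y hy] at h'
  have a0 : ∀ a b v w, Υ y ![a + b, v, w] = Υ y ![a, v, w] + Υ y ![b, v, w] := fun a b v w =>
    by
    have e := (Υ y).toAlternatingMap.map_update_add ![a, v, w] 0 a b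
    have f0 : ∀ b, Function.update ![a, v, w] 0 b = ![b, v, w] := fun b => by
      funext i; fin_cases i <;> rfl
    rw [f0, f0, f0] at e
    exact e
  have m0 : ∀ a b v w, Υ y ![a - b, v, w] = Υ y ![a, v, w] - Υ y ![b, v, w] := fun a b v w =>
    by
    rw [eq_sub_iff_add_eq, ← a0, sub_add_cancel]
  rw [← cyc y u (curvature (fderiv ℝ D y) (D y) x z v) w,
    cyc y (curvature (fderiv ℝ D y) (D y) x z w) u v]
  simp only [curvature_apply, a0, m0]
  have c1 := fun a b => cyc y (D y a u) (D y b v) w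
  have c2 := fun a b => (cyc y v (D y b w) (D y a u)).trans (cyc y (D y a u) v (D y b w))
  have c3 := fun a b => cyc y (D y a v) (D y b w) u
  linear_combination h' + c1 x z - c1 z x + c2 x z - c2 z x + c3 x z - c3 z x

/-- The transverse connection is Ricci flat. -/
theorem trace_curvature (hV : Module.finrank ℝ V = 7) (Y : LocalVolume U g η ξ Φ Υ) (v w : V) :
    LinearMap.trace ℝ V (((curvature (fderiv ℝ D y) (D y)).flip v).flip w) = 0 := by
  obtain ⟨e, he, he1⟩ := T.exists_frame S hy hV Y
  exact (S.contact y hy).trace_curvature_eq_zero hV (T.curvature_swap S hy)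
    (T.curvature_skew S hy) (T.curvature_endo S hy) (T.curvature_reeb S hy) (T.bianchi S hy)
    (fun x z => (S.contact y hy).trace_Φ_comp_eq_zero hV he (Y.threeZero y hy) he1
      (T.curvature_endo S hy x z)
      (T.curvature_volume S hy hV Y x z)) v w

/-- The tensor `contactTensor` is parallel for the transverse connection. -/
theorem fderiv_contactTensor (x v w : V) :
    fderiv ℝ (contactTensor c g η ξ Φ) y x v w =
      contactTensor c g η ξ Φ y (D y x v) w + contactTensor c g η ξ Φ y v (D y x w)
        - D y x (contactTensor c g η ξ Φ y v w) := by
  have hK := S.diff_contactTensor hy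
  have dη := fun v => (S.diff_η hy).clm_apply (differentiableAt_const v)
  have dΦ := fun v => (S.diff_Φ hy).clm_apply (differentiableAt_const v)
  have dg := ((S.diff_g hy).clm_apply (dΦ v)).clm_apply (differentiableAt_const w)
  have h : fderiv ℝ (fun p => contactTensor c g η ξ Φ p v w) y x =
      (c / 2) • ((η y v • (Φ y (D y x w) - D y x (Φ y w)) + η y (D y x v) • Φ y w)
        + (η y w • (Φ y (D y x v) - D y x (Φ y v)) + η y (D y x w) • Φ y v)
        - (-(g y (Φ y v) w • D y x (ξ y))
          + (g y (Φ y v) (D y x w) + g y (Φ y (D y x v)) w) • ξ y)) := by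
    simp only [contactTensor_apply]
    rw [fderiv_fun_const_smul ((((dη v).fun_smul (dΦ w)).fun_add ((dη w).fun_smul (dΦ v))).fun_sub
        (dg.fun_smul (S.diff_ξ hy))),
      fderiv_fun_sub (((dη v).fun_smul (dΦ w)).fun_add ((dη w).fun_smul (dΦ v))) (dg.fun_smul (S.diff_ξ hy)),
      fderiv_fun_add ((dη v).fun_smul (dΦ w)) ((dη w).fun_smul (dΦ v)),
      fderiv_fun_smul (dη v) (dΦ w), fderiv_fun_smul (dη w) (dΦ v),
      fderiv_fun_smul dg (S.diff_ξ hy)]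
    simp only [add_apply, sub_apply,
      smul_apply, ContinuousLinearMap.smulRight_apply]
    rw [fderiv_apply_const (S.diff_η hy), fderiv_apply_const (S.diff_η hy),
      fderiv_apply_const (S.diff_Φ hy), fderiv_apply_const (S.diff_Φ hy),
      fderiv_apply_fun₂ (S.diff_g hy) (dΦ v) (differentiableAt_const w),
      fderiv_apply_const (S.diff_Φ hy), T.endo y hy, T.endo y hy, T.contact y hy, T.contact y hy,
      T.reeb y hy, T.metric y hy]
    simp only [fderiv_fun_const, Pi.zero_apply, zero_apply, map_zero,
      map_sub, sub_apply]
    module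
  rw [fderiv_apply_fun₂ hK (differentiableAt_const v) (differentiableAt_const w)] at h
  simp only [fderiv_fun_const, Pi.zero_apply, zero_apply, map_zero,
    add_zero] at h
  rw [h]
  simp only [contactTensor_apply, map_add, map_sub, map_smul]
  module

end IsTransverseConnection

namespace LocalSasakian

/-- The Ricci curvature of a Sasakian structure with a parallel transverse volume form. -/
theorem trace_curvature (S : LocalSasakian U c g η ξ Φ) (L : IsLeviCivita U g Γ)
    (hV : Module.finrank ℝ V = 7) (Y : LocalVolume U g η ξ Φ Υ) {y : V} (hy : y ∈ U) (v w : V) :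
    LinearMap.trace ℝ V (((curvature (fderiv ℝ Γ y) (Γ y)).flip v).flip w) =
      3 * c ^ 2 / 2 * (η y v * η y w) - c ^ 2 / 2 * (g y v w - η y v * η y w) := by
  have T := S.isTransverseConnection L
  set K := contactTensor c g η ξ Φ with hK
  set D : V → V →L[ℝ] V →L[ℝ] V := fun y => Γ y - K y with hD
  have dK := S.diff_contactTensor hy
  have dΓ : fderiv ℝ Γ y = fderiv ℝ D y + fderiv ℝ K y := by
    rw [hD, fderiv_fun_sub (L.smooth y hy) dK, sub_add_cancel]
  have hΓ : Γ y = D y + K y := by simp [hD]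
  refine (S.contact y hy).trace_ricci hV (K := fun x u => K y x u)
    (T.trace_curvature S hy hV Y v w) (fun x u => contactTensor_apply ..) v w fun x => ?_
  change curvature (fderiv ℝ Γ y) (Γ y) x v w = curvature (fderiv ℝ D y) (D y) x v w
    + (c * g y (Φ y x) v) • K y (ξ y) w + K y x (K y v w) - K y v (K y x w)
  -- For `Γ = D + K` the linear correction to the curvature is the exterior covariant derivative of
  -- `K`. As `K` is parallel, only its torsion part, computed here, survives.
  have ht : (c * g y (Φ y x) v) • K y (ξ y) w = K y (D y x v) w - K y (D y v x) w := by
    rw [← sub_apply, ← map_sub, T.torsion y hy, map_smul]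
    rfl
  rw [curvature_apply, curvature_apply, dΓ, hΓ, ht]
  simp only [add_apply, map_add]
  rw [T.fderiv_contactTensor S hy, T.fderiv_contactTensor S hy]
  abel

end LocalSasakian
end LocalGeometry

/-! ### Coordinate expressions and smoothness -/

section Charts

variable {M : Type*} [TopologicalSpace M] [ChartedSpace E7 M] [IsManifold (𝓡 7) ∞ M]

theorem chartCoframe_comp_chartFrame (x₀ : M) {y : E7} (hy : y ∈ (extChartAt (𝓡 7) x₀).target) :
    (chartCoframe x₀ (chartPoint x₀ y)).comp (chartFrame x₀ y) = ContinuousLinearMap.id ℝ E7 := by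
  have h := mfderiv_extChartAt_comp_mfderivWithin_extChartAt_symm (I := 𝓡 7) hy
  rw [ModelWithCorners.range_eq_univ, mfderivWithin_univ] at h
  exact h

theorem chartFrame_comp_chartCoframe (x₀ : M) {y : E7} (hy : y ∈ (extChartAt (𝓡 7) x₀).target) :
    (chartFrame x₀ y).comp (chartCoframe x₀ (chartPoint x₀ y)) =
      ContinuousLinearMap.id ℝ (TangentSpace (𝓡 7) (chartPoint x₀ y)) := by
  have h := mfderivWithin_extChartAt_symm_comp_mfderiv_extChartAt (I := 𝓡 7) hy
  rw [ModelWithCorners.range_eq_univ, mfderivWithin_univ] at h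
  exact h

theorem chartCoframe_chartFrame (x₀ : M) {y : E7} (hy : y ∈ (extChartAt (𝓡 7) x₀).target)
    (u : E7) : chartCoframe x₀ (chartPoint x₀ y) (chartFrame x₀ y u) = u :=
  DFunLike.congr_fun (chartCoframe_comp_chartFrame x₀ hy) u

theorem chartFrame_chartCoframe (x₀ : M) {y : E7} (hy : y ∈ (extChartAt (𝓡 7) x₀).target)
    (u : TangentSpace (𝓡 7) (chartPoint x₀ y)) :
    chartFrame x₀ y (chartCoframe x₀ (chartPoint x₀ y) u) = u :=
  DFunLike.congr_fun (chartFrame_comp_chartCoframe x₀ hy) u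

theorem chartPoint_extChartAt (x₀ : M) {x : M} (hx : x ∈ (chartAt E7 x₀).source) :
    chartPoint x₀ (extChartAt (𝓡 7) x₀ x) = x :=
  (extChartAt (𝓡 7) x₀).left_inv (by rwa [extChartAt_source])

theorem chartPoint_mem (x₀ : M) {y : E7} (hy : y ∈ (extChartAt (𝓡 7) x₀).target) :
    chartPoint x₀ y ∈ (chartAt E7 x₀).source := by
  rw [← extChartAt_source (𝓡 7)]
  exact (extChartAt (𝓡 7) x₀).map_target hy

theorem extChartAt_chartPoint (x₀ : M) {y : E7} (hy : y ∈ (extChartAt (𝓡 7) x₀).target) :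
    extChartAt (𝓡 7) x₀ (chartPoint x₀ y) = y :=
  (extChartAt (𝓡 7) x₀).right_inv hy

theorem continuousLinearMapAt_eq (x₀ : M) {x : M} (hx : x ∈ (chartAt E7 x₀).source) :
    (trivializationAt E7 (TangentSpace (𝓡 7)) x₀).continuousLinearMapAt ℝ x = chartCoframe x₀ x :=
  TangentBundle.continuousLinearMapAt_trivializationAt hx

theorem symmL_eq (x₀ : M) {y : E7} (hy : y ∈ (extChartAt (𝓡 7) x₀).target) :
    (trivializationAt E7 (TangentSpace (𝓡 7)) x₀).symmL ℝ (chartPoint x₀ y) = chartFrame x₀ y := by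
  have h := TangentBundle.symmL_trivializationAt (I := 𝓡 7) (𝕜 := ℝ) (chartPoint_mem x₀ hy)
  rw [ModelWithCorners.range_eq_univ, mfderivWithin_univ, extChartAt_chartPoint x₀ hy] at h
  exact h

theorem contMDiffOn_source_iff {G : Type*} [NormedAddCommGroup G] [NormedSpace ℝ G] (x₀ : M)
    {F : M → G} {f : E7 → G} (h : ∀ y ∈ (extChartAt (𝓡 7) x₀).target, F (chartPoint x₀ y) = f y) :
    ContMDiffOn (𝓡 7) 𝓘(ℝ, G) ∞ F (chartAt E7 x₀).source ↔
      ContDiffOn ℝ ∞ f (extChartAt (𝓡 7) x₀).target := by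
  constructor
  · intro hF
    refine ContDiffOn.congr (f := F ∘ chartPoint x₀) ?_ fun y hy => (h y hy).symm
    rw [← contMDiffOn_iff_contDiffOn]
    exact hF.comp (contMDiffOn_extChartAt_symm x₀) fun y hy => chartPoint_mem x₀ hy
  · intro hf
    refine ContMDiffOn.congr (f := f ∘ extChartAt (𝓡 7) x₀) ?_ fun x hx => ?_
    · refine hf.contMDiffOn.comp contMDiffOn_extChartAt fun x hx => ?_
      exact (extChartAt (𝓡 7) x₀).map_source (by rwa [extChartAt_source])
    · rw [Function.comp_apply, ← h _ ((extChartAt (𝓡 7) x₀).map_source (by rwa [extChartAt_source])),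
        chartPoint_extChartAt x₀ hx]

/-- The coordinate expression of a field of bilinear forms in the chart at `x₀`. -/
def chartBil (g : ∀ x : M, TangentSpace (𝓡 7) x →L[ℝ] TangentSpace (𝓡 7) x →L[ℝ] ℝ) (x₀ : M)
    (y : E7) : E7 →L[ℝ] E7 →L[ℝ] ℝ :=
  (ContinuousLinearMap.precomp ℝ (chartFrame x₀ y)).comp
    ((g (chartPoint x₀ y)).comp (chartFrame x₀ y))

theorem chartBil_apply (g : ∀ x : M, TangentSpace (𝓡 7) x →L[ℝ] TangentSpace (𝓡 7) x →L[ℝ] ℝ)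
    (x₀ : M) (y u v : E7) : chartBil g x₀ y u v =
      g (chartPoint x₀ y) (chartFrame x₀ y u) (chartFrame x₀ y v) := rfl

theorem contDiffOn_chartVec {ξ : ∀ x : M, TangentSpace (𝓡 7) x}
    (hξ : ContMDiff (𝓡 7) (𝓡 7).tangent ∞ (fun x => (⟨x, ξ x⟩ : TangentBundle (𝓡 7) M))) (x₀ : M) :
    ContDiffOn ℝ ∞ (chartVec ξ x₀) (extChartAt (𝓡 7) x₀).target := by
  have h := ((trivializationAt E7 (TangentSpace (𝓡 7)) x₀).contMDiffOn_section_baseSet_iff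
    (IB := 𝓡 7) (n := ∞)).1 (hξ.contMDiffOn (s := _))
  rw [TangentBundle.trivializationAt_baseSet] at h
  refine (contMDiffOn_source_iff x₀ fun y hy => ?_).1 h
  have hx := chartPoint_mem x₀ hy
  rw [chartVec, ← continuousLinearMapAt_eq x₀ hx, Trivialization.continuousLinearMapAt_apply,
    Trivialization.linearMapAt_apply, if_pos (by exact hx)]

theorem contDiffOn_chartEndo
    {Φ : ∀ x : M, TangentSpace (𝓡 7) x →L[ℝ] TangentSpace (𝓡 7) x}
    (hΦ : ContMDiff (𝓡 7) ((𝓡 7).prod 𝓘(ℝ, E7 →L[ℝ] E7)) ∞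
      (fun x => TotalSpace.mk' (E7 →L[ℝ] E7)
        (E := fun x : M => TangentSpace (𝓡 7) x →L[ℝ] TangentSpace (𝓡 7) x) x (Φ x))) (x₀ : M) :
    ContDiffOn ℝ ∞ (chartEndo Φ x₀) (extChartAt (𝓡 7) x₀).target := by
  have h := ((trivializationAt (E7 →L[ℝ] E7)
    (fun x : M => TangentSpace (𝓡 7) x →L[ℝ] TangentSpace (𝓡 7) x)
      x₀).contMDiffOn_section_baseSet_iff (IB := 𝓡 7) (n := ∞)).1 (hΦ.contMDiffOn (s := _))
  rw [hom_trivializationAt_baseSet, TangentBundle.trivializationAt_baseSet, Set.inter_self] at h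
  refine (contMDiffOn_source_iff x₀ fun y hy => ?_).1 h
  have hx := chartPoint_mem x₀ hy
  rw [chartEndo, ← continuousLinearMapAt_eq x₀ hx, ← symmL_eq x₀ hy]
  rfl

/-- Both directions are needed: one differentiates the coefficients of a given metric, the other
proves that the rescaled metric is smooth. -/
theorem contMDiff_bil_iff
    {g : ∀ x : M, TangentSpace (𝓡 7) x →L[ℝ] TangentSpace (𝓡 7) x →L[ℝ] ℝ} :
    ContMDiff (𝓡 7) ((𝓡 7).prod 𝓘(ℝ, E7 →L[ℝ] E7 →L[ℝ] ℝ)) ∞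
      (fun x => TotalSpace.mk' (E7 →L[ℝ] E7 →L[ℝ] ℝ)
        (E := fun x : M => TangentSpace (𝓡 7) x →L[ℝ] TangentSpace (𝓡 7) x →L[ℝ] ℝ) x (g x)) ↔
    ∀ x₀, ContDiffOn ℝ ∞ (chartBil g x₀) (extChartAt (𝓡 7) x₀).target := by
  have key : ∀ x₀ : M, ContMDiffOn (𝓡 7) ((𝓡 7).prod 𝓘(ℝ, E7 →L[ℝ] E7 →L[ℝ] ℝ)) ∞
      (fun x => TotalSpace.mk' (E7 →L[ℝ] E7 →L[ℝ] ℝ)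
        (E := fun x : M => TangentSpace (𝓡 7) x →L[ℝ] TangentSpace (𝓡 7) x →L[ℝ] ℝ) x (g x))
        (chartAt E7 x₀).source ↔
      ContDiffOn ℝ ∞ (chartBil g x₀) (extChartAt (𝓡 7) x₀).target := fun x₀ => by
    have h := (trivializationAt (E7 →L[ℝ] E7 →L[ℝ] ℝ)
      (fun x : M => TangentSpace (𝓡 7) x →L[ℝ] TangentSpace (𝓡 7) x →L[ℝ] ℝ)
        x₀).contMDiffOn_section_baseSet_iff (IB := 𝓡 7) (n := ∞) (s := g)
    rw [hom_trivializationAt_baseSet, hom_trivializationAt_baseSet,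
      TangentBundle.trivializationAt_baseSet] at h
    simp only [Bundle.Trivial.trivialization_baseSet, Bundle.Trivial.fiberBundle_trivializationAt', Set.inter_univ,
      Set.inter_self] at h
    refine h.trans (contMDiffOn_source_iff x₀ fun y hy => ?_)
    have hx := chartPoint_mem x₀ hy
    ext u v
    rw [hom_trivializationAt_apply]
    refine (inCoordinates_apply_eq₂ hx hx (Set.mem_univ _)).trans ?_
    have e : ∀ u, (trivializationAt E7 (TangentSpace (𝓡 7)) x₀).symm (chartPoint x₀ y) u =
      chartFrame x₀ y u := fun u => by
      rw [← symmL_eq x₀ hy, Trivialization.symmL_apply _ hx]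
    rw [e, e]
    simp [chartBil_apply]
  constructor
  · exact fun h x₀ => (key x₀).1 h.contMDiffOn
  · exact fun h x => ((key x).2 (h x)).contMDiffAt
      ((chartAt E7 x).open_source.mem_nhds (mem_chart_source E7 x))

end Charts

/-! ### The Levi-Civita connection and the Ricci tensor in a chart -/

section Christoffel

theorem contDiffOn_det {n : Type*} [Fintype n] [DecidableEq n] {U : Set E7}
    {A : E7 → Matrix n n ℝ} (hA : ∀ i j, ContDiffOn ℝ ∞ (fun y => A y i j) U) :
    ContDiffOn ℝ ∞ (fun y => (A y).det) U := by
  simp only [Matrix.det_apply]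
  exact ContDiffOn.sum fun σ _ => (contDiffOn_prod fun i _ => hA (σ i) i).const_smul (Equiv.Perm.sign σ)

theorem contDiffOn_inv {n : Type*} [Fintype n] [DecidableEq n] {U : Set E7}
    {A : E7 → Matrix n n ℝ} (hA : ∀ i j, ContDiffOn ℝ ∞ (fun y => A y i j) U)
    (h0 : ∀ y ∈ U, (A y).det ≠ 0) (i j : n) : ContDiffOn ℝ ∞ (fun y => (A y)⁻¹ i j) U := by
  -- By Cramer's rule the entries of the inverse are quotients of determinants of smooth entries.
  simp only [Matrix.inv_def, Ring.inverse_eq_inv', Matrix.smul_apply, smul_eq_mul,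
    Matrix.adjugate_apply]
  refine ((contDiffOn_det hA).inv h0).mul (contDiffOn_det fun k l => ?_)
  by_cases hk : k = j
  · subst hk
    simp only [Matrix.updateRow_self]
    exact contDiffOn_const
  · simp only [Matrix.updateRow_ne hk]
    exact hA k l

theorem eq_of_single {F : Type*} [AddCommGroup F] [Module ℝ F] {a b : E7 → F}
    (ha : IsLinearMap ℝ a) (hb : IsLinearMap ℝ b)
    (h : ∀ i, a (EuclideanSpace.single i 1) = b (EuclideanSpace.single i 1)) (u : E7) :
    a u = b u := by
  have e : ha.mk' a = hb.mk' b := (EuclideanSpace.basisFun (Fin 7) ℝ).toBasis.ext fun i => by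
    simpa using h i
  exact LinearMap.congr_fun e u

theorem trace_eq_sum_apply (T : E7 →ₗ[ℝ] E7) :
    LinearMap.trace ℝ E7 T = ∑ k, T (EuclideanSpace.single k 1) k := by
  rw [LinearMap.trace_eq_matrix_trace ℝ (EuclideanSpace.basisFun (Fin 7) ℝ).toBasis, Matrix.trace]
  simp [LinearMap.toMatrix_apply]

theorem eq_sum_single (u : E7) : u = ∑ i, u i • EuclideanSpace.single i (1 : ℝ) := by
  have := (EuclideanSpace.basisFun (Fin 7) ℝ).toBasis.sum_repr u
  simpa using this.symm

variable {M : Type*} [TopologicalSpace M] [ChartedSpace E7 M] [IsManifold (𝓡 7) ∞ M]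

/-- The Levi-Civita connection in the chart at `x₀`. -/
def chartConnection (g : RiemMetric M) (x₀ : M) (y : E7) : E7 →L[ℝ] E7 →L[ℝ] E7 :=
  ∑ k, ∑ i, ∑ j, christoffel g x₀ k i j y •
    (EuclideanSpace.proj i : E7 →L[ℝ] ℝ).smulRight
      ((EuclideanSpace.proj j : E7 →L[ℝ] ℝ).smulRight (EuclideanSpace.single k (1 : ℝ) : E7))

variable (g : RiemMetric M) (x₀ : M)

theorem chartConnection_single (y : E7) (i j k : Fin 7) :
    chartConnection g x₀ y (EuclideanSpace.single i 1) (EuclideanSpace.single j 1) k =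
      christoffel g x₀ k i j y := by
  simp [chartConnection, Pi.single_apply]

theorem metricCoeff_apply (y : E7) (i j : Fin 7) : metricCoeff g x₀ y i j =
    chartBil g.inner x₀ y (EuclideanSpace.single i 1) (EuclideanSpace.single j 1) := rfl

theorem metricCoeff_symm (y : E7) (i j : Fin 7) : metricCoeff g x₀ y i j = metricCoeff g x₀ y j i :=
  g.symm _ _ _

theorem christoffel_symm (k i j : Fin 7) (y : E7) :
    christoffel g x₀ k i j y = christoffel g x₀ k j i y := by
  simp only [christoffel]
  congr 1
  refine Finset.sum_congr rfl fun l _ => ?_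
  have h : (fun z => metricCoeff g x₀ z i j) = fun z => metricCoeff g x₀ z j i :=
    funext fun z => metricCoeff_symm g x₀ z i j
  rw [h]
  ring

theorem isMetric_chartBil {y : E7} (hy : y ∈ (extChartAt (𝓡 7) x₀).target) :
    IsMetric (bil (chartBil g.inner x₀ y)) := by
  refine ⟨fun u v => g.symm _ _ _, fun v hv => g.pos _ _ fun h => hv ?_⟩
  exact (chartCoframe_chartFrame x₀ hy v).symm.trans ((congrArg _ h).trans (map_zero _))

theorem det_metricCoeff_ne_zero {y : E7} (hy : y ∈ (extChartAt (𝓡 7) x₀).target) :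
    (metricCoeff g x₀ y).det ≠ 0 := by
  intro h
  obtain ⟨v, hv, hv0⟩ := Matrix.exists_mulVec_eq_zero_iff.2 h
  have hm := isMetric_chartBil g x₀ hy
  have h0 : (∑ i, v i • EuclideanSpace.single i (1 : ℝ) : E7) = 0 := hm.eq_zero <| by
    have e : ∀ i, ∑ j, metricCoeff g x₀ y i j * v j = 0 := fun i => congrFun hv0 i
    simp only [map_sum, map_smul, LinearMap.sum_apply, LinearMap.smul_apply, bil_apply,
      ← metricCoeff_apply, smul_eq_mul]
    refine Finset.sum_eq_zero fun i _ => mul_eq_zero_of_right _ ((e i).symm.trans ?_).symm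
    exact Finset.sum_congr rfl fun j _ => by rw [metricCoeff_symm, mul_comm]
  refine hv (funext fun i => ?_)
  have := congrArg (fun u : E7 => u i) h0
  simpa [Pi.single_apply, Finset.sum_apply] using this

theorem contDiffOn_metricCoeff (i j : Fin 7) :
    ContDiffOn ℝ ∞ (fun y => metricCoeff g x₀ y i j) (extChartAt (𝓡 7) x₀).target := by
  have h := contMDiff_bil_iff.1 g.contMDiff x₀
  exact (h.clm_apply contDiffOn_const).clm_apply contDiffOn_const

theorem contDiffOn_partialDeriv {U : Set E7} (hU : IsOpen U) {u : E7 → ℝ} (hu : ContDiffOn ℝ ∞ u U)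
    (i : Fin 7) : ContDiffOn ℝ ∞ (partialDeriv i u) U :=
  (hu.fderiv_of_isOpen hU (m := ∞) (by simp)).clm_apply contDiffOn_const

theorem contDiffOn_christoffel (k i j : Fin 7) :
    ContDiffOn ℝ ∞ (christoffel g x₀ k i j) (extChartAt (𝓡 7) x₀).target := by
  have hU := isOpen_extChartAt_target (I := 𝓡 7) x₀
  have h := fun i j => contDiffOn_metricCoeff g x₀ i j
  have h' := fun i j k => contDiffOn_partialDeriv hU (h j k) i
  refine contDiffOn_const.mul (ContDiffOn.sum fun l _ => ?_)
  exact (contDiffOn_inv h (fun y hy => det_metricCoeff_ne_zero g x₀ hy) k l).mul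
    (((h' i j l).add (h' j i l)).sub (h' l i j))

theorem differentiableAt_chartConnection {y : E7} (hy : y ∈ (extChartAt (𝓡 7) x₀).target) :
    DifferentiableAt ℝ (chartConnection g x₀) y := by
  have hU := isOpen_extChartAt_target (I := 𝓡 7) x₀
  have h := fun k i j => differentiableAt_of_contDiffOn hU (contDiffOn_christoffel g x₀ k i j) hy
  unfold chartConnection
  exact DifferentiableAt.fun_sum fun k _ => DifferentiableAt.fun_sum fun i _ =>
    DifferentiableAt.fun_sum fun j _ => (h k i j).smul_const _

theorem sum_metricCoeff_mul_christoffel {y : E7} (hy : y ∈ (extChartAt (𝓡 7) x₀).target)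
    (i j k : Fin 7) : ∑ l, metricCoeff g x₀ y k l * christoffel g x₀ l i j y =
      (1 / 2) * (partialDeriv i (fun z => metricCoeff g x₀ z j k) y
      + partialDeriv j (fun z => metricCoeff g x₀ z i k) y
      - partialDeriv k (fun z => metricCoeff g x₀ z i j) y) := by
  set b : Fin 7 → ℝ := fun k => partialDeriv i (fun z => metricCoeff g x₀ z j k) y
      + partialDeriv j (fun z => metricCoeff g x₀ z i k) y
      - partialDeriv k (fun z => metricCoeff g x₀ z i j) y with hb
  have h1 : ∀ l, christoffel g x₀ l i j y = (1 / 2) * ((metricCoeff g x₀ y)⁻¹.mulVec b) l :=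
    fun l => rfl
  have h2 : metricCoeff g x₀ y * (metricCoeff g x₀ y)⁻¹ = 1 :=
    Matrix.mul_nonsing_inv _ (det_metricCoeff_ne_zero g x₀ hy).isUnit
  have h3 : (metricCoeff g x₀ y).mulVec ((metricCoeff g x₀ y)⁻¹.mulVec b) = b := by
    rw [Matrix.mulVec_mulVec, h2, Matrix.one_mulVec]
  have h4 := congrFun h3 k
  rw [Matrix.mulVec, dotProduct] at h4
  change _ = 1 / 2 * b k
  rw [← h4, Finset.mul_sum]
  refine Finset.sum_congr rfl fun l _ => ?_
  rw [h1]
  ring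

theorem isLeviCivita_chartConnection :
    IsLeviCivita (extChartAt (𝓡 7) x₀).target (chartBil g.inner x₀) (chartConnection g x₀) := by
  have hU := isOpen_extChartAt_target (I := 𝓡 7) x₀
  refine ⟨fun y hy => differentiableAt_chartConnection g x₀ hy, fun y hy => ?_, fun y hy => ?_⟩
  · refine fun u v => eq_of_single (a := fun u => chartConnection g x₀ y u v)
      (b := fun u => chartConnection g x₀ y v u) ⟨by simp, by simp⟩ ⟨by simp, by simp⟩
      (fun i => ?_) u
    refine eq_of_single (a := fun v => chartConnection g x₀ y (EuclideanSpace.single i 1) v)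
      (b := fun v => chartConnection g x₀ y v (EuclideanSpace.single i 1))
      ⟨by simp, by simp⟩ ⟨by simp, by simp⟩ (fun j => ?_) v
    ext k
    rw [chartConnection_single, chartConnection_single, christoffel_symm]
  · set B := chartBil g.inner x₀ with hB
    set Γ := chartConnection g x₀ with hΓ
    have hs : ∀ u v, B y u v = B y v u := fun u v => g.symm _ _ _
    -- These are the Christoffel symbols of the first kind. Adding the two that occur in the
    -- compatibility equation leaves a single partial derivative of the metric.
    have key : ∀ i j k, B y (Γ y (EuclideanSpace.single i 1) (EuclideanSpace.single j 1))
        (EuclideanSpace.single k 1) = (1 / 2) * (partialDeriv i (fun z => metricCoeff g x₀ z j k) y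
      + partialDeriv j (fun z => metricCoeff g x₀ z i k) y
      - partialDeriv k (fun z => metricCoeff g x₀ z i j) y) := fun i j k => by
      rw [← sum_metricCoeff_mul_christoffel g x₀ hy, hs,
        eq_sum_single (Γ y (EuclideanSpace.single i 1) (EuclideanSpace.single j 1)), map_sum]
      refine Finset.sum_congr rfl fun l _ => ?_
      rw [map_smul, chartConnection_single, metricCoeff_apply, smul_eq_mul, mul_comm]
    have hd := differentiableAt_of_contDiffOn hU (contMDiff_bil_iff.1 g.contMDiff x₀) hy
    refine fun x u v => eq_of_single (a := fun x => fderiv ℝ B y x u v)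
      (b := fun x => B y (Γ y x u) v + B y u (Γ y x v)) ⟨by simp, by simp⟩
      ⟨by intros; simp; ring, by intros; simp; ring⟩ (fun i => ?_) x
    refine eq_of_single (a := fun u => fderiv ℝ B y (EuclideanSpace.single i 1) u v)
      (b := fun u => B y (Γ y (EuclideanSpace.single i 1) u) v
        + B y u (Γ y (EuclideanSpace.single i 1) v)) ⟨by simp, by simp⟩
      ⟨by intros; simp; ring, by intros; simp; ring⟩ (fun j => ?_) u
    refine eq_of_single (a := fun v => fderiv ℝ B y (EuclideanSpace.single i 1)
        (EuclideanSpace.single j 1) v)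
      (b := fun v => B y (Γ y (EuclideanSpace.single i 1) (EuclideanSpace.single j 1)) v
        + B y (EuclideanSpace.single j 1) (Γ y (EuclideanSpace.single i 1) v))
      ⟨by simp, by simp⟩ ⟨by intros; simp; ring, by intros; simp; ring⟩ (fun k => ?_) v
    have e : fderiv ℝ B y (EuclideanSpace.single i 1) (EuclideanSpace.single j 1)
        (EuclideanSpace.single k 1) = partialDeriv i (fun z => metricCoeff g x₀ z j k) y := by
      change _ = fderiv ℝ (fun z => B z (EuclideanSpace.single j 1) (EuclideanSpace.single k 1)) y
        (EuclideanSpace.single i 1)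
      rw [fderiv_apply_fun₂ hd (differentiableAt_const _) (differentiableAt_const _)]
      simp [hB]
    change fderiv ℝ B y (EuclideanSpace.single i 1) (EuclideanSpace.single j 1)
        (EuclideanSpace.single k 1) = _
    rw [hs (EuclideanSpace.single j 1), key, key, e]
    have hk : (fun z => metricCoeff g x₀ z k j) = fun z => metricCoeff g x₀ z j k :=
      funext fun z => metricCoeff_symm g x₀ z k j
    rw [hk]
    ring

/-- The coordinate formula contracts the upper index with the first curvature argument, so it is the
trace of `x ↦ R(x, ∂ⱼ) ∂ᵢ`, after using the symmetry of the lower indices of `Γ`. -/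
theorem ricciCoeff_eq_trace {y : E7} (hy : y ∈ (extChartAt (𝓡 7) x₀).target) (i j : Fin 7) :
    ricciCoeff g x₀ i j y = LinearMap.trace ℝ E7
      (((curvature (fderiv ℝ (chartConnection g x₀) y) (chartConnection g x₀ y)).flip
        (EuclideanSpace.single j 1)).flip (EuclideanSpace.single i 1)) := by
  set Γ := chartConnection g x₀ with hΓ
  have hd : DifferentiableAt ℝ Γ y := differentiableAt_chartConnection g x₀ hy
  have h1 : ∀ l k i j, fderiv ℝ Γ y (EuclideanSpace.single l 1) (EuclideanSpace.single i 1)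
      (EuclideanSpace.single j 1) k = partialDeriv l (christoffel g x₀ k i j) y := fun l k i j => by
    have e : christoffel g x₀ k i j = fun z => (EuclideanSpace.proj k : E7 →L[ℝ] ℝ)
        (Γ z (EuclideanSpace.single i 1) (EuclideanSpace.single j 1)) :=
      funext fun z => (chartConnection_single g x₀ z i j k).symm
    rw [partialDeriv, e, fderiv_apply_fun (differentiableAt_const _)
      ((hd.clm_apply (differentiableAt_const _)).clm_apply (differentiableAt_const _)),
      fderiv_apply_fun₂ hd (differentiableAt_const _) (differentiableAt_const _)]
    simp
  have h2 : ∀ k l v, Γ y (EuclideanSpace.single k 1) v l =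
      ∑ m, christoffel g x₀ l k m y * v m := fun k l v => by
    conv_lhs => rw [eq_sum_single v]
    simp only [map_sum, map_smul, WithLp.ofLp_sum, Finset.sum_apply, WithLp.ofLp_smul,
      Pi.smul_apply, smul_eq_mul]
    refine Finset.sum_congr rfl fun m _ => ?_
    rw [hΓ, chartConnection_single, mul_comm]
  rw [trace_eq_sum_apply, ricciCoeff]
  refine Finset.sum_congr rfl fun k _ => ?_
  change _ = (curvature (fderiv ℝ Γ y) (Γ y) (EuclideanSpace.single k 1)
    (EuclideanSpace.single j 1) (EuclideanSpace.single i 1)) k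
  rw [curvature_apply]
  simp only [PiLp.add_apply, PiLp.sub_apply]
  rw [h1, h1, h2, h2]
  simp only [hΓ, chartConnection_single]
  have s1 : christoffel g x₀ k i j = christoffel g x₀ k j i :=
    funext fun z => christoffel_symm g x₀ k i j z
  have s2 : christoffel g x₀ k i k = christoffel g x₀ k k i :=
    funext fun z => christoffel_symm g x₀ k i k z
  rw [s1, s2, Finset.sum_sub_distrib, add_sub_assoc]
  congr 2
  · exact Finset.sum_congr rfl fun l _ => by rw [christoffel_symm g x₀ l i j]
  · exact Finset.sum_congr rfl fun l _ => by rw [christoffel_symm g x₀ l i k]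

/-- The Ricci tensor as a trace of the curvature of the Levi-Civita connection in a chart. -/
theorem ricci_eq_trace (x : M) (v w : TangentSpace (𝓡 7) x) :
    ricci g x v w = LinearMap.trace ℝ E7
      (((curvature (fderiv ℝ (chartConnection g x) (extChartAt (𝓡 7) x x))
        (chartConnection g x (extChartAt (𝓡 7) x x))).flip
        (chartCoframe x x w)).flip (chartCoframe x x v)) := by
  have hy := mem_extChartAt_target (I := 𝓡 7) x
  set R := curvature (fderiv ℝ (chartConnection g x) (extChartAt (𝓡 7) x x))
        (chartConnection g x (extChartAt (𝓡 7) x x)) with hR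
  set τ : E7 →ₗ[ℝ] E7 →ₗ[ℝ] ℝ := LinearMap.mk₂ ℝ
    (fun v w => ∑ k, R (EuclideanSpace.single k 1) w v k)
    (by intros; simp [Finset.sum_add_distrib]) (by intros; simp [Finset.mul_sum])
    (by intros; simp [Finset.sum_add_distrib]) (by intros; simp [Finset.mul_sum]) with hτ
  have h : ∀ v w, τ v w = LinearMap.trace ℝ E7 ((R.flip w).flip v) := fun v w => by
    rw [trace_eq_sum_apply]
    rfl
  rw [← h, ricci]
  conv_rhs => rw [eq_sum_single (chartCoframe x x v), eq_sum_single (chartCoframe x x w)]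
  simp only [map_sum, map_smul, LinearMap.sum_apply, LinearMap.smul_apply, smul_eq_mul]
  rw [Finset.sum_comm]
  refine Finset.sum_congr rfl fun j _ => ?_
  rw [Finset.mul_sum]
  refine Finset.sum_congr rfl fun i _ => ?_
  rw [ricciCoeff_eq_trace g x hy, h]
  ring

end Christoffel

/-! ### Rescaling and transport of contact metric structures -/

section Rescaling

variable {V : Type*} [AddCommGroup V] [Module ℝ V]
variable {g : V →ₗ[ℝ] V →ₗ[ℝ] ℝ} {η : V →ₗ[ℝ] ℝ} {ξ : V} {Φ : V →ₗ[ℝ] V}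

namespace IsContactMetric

/-- Rescaling a contact metric structure by `a` along `ξ` and by `b` transversally. -/
theorem rescale (S : IsContactMetric g η ξ Φ) {a b : ℝ} (ha : a ≠ 0) (hb : b ≠ 0)
    {g' : V →ₗ[ℝ] V →ₗ[ℝ] ℝ} {η' : V →ₗ[ℝ] ℝ} {ξ' : V}
    (hg : ∀ u v, g' u v = b ^ 2 * g u v + (a ^ 2 - b ^ 2) * (η u * η v))
    (hη : ∀ u, η' u = a * η u) (hξ : ξ' = a⁻¹ • ξ) : IsContactMetric g' η' ξ' Φ := by
  refine ⟨⟨fun u v => ?_, fun v hv => ?_⟩, ?_, fun v => ?_, fun u v => ?_, fun u v => ?_⟩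
  · rw [hg, hg, S.symm u v]; ring
  -- Positivity rests on `g' v v = a² η(v)² + b² g(Φ v, Φ v)`; when `η v = 0` it is simply `b² g v
  -- v`.
  · have h1 := S.compat v v
    have h2 : 0 ≤ g (Φ v) (Φ v) := by
      by_cases h : Φ v = 0
      · simp [h]
      · exact (S.pos _ h).le
    have h3 := S.pos v hv
    rw [hg]
    by_cases h : η v = 0
    · rw [h]
      have : 0 < b ^ 2 := by positivity
      nlinarith [mul_pos this h3]
    · have h4 : 0 < a ^ 2 * (η v * η v) := by
        have := mul_self_pos.2 h
        positivity
      nlinarith [mul_nonneg (sq_nonneg b) h2]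
  · rw [hη, hξ, map_smul, S.η_ξ, smul_eq_mul, mul_one, mul_inv_cancel₀ ha]
  · rw [S.Φ_sq, hη, hξ, smul_smul]
    congr 2
    field_simp
  · rw [hg, hg, hη, hη, S.compat, S.η_Φ]; ring
  · rw [hg, hg, S.η_Φ, S.η_Φ, S.skew]; ring

theorem hermitian_rescale (S : IsContactMetric g η ξ Φ) {a b : ℝ}
    {g' : V →ₗ[ℝ] V →ₗ[ℝ] ℝ} {η' : V →ₗ[ℝ] ℝ}
    (hg : ∀ u v, g' u v = b ^ 2 * g u v + (a ^ 2 - b ^ 2) * (η u * η v))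
    (hη : ∀ u, η' u = a * η u) (u v : V) :
    hermitian g' η' Φ u v = (b : ℂ) ^ 2 * hermitian g η Φ u v := by
  rw [hermitian, hermitian, hg, hg, hη, hη, S.η_Φ]
  push_cast
  ring

/-- The Hermitian form sees only the transverse part and scales by `b²`, so its 3 × 3 determinant
scales by `b⁶ = (b³)²`. -/
theorem normSq_rescale (S : IsContactMetric g η ξ Φ) {a b : ℝ}
    {g' : V →ₗ[ℝ] V →ₗ[ℝ] ℝ} {η' : V →ₗ[ℝ] ℝ}
    (hg : ∀ u v, g' u v = b ^ 2 * g u v + (a ^ 2 - b ^ 2) * (η u * η v))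
    (hη : ∀ u, η' u = a * η u) {z : ℂ} {u : Fin 3 → V}
    (h : z * (starRingEnd ℂ) z = Matrix.det (Matrix.of fun i j => hermitian g η Φ (u i) (u j))) :
    ((b ^ 3 : ℝ) • z) * (starRingEnd ℂ) ((b ^ 3 : ℝ) • z) =
      Matrix.det (Matrix.of fun i j => hermitian g' η' Φ (u i) (u j)) := by
  have e : (Matrix.of fun i j => hermitian g' η' Φ (u i) (u j)) =
      ((b : ℂ) ^ 2) • Matrix.of fun i j => hermitian g η Φ (u i) (u j) := by
    ext i j
    simp [S.hermitian_rescale hg hη]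
  rw [e, Matrix.det_smul, ← h, Complex.real_smul, map_mul, Complex.conj_ofReal]
  simp only [Fintype.card_fin]
  push_cast
  ring

theorem IsThreeZero.smul {Υ : V [⋀^Fin 3]→ₗ[ℝ] ℂ} (hΥ : IsThreeZero ξ Φ Υ) (a b : ℝ) :
    IsThreeZero (a • ξ) Φ (b • Υ) := by
  refine ⟨fun v w => ?_, fun u v w => ?_⟩
  · have h : Υ ![a • ξ, v, w] = a • Υ ![ξ, v, w] := by
      have e := Υ.map_update_smul ![ξ, v, w] 0 a ξ
      have f0 : ∀ b, Function.update ![ξ, v, w] 0 b = ![b, v, w] := fun b => by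
        funext i; fin_cases i <;> rfl
      rwa [f0, f0] at e
    rw [AlternatingMap.smul_apply, h, hΥ.transversal, smul_zero, smul_zero]
  · rw [AlternatingMap.smul_apply, AlternatingMap.smul_apply, hΥ.type, Complex.real_smul,
      Complex.real_smul]
    ring

end IsContactMetric

/-- Transport of a contact metric structure along an isomorphism. -/
theorem IsContactMetric.transport (S : IsContactMetric g η ξ Φ) {W : Type*} [AddCommGroup W]
    [Module ℝ W] {F : W →ₗ[ℝ] V} {C : V →ₗ[ℝ] W} (hCF : ∀ w, C (F w) = w) (hFC : ∀ v, F (C v) = v)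
    {g' : W →ₗ[ℝ] W →ₗ[ℝ] ℝ} {η' : W →ₗ[ℝ] ℝ} {ξ' : W} {Φ' : W →ₗ[ℝ] W}
    (hg : ∀ u v, g' u v = g (F u) (F v)) (hη : ∀ u, η' u = η (F u)) (hξ : ξ' = C ξ)
    (hΦ : ∀ u, Φ' u = C (Φ (F u))) : IsContactMetric g' η' ξ' Φ' := by
  refine ⟨⟨fun u v => ?_, fun v hv => ?_⟩, ?_, fun v => ?_, fun u v => ?_, fun u v => ?_⟩
  · rw [hg, hg, S.symm]
  · rw [hg]
    refine S.pos _ fun h => hv ?_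
    rw [← hCF v, h, map_zero]
  · rw [hη, hξ, hFC, S.η_ξ]
  · rw [hΦ, hΦ, hFC, S.Φ_sq, hη, hξ, map_add, map_neg, map_smul, hCF]
  · rw [hg, hg, hη, hη, hΦ, hΦ, hFC, hFC, S.compat]
  · rw [hg, hg, hΦ, hΦ, hFC, hFC, S.skew]

end Rescaling

/-! ### The structure on a tangent space -/

section Pointwise

variable {M : Type*} [TopologicalSpace M] [ChartedSpace E7 M] [IsManifold (𝓡 7) ∞ M]

/-- The inner product on a tangent space, as a bilinear form. -/
def RiemMetric.form (g : RiemMetric M) (x : M) :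
    TangentSpace (𝓡 7) x →ₗ[ℝ] TangentSpace (𝓡 7) x →ₗ[ℝ] ℝ :=
  (ContinuousLinearMap.coeLM ℝ) ∘ₗ
    (g.inner x : TangentSpace (𝓡 7) x →ₗ[ℝ] TangentSpace (𝓡 7) x →L[ℝ] ℝ)

theorem RiemMetric.form_apply (g : RiemMetric M) (x : M) (u v : TangentSpace (𝓡 7) x) :
    RiemMetric.form g x u v = g.inner x u v := rfl

theorem isMetric_form (g : RiemMetric M) (x : M) : IsMetric (RiemMetric.form g x) :=
  ⟨g.symm x, g.pos x⟩

theorem finrank_tangentSpace (x : M) : Module.finrank ℝ (TangentSpace (𝓡 7) x) = 7 :=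
  finrank_euclideanSpace_fin

namespace SasakianStructure

variable (S : SasakianStructure M)

/-- The contact form at a point as a covector. -/
def covector (x : M) : TangentSpace (𝓡 7) x →L[ℝ] ℝ :=
  (ContinuousAlternatingMap.ofSubsingleton ℝ (TangentSpace (𝓡 7) x) ℝ (0 : Fin 1)).symm (S.η x)

theorem covector_apply (x : M) (v : TangentSpace (𝓡 7) x) : S.covector x v = S.η x ![v] := by
  have h : ![v] = fun _ : Fin 1 => v := by funext i; fin_cases i; rfl
  rw [h]
  rfl

theorem isContactMetric (x : M) : IsContactMetric (RiemMetric.form S.g x)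
    (S.covector x : TangentSpace (𝓡 7) x →ₗ[ℝ] ℝ) (S.ξ x)
    (S.Φ x : TangentSpace (𝓡 7) x →ₗ[ℝ] TangentSpace (𝓡 7) x) := by
  have hη : ∀ v, (S.covector x : TangentSpace (𝓡 7) x →ₗ[ℝ] ℝ) v = S.η x ![v] := S.covector_apply x
  refine ⟨isMetric_form S.g x, ?_, fun v => ?_, fun u v => ?_, fun u v => ?_⟩
  · rw [hη, S.η_ξ]
  · rw [hη]
    exact S.Φ_sq x v
  · rw [hη, hη]
    exact S.compatible x u v
  · have h : S.dη x ![u, v] = -S.dη x ![v, u] := by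
      have e := (S.dη x).map_swap ![v, u] (i := 0) (j := 1) (by decide)
      refine Eq.trans ?_ e
      change _ = S.dη x _
      congr 1
      funext i; fin_cases i <;> rfl
    rw [S.dη_eq, S.dη_eq, S.g.symm x (S.Φ x v)] at h
    exact h

end SasakianStructure

namespace ContactCalabiYau

variable (S : ContactCalabiYau M)

theorem isThreeZero (x : M) : IsContactMetric.IsThreeZero (S.ξ x)
    (S.Φ x : TangentSpace (𝓡 7) x →ₗ[ℝ] TangentSpace (𝓡 7) x) (S.Υ x).toAlternatingMap :=
  ⟨S.transversal x, S.type_three_zero x⟩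

set_option maxRecDepth 4000 in
theorem normSq (x : M) (u : Fin 3 → TangentSpace (𝓡 7) x) :
    S.Υ x u * (starRingEnd ℂ) (S.Υ x u) = Matrix.det (Matrix.of fun i j =>
      IsContactMetric.hermitian (RiemMetric.form S.g x)
        (S.covector x : TangentSpace (𝓡 7) x →ₗ[ℝ] ℝ)
        (S.Φ x : TangentSpace (𝓡 7) x →ₗ[ℝ] TangentSpace (𝓡 7) x) (u i) (u j)) := by
  have hc := S.isContactMetric x
  have hV := finrank_tangentSpace x
  obtain ⟨e, he⟩ := hc.exists_frame hV
  have hκ : ∀ u v, (S.dη x).toAlternatingMap ![u, v] = RiemMetric.form S.g x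
      ((S.Φ x : TangentSpace (𝓡 7) x →ₗ[ℝ] TangentSpace (𝓡 7) x) u) v := S.dη_eq x
  have h1 := hc.normSq_eq_one_of_normalised he (S.isThreeZero x) hκ (S.normalised x)
  exact hc.normSq_threeZero hV he (S.isThreeZero x) h1 u

/-- The metric `a² η² + b² (g - η²)`. -/
def rescaledInner (a b : ℝ) (x : M) :
    TangentSpace (𝓡 7) x →L[ℝ] TangentSpace (𝓡 7) x →L[ℝ] ℝ :=
  b ^ 2 • S.g.inner x + (a ^ 2 - b ^ 2) • (S.covector x).smulRight (S.covector x)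

theorem rescaledInner_apply (a b : ℝ) (x : M) (u v : TangentSpace (𝓡 7) x) :
    S.rescaledInner a b x u v =
      b ^ 2 * S.g.inner x u v + (a ^ 2 - b ^ 2) * (S.covector x u * S.covector x v) := rfl

end ContactCalabiYau

end Pointwise

/-! ### The rescaled structure in a chart -/

section ChartData

variable {M : Type*} [TopologicalSpace M] [ChartedSpace E7 M] [IsManifold (𝓡 7) ∞ M]

theorem chartForm_apply {p : ℕ} {F : Type*} [NormedAddCommGroup F] [NormedSpace ℝ F]
    (α : DForm M p F) (x₀ : M) (y : E7) (v : Fin p → E7) :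
    chartForm α x₀ y v = α (chartPoint x₀ y) (fun i => chartFrame x₀ y (v i)) := rfl

theorem chartFrame_vecCons_one (x₀ : M) (y u : E7) :
    (fun i => chartFrame x₀ y (![u] i)) = ![chartFrame x₀ y u] := by
  funext i; fin_cases i; rfl

theorem chartFrame_vecCons_two (x₀ : M) (y u v : E7) :
    (fun i => chartFrame x₀ y (![u, v] i)) = ![chartFrame x₀ y u, chartFrame x₀ y v] := by
  funext i; fin_cases i <;> rfl

theorem chartEndo_apply (Φ : ∀ x : M, TangentSpace (𝓡 7) x →L[ℝ] TangentSpace (𝓡 7) x) (x₀ : M)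
    (y u : E7) : chartEndo Φ x₀ y u =
      chartCoframe x₀ (chartPoint x₀ y) (Φ (chartPoint x₀ y) (chartFrame x₀ y u)) := rfl

namespace SasakianStructure

variable (S : SasakianStructure M) (x₀ : M)

/-- The contact form in the chart at `x₀`, as a field of covectors. -/
def chartCovector (y : E7) : E7 →L[ℝ] ℝ :=
  (ContinuousAlternatingMap.ofSubsingletonLIE (𝕜 := ℝ) (E := E7) (F := ℝ) (0 : Fin 1)).symm (chartForm S.η x₀ y)

theorem chartCovector_apply' (y u : E7) : S.chartCovector x₀ y u = chartForm S.η x₀ y ![u] := by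
  have h : ![u] = fun _ : Fin 1 => u := by funext i; fin_cases i; rfl
  rw [h]
  rfl

theorem chartCovector_apply (y u : E7) :
    S.chartCovector x₀ y u = S.covector (chartPoint x₀ y) (chartFrame x₀ y u) := by
  rw [chartCovector_apply', covector_apply, chartForm_apply, chartFrame_vecCons_one]

theorem contDiffOn_chartCovector :
    ContDiffOn ℝ ∞ (S.chartCovector x₀) (extChartAt (𝓡 7) x₀).target :=
  (ContinuousAlternatingMap.ofSubsingletonLIE (𝕜 := ℝ) (E := E7) (F := ℝ)
    (0 : Fin 1)).symm.toContinuousLinearEquiv.toContinuousLinearMap.contDiff.comp_contDiffOn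
      (S.smooth_η x₀)

theorem isContactMetric_chart {y : E7} (hy : y ∈ (extChartAt (𝓡 7) x₀).target) :
    IsContactMetric (bil (chartBil S.g.inner x₀ y)) (S.chartCovector x₀ y : E7 →ₗ[ℝ] ℝ)
      (chartVec S.ξ x₀ y) (chartEndo S.Φ x₀ y : E7 →ₗ[ℝ] E7) :=
  (S.isContactMetric (chartPoint x₀ y)).transport
    (F := (chartFrame x₀ y : E7 →ₗ[ℝ] _)) (C := (chartCoframe x₀ (chartPoint x₀ y) : _ →ₗ[ℝ] E7))
    (chartCoframe_chartFrame x₀ hy) (chartFrame_chartCoframe x₀ hy) (fun _ _ => rfl)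
    (S.chartCovector_apply x₀ y) rfl (fun _ => rfl)

theorem chartForm_dη {y : E7} (hy : y ∈ (extChartAt (𝓡 7) x₀).target) (u v : E7) :
    chartForm S.dη x₀ y ![u, v] = chartBil S.g.inner x₀ y (chartEndo S.Φ x₀ y u) v := by
  rw [chartForm_apply, chartFrame_vecCons_two, S.dη_eq, chartBil_apply, chartEndo_apply,
    chartFrame_chartCoframe x₀ hy]

theorem fderiv_chartCovector {y : E7} (hy : y ∈ (extChartAt (𝓡 7) x₀).target) (u v : E7) :
    fderiv ℝ (S.chartCovector x₀) y u v - fderiv ℝ (S.chartCovector x₀) y v u =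
      chartBil S.g.inner x₀ y (chartEndo S.Φ x₀ y u) v := by
  have hU := isOpen_extChartAt_target (I := 𝓡 7) x₀
  have hd := differentiableAt_of_contDiffOn hU (S.smooth_η x₀) hy
  have hc := differentiableAt_of_contDiffOn hU (S.contDiffOn_chartCovector x₀) hy
  rw [← S.chartForm_dη x₀ hy, ← S.hasExtDeriv_η x₀ y hy, extDeriv_apply hd]
  have h0 : (fun z => chartForm S.η x₀ z ((0 : Fin 2).removeNth ![u, v])) =
      fun z => S.chartCovector x₀ z v := by
    funext z
    rw [chartCovector_apply']
    congr 1
  have h1 : (fun z => chartForm S.η x₀ z ((1 : Fin 2).removeNth ![u, v])) =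
      fun z => S.chartCovector x₀ z u := by
    funext z
    rw [chartCovector_apply']
    congr 1
    funext i; fin_cases i; rfl
  rw [Fin.sum_univ_two, h0, h1, fderiv_apply_const hc, fderiv_apply_const hc]
  simp
  ring

/-- The fields `u` and `v` are constant, so their own bracket vanishes and the other brackets
involve only derivatives of `Φ`. -/
theorem normal_chart {y : E7} (hy : y ∈ (extChartAt (𝓡 7) x₀).target) (u v : E7) :
    fderiv ℝ (chartEndo S.Φ x₀) y (chartEndo S.Φ x₀ y u) v
      - fderiv ℝ (chartEndo S.Φ x₀) y (chartEndo S.Φ x₀ y v) u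
      + chartEndo S.Φ x₀ y (fderiv ℝ (chartEndo S.Φ x₀) y v u)
      - chartEndo S.Φ x₀ y (fderiv ℝ (chartEndo S.Φ x₀) y u v)
      + chartBil S.g.inner x₀ y (chartEndo S.Φ x₀ y u) v • chartVec S.ξ x₀ y = 0 := by
  have hU := isOpen_extChartAt_target (I := 𝓡 7) x₀
  have hd := differentiableAt_of_contDiffOn hU (contDiffOn_chartEndo S.smooth_Φ x₀) hy
  have h := S.normal x₀ y hy u v
  simp only [VectorField.lieBracket, fderiv_apply_const hd, fderiv_fun_const, Pi.zero_apply,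
    zero_apply, S.chartForm_dη x₀ hy] at h
  rw [← h]
  simp only [sub_zero, zero_sub, map_neg, map_zero]
  abel

end SasakianStructure

namespace ContactCalabiYau

variable (S : ContactCalabiYau M) (x₀ : M) {a b : ℝ}

theorem chartBil_rescaledInner (a b : ℝ) (y : E7) : chartBil (S.rescaledInner a b) x₀ y =
    b ^ 2 • chartBil S.g.inner x₀ y +
      (a ^ 2 - b ^ 2) • (S.chartCovector x₀ y).smulRight (S.chartCovector x₀ y) := by
  ext u v
  simp only [chartBil_apply, rescaledInner_apply, S.chartCovector_apply,
    add_apply, smul_apply,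
    ContinuousLinearMap.smulRight_apply, smul_eq_mul]

theorem contDiffOn_rescaledInner (a b : ℝ) :
    ContDiffOn ℝ ∞ (chartBil (S.rescaledInner a b) x₀) (extChartAt (𝓡 7) x₀).target := by
  have hη := S.contDiffOn_chartCovector x₀
  refine ContDiffOn.congr ?_ fun y _ => S.chartBil_rescaledInner x₀ a b y
  exact ((contMDiff_bil_iff.1 S.g.contMDiff x₀).const_smul _).add
    ((hη.smulRight hη).const_smul _)

theorem rescaledInner_chart (a b : ℝ) (y u v : E7) : chartBil (S.rescaledInner a b) x₀ y u v =
    b ^ 2 * chartBil S.g.inner x₀ y u v +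
      (a ^ 2 - b ^ 2) * (S.chartCovector x₀ y u * S.chartCovector x₀ y v) := by
  rw [chartBil_rescaledInner]; rfl

/-- Since `g'(Φ u, v) = b² g(Φ u, v)` and `dη' = a dη`, the constant is `a / b²`. Normality is
unaffected: the factors of `c`, `g'` and `ξ'` multiply to 1. -/
theorem localSasakian (ha : a ≠ 0) (hb : b ≠ 0) :
    LocalSasakian (extChartAt (𝓡 7) x₀).target (a / b ^ 2) (chartBil (S.rescaledInner a b) x₀)
      (fun y => a • S.chartCovector x₀ y) (fun y => a⁻¹ • chartVec S.ξ x₀ y)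
      (chartEndo S.Φ x₀) := by
  have hU := isOpen_extChartAt_target (I := 𝓡 7) x₀
  have hg : ∀ y ∈ (extChartAt (𝓡 7) x₀).target, ∀ u v, chartBil (S.rescaledInner a b) x₀ y
      (chartEndo S.Φ x₀ y u) v = b ^ 2 * chartBil S.g.inner x₀ y (chartEndo S.Φ x₀ y u) v :=
    fun y hy u v => by
      have e : S.chartCovector x₀ y (chartEndo S.Φ x₀ y u) = 0 :=
        (S.isContactMetric_chart x₀ hy).η_Φ u
      rw [rescaledInner_chart, e]
      ring
  refine ⟨hU, by positivity, S.contDiffOn_rescaledInner x₀ a b,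
    (S.contDiffOn_chartCovector x₀).const_smul a, (contDiffOn_chartVec S.smooth_ξ x₀).const_smul _,
    contDiffOn_chartEndo S.smooth_Φ x₀, fun y hy => ?_, fun y hy u v => ?_, fun y hy u v => ?_⟩
  · exact (S.isContactMetric_chart x₀ hy).rescale ha hb (S.rescaledInner_chart x₀ a b y)
      (fun u => rfl) rfl
  · have hc := differentiableAt_of_contDiffOn hU (S.contDiffOn_chartCovector x₀) hy
    rw [hg y hy, fderiv_fun_const_smul hc, ← S.fderiv_chartCovector x₀ hy]
    simp only [smul_apply, smul_eq_mul]
    field_simp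
  · rw [hg y hy, ← S.normal_chart x₀ hy u v, smul_smul]
    congr 2
    field_simp

theorem localVolume (a b : ℝ) :
    LocalVolume (extChartAt (𝓡 7) x₀).target (chartBil (S.rescaledInner a b) x₀)
      (fun y => a • S.chartCovector x₀ y) (fun y => a⁻¹ • chartVec S.ξ x₀ y)
      (chartEndo S.Φ x₀) (fun y => b ^ 3 • chartForm S.Υ x₀ y) := by
  have hU := isOpen_extChartAt_target (I := 𝓡 7) x₀
  refine ⟨(S.smooth_Υ x₀).const_smul _, fun y hy => ?_, fun y hy u => ?_, fun y hy p q u v => ?_⟩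
  · have e : (b ^ 3 • chartForm S.Υ x₀ y).toAlternatingMap =
        b ^ 3 • (chartForm S.Υ x₀ y).toAlternatingMap := rfl
    rw [e]
    refine IsContactMetric.IsThreeZero.smul ⟨fun v w => ?_, fun u v w => ?_⟩ _ _
    · have h := S.transversal (chartPoint x₀ y) (chartFrame x₀ y v) (chartFrame x₀ y w)
      rw [← h]
      change chartForm S.Υ x₀ y _ = _
      rw [chartForm_apply]
      congr 1
      funext i; fin_cases i
      · exact chartFrame_chartCoframe x₀ hy _
      · rfl
      · rfl
    · have h := S.type_three_zero (chartPoint x₀ y) (chartFrame x₀ y u) (chartFrame x₀ y v)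
        (chartFrame x₀ y w)
      change chartForm S.Υ x₀ y _ = Complex.I * chartForm S.Υ x₀ y _
      rw [chartForm_apply, chartForm_apply]
      refine Eq.trans ?_ (h.trans ?_)
      · congr 1
        funext i; fin_cases i
        · exact chartFrame_chartCoframe x₀ hy _
        · rfl
        · rfl
      · congr 2
        funext i; fin_cases i <;> rfl
  · refine (S.isContactMetric_chart x₀ hy).normSq_rescale (S.rescaledInner_chart x₀ a b y)
      (fun u => rfl) ?_
    refine (S.normSq (chartPoint x₀ y) fun i => chartFrame x₀ y (u i)).trans ?_
    congr 2
    ext i j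
    have e : chartFrame x₀ y (chartEndo S.Φ x₀ y (u i)) =
        S.Φ (chartPoint x₀ y) (chartFrame x₀ y (u i)) := chartFrame_chartCoframe x₀ hy _
    simp only [IsContactMetric.hermitian, bil_apply, chartBil_apply, RiemMetric.form_apply,
      ContinuousLinearMap.coe_coe, S.chartCovector_apply, e]
  · have hd := differentiableAt_of_contDiffOn hU (S.smooth_Υ x₀) hy
    have h : extDeriv (chartForm S.Υ x₀) y ![p, q, u, v] = 0 := by
      rw [S.closed_Υ x₀ y hy]; rfl
    have e : ∀ w : Fin 3 → E7, ∀ x, fderiv ℝ (fun z => chartForm S.Υ x₀ z w) y x =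
        fderiv ℝ (chartForm S.Υ x₀) y x w := fun w x => by
      exact fderiv_continuousAlternatingMap_apply_const_apply hd w x
    have r0 : (0 : Fin 4).removeNth ![p, q, u, v] = ![q, u, v] := by
      funext i; fin_cases i <;> rfl
    have r1 : (1 : Fin 4).removeNth ![p, q, u, v] = ![p, u, v] := by
      funext i; fin_cases i <;> rfl
    have r2 : (2 : Fin 4).removeNth ![p, q, u, v] = ![p, q, v] := by
      funext i; fin_cases i <;> rfl
    have r3 : (3 : Fin 4).removeNth ![p, q, u, v] = ![p, q, u] := by
      funext i; fin_cases i <;> rfl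
    rw [extDeriv_apply hd, Fin.sum_univ_four, r0, r1, r2, r3, e, e, e, e] at h
    rw [fderiv_fun_const_smul hd]
    simp only [smul_apply, ContinuousAlternatingMap.smul_apply, ← smul_sub,
      ← smul_add]
    refine smul_eq_zero_of_right _ (Eq.trans ?_ h)
    simp
    ring

end ContactCalabiYau

end ChartData

/-! ### The metric of the G₂-structure and its Ricci tensor -/

section Main

variable {M : Type*} [TopologicalSpace M] [ChartedSpace E7 M] [IsManifold (𝓡 7) ∞ M]

theorem RiemMetric.ext_inner {g g' : RiemMetric M}
    (h : ∀ x (u v : TangentSpace (𝓡 7) x), g.inner x u v = g'.inner x u v) : g = g' := by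
  have e : g.inner = g'.inner := by
    funext x
    ext u v
    exact h x u v
  cases g
  cases g'
  congr

namespace ContactCalabiYau

variable (S : ContactCalabiYau M) {a b : ℝ}

/-- The tensor `a² η² + b² (g - η²)` at a point, as a bilinear form. -/
def rescaledForm (a b : ℝ) (x : M) :
    TangentSpace (𝓡 7) x →ₗ[ℝ] TangentSpace (𝓡 7) x →ₗ[ℝ] ℝ :=
  (ContinuousLinearMap.coeLM ℝ) ∘ₗ
    (S.rescaledInner a b x : TangentSpace (𝓡 7) x →ₗ[ℝ] TangentSpace (𝓡 7) x →L[ℝ] ℝ)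

theorem isContactMetric_rescaled (ha : a ≠ 0) (hb : b ≠ 0) (x : M) :
    IsContactMetric (S.rescaledForm a b x)
      ((a • S.covector x : TangentSpace (𝓡 7) x →L[ℝ] ℝ) : TangentSpace (𝓡 7) x →ₗ[ℝ] ℝ)
      (a⁻¹ • S.ξ x) (S.Φ x : TangentSpace (𝓡 7) x →ₗ[ℝ] TangentSpace (𝓡 7) x) :=
  (S.isContactMetric x).rescale ha hb (S.rescaledInner_apply a b x) (fun _ => rfl) rfl

theorem isVonNBounded_rescaledInner (ha : a ≠ 0) (hb : b ≠ 0) (x : M) :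
    Bornology.IsVonNBounded ℝ
      {v : TangentSpace (𝓡 7) x | S.rescaledInner a b x v v < 1} := by
  -- With this `c` one has `c² g ≤ g'`, so the unit ball of `g'` lies in the image under `c⁻¹` of
  -- that of `g`, which is bounded.
  obtain ⟨c, hc, hca, hcb⟩ : ∃ c : ℝ, 0 < c ∧ c ^ 2 ≤ a ^ 2 ∧ c ^ 2 ≤ b ^ 2 := by
    refine ⟨min |a| |b|, lt_min (abs_pos.2 ha) (abs_pos.2 hb), ?_, ?_⟩
    · rw [sq_le_sq, abs_of_nonneg (le_min (abs_nonneg a) (abs_nonneg b))]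
      exact min_le_left _ _
    · rw [sq_le_sq, abs_of_nonneg (le_min (abs_nonneg a) (abs_nonneg b))]
      exact min_le_right _ _
  have hs := (S.g.isVonNBounded x).image
    (c⁻¹ • ContinuousLinearMap.id ℝ (TangentSpace (𝓡 7) x))
  refine hs.subset ?_
  intro v hv
  refine ⟨c • v, ?_, ?_⟩
  · have h0 : 0 ≤ S.g.inner x v v - S.covector x v * S.covector x v := by
      have h := (S.isContactMetric x).compat v v
      have h' : 0 ≤ S.g.inner x (S.Φ x v) (S.Φ x v) := by
        by_cases hz : S.Φ x v = 0
        · simp [hz]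
        · exact (S.g.pos x _ hz).le
      exact h'.trans_eq h
    have h1 : S.rescaledInner a b x v v < 1 := hv
    rw [rescaledInner_apply] at h1
    change S.g.inner x (c • v) (c • v) < 1
    simp only [map_smul, smul_apply, smul_eq_mul]
    nlinarith [mul_nonneg (sub_nonneg.2 hcb) h0,
      mul_nonneg (sub_nonneg.2 hca) (mul_self_nonneg (S.covector x v))]
  · simp only [smul_apply, ContinuousLinearMap.id_apply]
    rw [smul_smul, inv_mul_cancel₀ hc.ne', one_smul]

/-- The Riemannian metric `a² η² + b² (g - η²)`. -/
def rescaledMetric (ha : a ≠ 0) (hb : b ≠ 0) : RiemMetric M where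
  inner := S.rescaledInner a b
  symm x := (S.isContactMetric_rescaled ha hb x).symm
  pos x := (S.isContactMetric_rescaled ha hb x).pos
  isVonNBounded := S.isVonNBounded_rescaledInner ha hb
  contMDiff := contMDiff_bil_iff.2 fun x₀ => S.contDiffOn_rescaledInner x₀ a b

/-- The coefficients are distributed so that each factor belongs to the rescaled structure, to which
the pointwise result `IsContactMetric.exists_wedge_phi` applies. -/
theorem phi_eq (a b : ℝ) (x : M) : S.phi a b x =
    wedge (a • (S.η x).toAlternatingMap) (b ^ 2 • (S.dη x).toAlternatingMap)
      + rePart (b ^ 3 • (S.Υ x).toAlternatingMap) := by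
  have h1 : wedge (a • (S.η x).toAlternatingMap) (b ^ 2 • (S.dη x).toAlternatingMap) =
      (a * b ^ 2) • wedge (S.η x).toAlternatingMap (S.dη x).toAlternatingMap := by
    ext v
    have hv : v = ![v 0, v 1, v 2] := by funext i; fin_cases i <;> rfl
    rw [hv]
    simp only [AlternatingMap.smul_apply, wedge_one_two, smul_eq_mul]
    ring
  have h2 : rePart (b ^ 3 • (S.Υ x).toAlternatingMap) =
      b ^ 3 • rePart (S.Υ x).toAlternatingMap := by
    ext v
    exact Complex.re_ofReal_mul _ _
  rw [h1, h2]
  rfl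

theorem exists_wedge_phi (ha : a ≠ 0) (hb : b ≠ 0) (x : M) :
    ∃ B : Module.Basis (Fin 7) ℝ (TangentSpace (𝓡 7) x),
      (∀ i j, S.rescaledForm a b x (B i) (B j) = if i = j then 1 else 0) ∧
      IsUnitVolume (fun u v => S.rescaledForm a b x u v) B.det ∧
      ∀ X Y, wedge (wedge ((S.phi a b x).curryLeft X) ((S.phi a b x).curryLeft Y)) (S.phi a b x) =
        (6 * S.rescaledForm a b x X Y) • B.det := by
  have hc := S.isContactMetric_rescaled ha hb x
  have hV := finrank_tangentSpace x
  have hΥ := (S.isThreeZero x).smul a⁻¹ (b ^ 3)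
  obtain ⟨e, he, h1⟩ := hc.exists_special_frame_of_normSq hV hΥ fun u =>
    (S.isContactMetric x).normSq_rescale (S.rescaledInner_apply a b x) (fun _ => rfl)
      (S.normSq x u)
  refine hc.exists_wedge_phi hV he hΥ h1 (κ := b ^ 2 • (S.dη x).toAlternatingMap)
    (η₁ := a • (S.η x).toAlternatingMap) (fun u v => ?_) (fun u => ?_) (S.phi_eq a b x)
  · have h := S.dη_eq x u v
    have hΦ : S.covector x (S.Φ x u) = 0 := (S.isContactMetric x).η_Φ u
    change b ^ 2 * S.dη x ![u, v] = S.rescaledInner a b x (S.Φ x u) v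
    rw [h, rescaledInner_apply, hΦ]
    ring
  · change a * S.η x ![u] = a * S.covector x u
    rw [S.covector_apply]

theorem inducesMetric_rescaledMetric (ha : a ≠ 0) (hb : b ≠ 0) :
    InducesMetric (S.phi a b) (S.rescaledMetric ha hb) := fun x => by
  obtain ⟨B, -, hv, h⟩ := S.exists_wedge_phi ha hb x
  exact ⟨B.det, hv, h⟩

theorem eq_rescaledMetric (ha : a ≠ 0) (hb : b ≠ 0) {g : RiemMetric M}
    (hg : InducesMetric (S.phi a b) g) : g = S.rescaledMetric ha hb := by
  refine RiemMetric.ext_inner fun x u v => ?_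
  obtain ⟨B, hB, -, h⟩ := S.exists_wedge_phi ha hb x
  obtain ⟨vol, hvol, h'⟩ := hg x
  exact IsContactMetric.metric_unique (isMetric_form g x) hB hvol
    (fun X Y => (h X Y).symm.trans (h' X Y)) u v

theorem chartBil_chartCoframe (g : ∀ x : M, TangentSpace (𝓡 7) x →L[ℝ] TangentSpace (𝓡 7) x →L[ℝ] ℝ)
    (x₀ : M) {x : M} (hx : x ∈ (chartAt E7 x₀).source) (v w : TangentSpace (𝓡 7) x) :
    chartBil g x₀ (extChartAt (𝓡 7) x₀ x) (chartCoframe x₀ x v) (chartCoframe x₀ x w) =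
      g x v w := by
  obtain ⟨y, hy, rfl⟩ : ∃ y ∈ (extChartAt (𝓡 7) x₀).target, chartPoint x₀ y = x :=
    ⟨_, (extChartAt (𝓡 7) x₀).map_source (by rwa [extChartAt_source]), chartPoint_extChartAt x₀ hx⟩
  rw [extChartAt_chartPoint x₀ hy, chartBil_apply, chartFrame_chartCoframe x₀ hy,
    chartFrame_chartCoframe x₀ hy]

theorem chartCovector_chartCoframe (x₀ : M) {x : M} (hx : x ∈ (chartAt E7 x₀).source)
    (v : TangentSpace (𝓡 7) x) :
    S.chartCovector x₀ (extChartAt (𝓡 7) x₀ x) (chartCoframe x₀ x v) = S.covector x v := by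
  obtain ⟨y, hy, rfl⟩ : ∃ y ∈ (extChartAt (𝓡 7) x₀).target, chartPoint x₀ y = x :=
    ⟨_, (extChartAt (𝓡 7) x₀).map_source (by rwa [extChartAt_source]), chartPoint_extChartAt x₀ hx⟩
  rw [extChartAt_chartPoint x₀ hy, S.chartCovector_apply, chartFrame_chartCoframe x₀ hy]

theorem ricci_rescaledMetric (ha : a ≠ 0) (hb : b ≠ 0) (x : M) (v w : TangentSpace (𝓡 7) x) :
    ricci (S.rescaledMetric ha hb) x v w =
      3 * a ^ 4 / (2 * b ^ 4) * (S.η x ![v] * S.η x ![w])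
        - a ^ 2 / (2 * b ^ 2) * S.gD x v w := by
  have hx := mem_chart_source E7 x
  -- With `c = a / b²` and `η' = a η`, the coefficients become `(3c²/2) a² = 3a⁴/(2b⁴)` and `(c²/2)
  -- b² = a²/(2b²)`.
  rw [ricci_eq_trace, (S.localSasakian x ha hb).trace_curvature
    (isLeviCivita_chartConnection (S.rescaledMetric ha hb) x) finrank_euclideanSpace_fin
    (S.localVolume x a b) ((extChartAt (𝓡 7) x).map_source (mem_extChartAt_source x))]
  have h1 := chartBil_chartCoframe (S.rescaledInner a b) x hx w v
  simp only [h1, rescaledInner_apply, smul_apply,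
    S.chartCovector_chartCoframe x hx, S.covector_apply, smul_eq_mul, gD, S.g.symm x w v]
  field_simp
  ring

end ContactCalabiYau

end Main

end ContactCY

end

open ContactCY in
theorem proposition2p5 {M : Type*} [TopologicalSpace M] [T2Space M] [SecondCountableTopology M]
    [ChartedSpace (EuclideanSpace ℝ (Fin 7)) M] [IsManifold (𝓡 7) ∞ M]
    (S : ContactCalabiYau M) (f h : ℝ → ℝ) (t : ℝ) (hf : f t ≠ 0) (hh : h t ≠ 0) :
    (∃! g : RiemMetric M, InducesMetric (S.phi (f t) (h t)) g) ∧
    ∀ g : RiemMetric M, InducesMetric (S.phi (f t) (h t)) g →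
      ∀ (x : M) (v w : TangentSpace (𝓡 7) x),
        ricci g x v w =
          3 * f t ^ 4 / (2 * h t ^ 4) * (S.η x ![v] * S.η x ![w])
            - f t ^ 2 / (2 * h t ^ 2) * S.gD x v w := by
  refine ⟨⟨S.rescaledMetric hf hh, S.inducesMetric_rescaledMetric hf hh,
    fun g hg => S.eq_rescaledMetric hf hh hg⟩, fun g hg x v w => ?_⟩
  rw [S.eq_rescaledMetric hf hh hg, S.ricci_rescaledMetric hf hh]
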